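/- Manifolds are smooth, real, finite-dimensional, Hausdorff and without boundary. For a manifold $N$ let $\Omega^p(N)$ be the smooth $p$-forms and $\Omega^k(N,TN)=\Gamma(\wedge^kT^*N\otimes TN)$ the smooth vector-valued $k$-forms ($k\ge 0$), regarded as maps $\oplus^kTN\to TN$. For $K\in\Omega^k(N,TN)$ and $\omega\in\Omega^{p}(N)$ with $p\ge 1$ put $$(i_K\omega)(X_1,\dots,X_{k+p-1})=\frac{1}{k!\,(p-1)!}\sum_{\sigma\in S_{k+p-1}}\mathrm{sgn}(\sigma)\,\omega\bigl(K(X_{\sigma(1)},\dots,X_{\sigma(k)}),X_{\sigma(k+1)},\dots,X_{\sigma(k+p-1)}\bigr),$$ let $i_K=0$ on $\Omega^0(N)$, and let $\mathcal L_K=d\,i_K-(-1)^{k-1}i_K\,d$. A Frölicher–Nijenhuis bracket of $K\in\Omega^k(N,TN)$ and $L\in\Omega^l(N,TN)$ is a form $[K,L]\in\Omega^{k+l}(N,TN)$ with $\mathcal L_{[K,L]}=\mathcal L_K\mathcal L_L-(-1)^{kl}\mathcal L_L\mathcal L_K$ on $\Omega^p(N)$ for all $p\ge 0$. Let $\mathcal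 G\rightrightarrows M$ be a Lie groupoid with source $s$, target $t$ and multiplication $m:\mathcal G^{(2)}=\{(g,h): s(g)=t(h)\}\to\mathcal G$. A form $K\in\Omega^k(\mathcal G,T\mathcal G)$ is multiplicative if there is $K_M\in\Omega^k(M,TM)$ such that $(K,K_M)$ is a groupoid morphism from $\oplus^kT\mathcal G\rightrightarrows\oplus^kTM$ to $T\mathcal G\rightrightarrows TM$ (the structure maps being the differentials $Ts,Tt,Tm$, taken componentwise), that is: - $Ts(K(X_1,\dots,X_k))=K_M(Ts\,X_1,\dots,Ts\,X_k)$ and $Tt(K(X_1,\dots,X_k))=K_M(Tt\,X_1,\dots,Tt\,X_k)$ for all $g\in\mathcal G$ and $X_i\in T_g\mathcal G$; - $K(Tm(X_1,Y_1),\dots,Tm(X_k,Y_k))=Tm(K(X_1,\dots,X_k),K(Y_1,\dots,Y_k))$ for all $(g,h)\in\mathcal G^{(2)}$ and $X_i\in T_g\mathcal G$, $Y_i\in T_h\mathcal G$ with $Ts\,X_i=Tt\,Y_i$. **Theorem.** For all $k,l\ge 0$, $K\in\Omega^k(\mathcal G,T\mathcal G)$ and $L\in\Omega^l(\mathcal G,T\mathcal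 G)$, the Frölicher–Nijenhuis bracket $[K,L]\in\Omega^{k+l}(\mathcal G,T\mathcal G)$ exists and is unique. If $K$ and $L$ are multiplicative, then $[K,L]$ is multiplicative. Moreover, for every $k\ge0$ the multiplicative forms are a linear subspace of $\Omega^k(\mathcal G,T\mathcal G)$. Hence the multiplicative vector-valued forms are a graded Lie subalgebra of $\bigl(\Omega^\bullet(\mathcal G,T\mathcal G),[\cdot,\cdot]\bigr)$, i.e. a graded linear subspace closed under the bracket. -/

import Mathlib

open scoped Manifold ContDiff

noncomputable section

/-! ### Insertion of a vector-valued alternating form into a scalar one -/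

section Insertion

variable {V : Type*}

theorem castAdd_update {k p : ℕ} (v : Fin (k + p) → V) (a : Fin k) (x : V) :
    (fun i => Function.update v (Fin.castAdd p a) x (Fin.castAdd p i)) =
      Function.update (fun i => v (Fin.castAdd p i)) a x := by
  ext i
  by_cases h : i = a <;> simp [h]

theorem natAdd_update {k p : ℕ} (v : Fin (k + p) → V) (b : Fin p) (x : V) :
    (fun j => Function.update v (Fin.natAdd k b) x (Fin.natAdd k j)) =
      Function.update (fun j => v (Fin.natAdd k j)) b x := by
  ext j
  by_cases h : j = b <;> simp [h]

theorem castAdd_update_natAdd {k p : ℕ} (v : Fin (k + p) → V) (b : Fin p) (x : V) :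
    (fun i => Function.update v (Fin.natAdd k b) x (Fin.castAdd p i)) =
      fun i => v (Fin.castAdd p i) := by
  ext i
  have h : Fin.castAdd p i ≠ Fin.natAdd k b := by
    intro h; have := congrArg Fin.val h; simp at this; omega
  simp [h]

theorem natAdd_update_castAdd {k p : ℕ} (v : Fin (k + p) → V) (a : Fin k) (x : V) :
    (fun j => Function.update v (Fin.castAdd p a) x (Fin.natAdd k j)) =
      fun j => v (Fin.natAdd k j) := by
  ext j
  have h : Fin.natAdd k j ≠ Fin.castAdd p a := by
    intro h; have := congrArg Fin.val h; simp at this; omega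
  simp [h]

variable [AddCommGroup V] [Module ℝ V] [TopologicalSpace V]

/-- The multilinear map `(X₁, …, X_{k+p}) ↦ η (K (X₁, …, X_k), X_{k+1}, …, X_{k+p})`. -/
def insertMultilinear {k p : ℕ} (K : V [⋀^Fin k]→L[ℝ] V) (η : V [⋀^Fin (p + 1)]→L[ℝ] ℝ) :
    ContinuousMultilinearMap ℝ (fun _ : Fin (k + p) => V) ℝ where
  toFun v := η (Fin.cons (K fun i => v (Fin.castAdd p i)) fun j => v (Fin.natAdd k j))
  map_update_add' := by
    intro inst v i x y
    obtain rfl : inst = fun a b => instDecidableEqFin (k + p) a b := Subsingleton.elim _ _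
    refine Fin.addCases (fun a => ?_) (fun b => ?_) i
    · simp only [castAdd_update, natAdd_update_castAdd, K.map_update_add]
      exact η.toMultilinearMap.cons_add _ _ _
    · simp only [castAdd_update_natAdd, natAdd_update, Fin.cons_update, η.map_update_add]
  map_update_smul' := by
    intro inst v i c x
    obtain rfl : inst = fun a b => instDecidableEqFin (k + p) a b := Subsingleton.elim _ _
    refine Fin.addCases (fun a => ?_) (fun b => ?_) i
    · simp only [castAdd_update, natAdd_update_castAdd, K.map_update_smul]
      exact η.toMultilinearMap.cons_smul _ _ _
    · simp only [castAdd_update_natAdd, natAdd_update, Fin.cons_update, η.map_update_smul]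
  cont := by
    refine η.cont.comp (continuous_pi fun j => ?_)
    refine Fin.cases ?_ (fun j => ?_) j
    · exact K.cont.comp (continuous_pi fun i => continuous_apply (Fin.castAdd p i))
    · exact continuous_apply (Fin.natAdd k j)

/-- The insertion `i_K η` at one point, for `K` of degree `k` and `η` of degree `p + 1`:
`(i_K η)(X₁, …, X_{k+p}) = (1 / (k! p!)) ∑_σ sgn(σ) η(K(X_{σ1}, …, X_{σk}), X_{σ(k+1)}, …)`. -/
def insertForm {k p : ℕ} (K : V [⋀^Fin k]→L[ℝ] V) (η : V [⋀^Fin (p + 1)]→L[ℝ] ℝ) :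
    V [⋀^Fin (k + p)]→L[ℝ] ℝ :=
  ((k.factorial : ℝ) * (p.factorial : ℝ))⁻¹ •
    ContinuousMultilinearMap.alternatization (insertMultilinear K η)

theorem insertForm_apply {k p : ℕ} (K : V [⋀^Fin k]→L[ℝ] V) (η : V [⋀^Fin (p + 1)]→L[ℝ] ℝ)
    (X : Fin (k + p) → V) :
    insertForm K η X = ((k.factorial : ℝ) * (p.factorial : ℝ))⁻¹ *
      ∑ σ : Equiv.Perm (Fin (k + p)), (Equiv.Perm.sign σ : ℝ) *
        η (Fin.cons (K fun i => X (σ (Fin.castAdd p i))) fun j => X (σ (Fin.natAdd k j))) := by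
  rw [insertForm, ContinuousAlternatingMap.smul_apply,
    ContinuousMultilinearMap.alternatization_apply_apply, smul_eq_mul]
  congr 1
  refine Finset.sum_congr rfl fun σ _ => ?_
  rw [Units.smul_def, zsmul_eq_mul]
  rfl

end Insertion

/-! ### Differential forms and vector-valued forms on a manifold -/

section Forms

variable {E : Type*} [NormedAddCommGroup E] [NormedSpace ℝ E]
  {H : Type*} [TopologicalSpace H] (I : ModelWithCorners ℝ E H)
  (N : Type*) [TopologicalSpace N] [ChartedSpace H N]

/-- A (not necessarily smooth) field of alternating `p`-forms on the tangent spaces of `N`. -/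
abbrev FormField (p : ℕ) : Type _ := ∀ x : N, TangentSpace I x [⋀^Fin p]→L[ℝ] ℝ

/-- A (not necessarily smooth) field of tangent-valued alternating `k`-forms on `N`. -/
abbrev VectorFormField (k : ℕ) : Type _ :=
  ∀ x : N, TangentSpace I x [⋀^Fin k]→L[ℝ] TangentSpace I x

variable {N}

/-- The differential at `y` of the inverse of the chart at `x₀`, as a map `E → T N`. -/
def chartInvDeriv (x₀ : N) (y : E) : E →L[ℝ] TangentSpace I ((extChartAt I x₀).symm y) :=
  (mfderiv 𝓘(ℝ, E) I (extChartAt I x₀).symm y).comp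
    (NormedSpace.fromTangentSpace (𝕜 := ℝ) y).symm.toContinuousLinearMap

/-- The differential at `x` of the chart at `x₀`, as a map `T_x N → E`. -/
def chartDeriv (x₀ x : N) : TangentSpace I x →L[ℝ] E :=
  (NormedSpace.fromTangentSpace (𝕜 := ℝ) (extChartAt I x₀ x)).toContinuousLinearMap.comp
    (mfderiv I 𝓘(ℝ, E) (extChartAt I x₀) x)

variable {I}

/-- The coordinate expression of a form in the chart at `x₀`, i.e. its pullback by the inverse
chart. -/
def FormField.inChart {p : ℕ} (η : FormField I N p) (x₀ : N) (y : E) : E [⋀^Fin p]→L[ℝ] ℝ :=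
  (η ((extChartAt I x₀).symm y)).compContinuousLinearMap (chartInvDeriv I x₀ y)

/-- The coordinate expression of a vector-valued form in the chart at `x₀`. -/
def VectorFormField.inChart {k : ℕ} (K : VectorFormField I N k) (x₀ : N) (y : E) :
    E [⋀^Fin k]→L[ℝ] E :=
  (chartDeriv I x₀ ((extChartAt I x₀).symm y)).compContinuousAlternatingMap
    ((K ((extChartAt I x₀).symm y)).compContinuousLinearMap (chartInvDeriv I x₀ y))

variable (I N)

/-- `Ω^p(N)`: the smooth differential `p`-forms. -/
def smoothForms (p : ℕ) : Submodule ℝ (FormField I N p) where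
  carrier := {η | ∀ x₀ : N, ContDiffOn ℝ ∞ (η.inChart x₀) (extChartAt I x₀).target}
  add_mem' := fun ha hb x₀ => (ha x₀).add (hb x₀)
  zero_mem' := fun _ => contDiffOn_const (c := 0)
  smul_mem' := fun c _ ha x₀ => (ha x₀).const_smul c

/-- `Ω^k(N, TN)`: the smooth vector-valued `k`-forms. -/
def vectorForms (k : ℕ) : Submodule ℝ (VectorFormField I N k) where
  carrier := {K | ∀ x₀ : N, ContDiffOn ℝ ∞ (K.inChart x₀) (extChartAt I x₀).target}
  add_mem' := fun {a b} ha hb x₀ => by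
    refine ((ha x₀).add (hb x₀)).congr fun y _ => ?_
    ext v
    exact map_add (chartDeriv I x₀ _) _ _
  zero_mem' := fun x₀ => by
    refine (contDiffOn_const (c := 0)).congr fun y _ => ?_
    ext v
    exact map_zero (chartDeriv I x₀ _)
  smul_mem' := fun c a ha x₀ => by
    refine ((ha x₀).const_smul c).congr fun y _ => ?_
    ext v
    exact map_smul (chartDeriv I x₀ _) _ _

variable {I N}

/-- The exterior differential, computed at each point `x` in the preferred chart at `x`. -/
def extDifferential {p : ℕ} (η : FormField I N p) : FormField I N (p + 1) := fun x =>
  (extDeriv (η.inChart x) (extChartAt I x x)).compContinuousLinearMap (chartDeriv I x x)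

/-- `i_K : Ω^{p+1}(N) → Ω^{k+p}(N)`; on functions `i_K` is zero. -/
def insertField {k p : ℕ} (K : VectorFormField I N k) (η : FormField I N (p + 1)) :
    FormField I N (k + p) := fun x => insertForm (K x) (η x)

/-- `𝓛_K = [d, i_K] = d i_K - (-1)^{k-1} i_K d : Ω^p(N) → Ω^{k+p}(N)`,
where `-(-1)^{k-1} = (-1)^k` and `i_K` vanishes on `Ω^0(N)`. -/
def lieDerivative {k : ℕ} (K : VectorFormField I N k) :
    ∀ {p : ℕ}, FormField I N p → FormField I N (k + p)
  | 0, f => (-1 : ℝ) ^ k • insertField K (extDifferential f)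
  | _ + 1, η =>
      extDifferential (insertField K η) + (-1 : ℝ) ^ k • insertField K (extDifferential η)

/-- `B` is the Frölicher–Nijenhuis bracket of `K` and `L`:
`𝓛_B = 𝓛_K 𝓛_L - (-1)^{kl} 𝓛_L 𝓛_K` on all smooth differential forms.
The three terms have degrees `(k + l) + p`, `k + (l + p)`, `l + (k + p)`, identified by
`Fin.cast`. -/
def IsFrolicherNijenhuisBracket {k l : ℕ} (K : VectorFormField I N k) (L : VectorFormField I N l)
    (B : VectorFormField I N (k + l)) : Prop :=
  ∀ (p : ℕ), ∀ η ∈ smoothForms I N p, ∀ (x : N) (X : Fin (k + l + p) → TangentSpace I x),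
    lieDerivative B η x X =
      lieDerivative K (lieDerivative L η) x
          (fun i => X (Fin.cast (Nat.add_assoc k l p).symm i)) -
        (-1 : ℝ) ^ (k * l) * lieDerivative L (lieDerivative K η) x
          (fun i => X (Fin.cast (by omega : l + (k + p) = k + l + p) i))

end Forms

/-! ### Lie groupoids and multiplicative vector-valued forms -/

section Groupoids

variable {E : Type*} [NormedAddCommGroup E] [NormedSpace ℝ E]
  {H : Type*} [TopologicalSpace H] (I : ModelWithCorners ℝ E H)
  {E' : Type*} [NormedAddCommGroup E'] [NormedSpace ℝ E']
  {H' : Type*} [TopologicalSpace H'] (J : ModelWithCorners ℝ E' H')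
  (G : Type*) [TopologicalSpace G] [ChartedSpace H G]
  (M : Type*) [TopologicalSpace M] [ChartedSpace H' M]

/-- A Lie groupoid `G ⇉ M`. The multiplication is a total function of which only the values on
`{(g, h) | s g = t h}` matter. As `s` and `t` are submersions, this set is an embedded
submanifold of `G × G`, and `ContMDiffOn` on it is smoothness for the submanifold structure. -/
structure LieGroupoid where
  source : G → M
  target : G → M
  unit : M → G
  inv : G → G
  mul : G → G → G
  source_unit : ∀ x, source (unit x) = x
  target_unit : ∀ x, target (unit x) = x
  source_mul : ∀ g h, source g = target h → source (mul g h) = source h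
  target_mul : ∀ g h, source g = target h → target (mul g h) = target g
  mul_assoc : ∀ g h k, source g = target h → source h = target k →
    mul (mul g h) k = mul g (mul h k)
  unit_mul : ∀ g, mul (unit (target g)) g = g
  mul_unit : ∀ g, mul g (unit (source g)) = g
  source_inv : ∀ g, source (inv g) = target g
  target_inv : ∀ g, target (inv g) = source g
  inv_mul : ∀ g, mul (inv g) g = unit (source g)
  mul_inv : ∀ g, mul g (inv g) = unit (target g)
  submersion_source : Manifold.IsSubmersion I J ∞ source
  submersion_target : Manifold.IsSubmersion I J ∞ target
  smooth_unit : ContMDiff J I ∞ unit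
  smooth_inv : ContMDiff I I ∞ inv
  smooth_mul : ContMDiffOn (I.prod I) I ∞ (fun q : G × G => mul q.1 q.2)
    {q | source q.1 = target q.2}

variable {I J G M}

namespace LieGroupoid

variable (𝒢 : LieGroupoid I J G M)

/-- The space of composable arrows `G⁽²⁾`. -/
def composable : Set (G × G) := {q | 𝒢.source q.1 = 𝒢.target q.2}

/-- The multiplication of the tangent groupoid, `Tm (X, Y)` for `X ∈ T_g G`, `Y ∈ T_h G` with
`s g = t h` and `Ts X = Tt Y`. Such a pair `(X, Y)` is tangent to `G⁽²⁾`, and on vectors tangent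
to `G⁽²⁾` the derivative within `G⁽²⁾` is the differential of `m : G⁽²⁾ → G`. -/
def tangentMul (g h : G) (X : TangentSpace I g) (Y : TangentSpace I h) :
    TangentSpace I (𝒢.mul g h) :=
  mfderivWithin (I.prod I) I (fun q : G × G => 𝒢.mul q.1 q.2) 𝒢.composable (g, h)
    ((X, Y) : TangentSpace I g × TangentSpace I h)

/-- `K` covers `K_M`: the maps `K : ⊕ᵏ TG → TG` and `K_M : ⊕ᵏ TM → TM` form a morphism of
groupoids, i.e. they commute with the source and target maps and preserve multiplication. -/
structure Covers {k : ℕ} (K : VectorFormField I G k) (KM : VectorFormField J M k) : Prop where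
  source : ∀ (g : G) (X : Fin k → TangentSpace I g),
    mfderiv I J 𝒢.source g (K g X) = KM (𝒢.source g) fun i => mfderiv I J 𝒢.source g (X i)
  target : ∀ (g : G) (X : Fin k → TangentSpace I g),
    mfderiv I J 𝒢.target g (K g X) = KM (𝒢.target g) fun i => mfderiv I J 𝒢.target g (X i)
  mul : ∀ (g h : G), 𝒢.source g = 𝒢.target h →
    ∀ (X : Fin k → TangentSpace I g) (Y : Fin k → TangentSpace I h),
      (∀ i, tangentMap I J 𝒢.source ⟨g, X i⟩ = tangentMap I J 𝒢.target ⟨h, Y i⟩) →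
      K (𝒢.mul g h) (fun i => 𝒢.tangentMul g h (X i) (Y i)) = 𝒢.tangentMul g h (K g X) (K h Y)

/-- A vector-valued form on `G` is multiplicative if it covers some `K_M ∈ Ω^k(M, TM)`. -/
def IsMultiplicative {k : ℕ} (K : VectorFormField I G k) : Prop :=
  ∃ KM ∈ vectorForms J M k, 𝒢.Covers K KM

end LieGroupoid

end Groupoids

end

/-! The reason is naturality of the bracket. Suppose a smooth map `f` relates `K` to `K'` and `L` to
`L'`, that is `Tf ∘ K = K' ∘ ⊕ᵏTf` and likewise for `L`. Then pullback by `f` intertwines the Lie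
derivatives, hence their graded commutators. A form `B` is recovered from its Lie derivative on
functions by `𝓛_B g = (-1)^(deg B) dg ∘ B`, so `f` relates `[K, L]` to `[K', L']`.

Multiplicativity consists of such relations. The source and target maps relate `K` to `K_M`, so they
relate `[K, L]` to `[K_M, L_M]`, which is the base form of the bracket. Compatibility with `s` and
`t` makes `K × K` tangent to `G⁽²⁾`, and its restriction there is related to `K` by both projections
and by the multiplication. The bracket of the restrictions of `K × K` and `L × L` is then related to
`[K, L]` by the same three maps, which says that `[K, L]` preserves multiplication
(`Covers.isChartBracket_mul`). The set `G⁽²⁾` is only needed locally: the normal form of the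
submersion `s` parametrizes it by open subsets of a vector space `E × F`, and `related_flatBracket`
is naturality for maps out of such subsets.

Existence is settled on a vector space. Coordinate functions force the formula `[K, L] = (-1)^k 𝓛_K
L - (-1)^(kl) (-1)^l 𝓛_L K`, with Lie derivatives taken componentwise; it must be shown that it
satisfies the commutator identity on all forms. For this, forms become functions of lists of
vectors, and each identity of the graded calculus is proved by induction on the list, contracting
with one constant vector at a time: `insert_insert` for two insertions, `lie_insert` for a Lie
derivative and an insertion, and `lie_lie` for two Lie derivatives. Only the parities of the degrees
enter, so no degrees have to be matched. `flatLie_flatBracket` carries the result back to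
alternating maps, `flatBracket_related` is naturality, and naturality under transition maps makes
the local brackets agree on a manifold (`isChartBracket_fnBracket`). Uniqueness follows from bump
functions with prescribed differential at a point. -/

set_option linter.unusedSectionVars false

noncomputable section

/-! ### Calculus of forms evaluated on lists of vectors

A form of arbitrary (possibly mixed) degree is viewed as a function of lists of vectors; insertion
and the exterior derivative are then given by recursion on the list, through
`ι_X i_K = i_{ι_X K} - (-1)^k i_K ι_X` and `ι_X d = D_X - d ι_X`. -/

namespace ListForm

variable {V F F' : Type*} [NormedAddCommGroup V] [NormedSpace ℝ V]
  [NormedAddCommGroup F'] [NormedSpace ℝ F'] [NormedAddCommGroup F] [NormedSpace ℝ F]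

/-- Insertion of a vector-valued form at one point. -/
def insertAt (K : List V → V) (α : List V → F) : List V → F
  | [] => α [K []]
  | X :: l => insertAt (fun m => K (X :: m)) α l -
      insertAt (fun m => (-1 : ℝ) ^ m.length • K m) (fun m => α (X :: m)) l
termination_by l => l.length

/-- Contraction with a constant vector. -/
def contract (X : V) (α : V → List V → F) : V → List V → F := fun x l => α x (X :: l)

/-- Derivative of the coefficients in a constant direction. -/
def dirDeriv (X : V) (α : V → List V → F) : V → List V → F :=
  fun x l => fderiv ℝ (fun y => α y l) x X

/-- Insertion of a field of vector-valued forms. -/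
def insert (K : V → List V → V) (α : V → List V → F) : V → List V → F :=
  fun x => insertAt (K x) (α x)

/-- The exterior derivative. -/
def extD (α : V → List V → F) (x : V) : List V → F
  | [] => 0
  | X :: l => dirDeriv X α x l - extD (contract X α) x l
termination_by l => l.length

/-- The Lie derivative along a vector-valued form of parity `s = ± 1`. -/
def lie (s : ℝ) (K : V → List V → V) (α : V → List V → F) : V → List V → F :=
  extD (insert K α) + s • insert K (extD α)

/-- All degrees that occur have parity `s`. -/
def HasParity (s : ℝ) (K : V → List V → F) : Prop :=
  ∀ x l, (-1 : ℝ) ^ l.length • K x l = s • K x l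

/-- Multilinearity on lists. -/
structure IsMultilinear (α : List V → F) : Prop where
  add : ∀ l m u v, α (l ++ (u + v) :: m) = α (l ++ u :: m) + α (l ++ v :: m)
  smul : ∀ l m (c : ℝ) v, α (l ++ (c • v) :: m) = c • α (l ++ v :: m)

/-- Antisymmetry under exchange of neighbours. -/
def IsAlternating (α : List V → F) : Prop :=
  ∀ l m u v, α (l ++ u :: v :: m) = -α (l ++ v :: u :: m)

/-- Smooth fields of multilinear forms. -/
structure IsSmooth (α : V → List V → F) : Prop where
  contDiff : ∀ l, ContDiff ℝ ∞ fun x => α x l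
  multilinear : ∀ x, IsMultilinear (α x)

theorem insertAt_nil (K : List V → V) (α : List V → F) : insertAt K α [] = α [K []] := by
  rw [insertAt]

theorem insertAt_cons (K : List V → V) (α : List V → F) (X : V) (l : List V) :
    insertAt K α (X :: l) = insertAt (fun m => K (X :: m)) α l -
      insertAt (fun m => (-1 : ℝ) ^ m.length • K m) (fun m => α (X :: m)) l := by
  rw [insertAt]

theorem extD_nil (α : V → List V → F) (x : V) : extD α x [] = 0 := by rw [extD]

theorem extD_cons (α : V → List V → F) (x X : V) (l : List V) :
    extD α x (X :: l) = dirDeriv X α x l - extD (contract X α) x l := by rw [extD]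

theorem IsMultilinear.cons {α : List V → F} (h : IsMultilinear α) (X : V) :
    IsMultilinear fun m => α (X :: m) :=
  ⟨fun l m u v => h.add (X :: l) m u v, fun l m c v => h.smul (X :: l) m c v⟩

theorem IsAlternating.cons {α : List V → F} (h : IsAlternating α) (X : V) :
    IsAlternating fun m => α (X :: m) :=
  fun l m u v => h (X :: l) m u v

theorem IsMultilinear.add_form {α η : List V → F} (h : IsMultilinear α) (h' : IsMultilinear η) :
    IsMultilinear (α + η) :=
  ⟨fun l m u v => by simp only [Pi.add_apply, h.add, h'.add]; abel,
    fun l m c v => by simp only [Pi.add_apply, h.smul, h'.smul, smul_add]⟩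

theorem IsMultilinear.smul_form {α : List V → F} (h : IsMultilinear α) (a : ℝ) :
    IsMultilinear (a • α) :=
  ⟨fun l m u v => by simp only [Pi.smul_apply, h.add, smul_add],
    fun l m c v => by simp only [Pi.smul_apply, h.smul, smul_comm a c]⟩

theorem insertAt_add_left {α : List V → F} (h : IsMultilinear α) (K K' : List V → V)
    (l : List V) : insertAt (K + K') α l = insertAt K α l + insertAt K' α l := by
  induction l generalizing K K' α with
  | nil => simpa [insertAt_nil] using h.add [] [] (K []) (K' [])
  | cons X l ih =>
    have h1 : (fun m => (K + K') (X :: m)) = (fun m => K (X :: m)) + fun m => K' (X :: m) := rfl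
    have h2 : (fun m : List V => (-1 : ℝ) ^ m.length • (K + K') m) =
        (fun m => (-1 : ℝ) ^ m.length • K m) + fun m => (-1 : ℝ) ^ m.length • K' m := by
      ext m; simp
    rw [insertAt_cons, insertAt_cons, insertAt_cons, h1, h2, ih h, ih (h.cons X)]
    abel

theorem insertAt_smul_left {α : List V → F} (h : IsMultilinear α) (c : ℝ) (K : List V → V)
    (l : List V) : insertAt (c • K) α l = c • insertAt K α l := by
  induction l generalizing K α with
  | nil => simpa [insertAt_nil] using h.smul [] [] c (K [])
  | cons X l ih =>
    have h1 : (fun m => (c • K) (X :: m)) = c • (fun m => K (X :: m)) := rfl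
    have h2 : (fun m : List V => (-1 : ℝ) ^ m.length • (c • K) m) =
        c • (fun m => (-1 : ℝ) ^ m.length • K m) := by
      ext m; simp [smul_comm c]
    rw [insertAt_cons, insertAt_cons, h1, h2, ih h, ih (h.cons X), smul_sub]

theorem insertAt_add_right (K : List V → V) (α η : List V → F) (l : List V) :
    insertAt K (α + η) l = insertAt K α l + insertAt K η l := by
  induction l generalizing K α η with
  | nil => simp [insertAt_nil]
  | cons X l ih =>
    have h1 : (fun m => (α + η) (X :: m)) = (fun m => α (X :: m)) + fun m => η (X :: m) := rfl
    rw [insertAt_cons, insertAt_cons, insertAt_cons, h1, ih, ih]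
    abel

theorem insertAt_map (A : F →ₗ[ℝ] F') (K : List V → V) (α : List V → F) (l : List V) :
    insertAt K (fun m => A (α m)) l = A (insertAt K α l) := by
  induction l generalizing K α with
  | nil => simp [insertAt_nil]
  | cons X l ih => rw [insertAt_cons, insertAt_cons, ih, ih, map_sub]

theorem insertAt_smul_right (K : List V → V) (c : ℝ) (α : List V → F) (l : List V) :
    insertAt K (c • α) l = c • insertAt K α l :=
  insertAt_map (LinearMap.lsmul ℝ F c) K α l

/-- The vectors in front of the varying slot are peeled off by the recursion. Once the slot is at
the head, it goes either into `K` or into `α`, and linearity of insertion in these two arguments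
applies. -/
theorem IsMultilinear.insertAt {K : List V → V} {α : List V → F} (hK : IsMultilinear K)
    (hα : IsMultilinear α) : IsMultilinear (insertAt K α) := by
  have hsign : ∀ {K : List V → V}, IsMultilinear K →
      IsMultilinear fun m => (-1 : ℝ) ^ m.length • K m := fun {K} hK =>
    ⟨fun l m u v => by simp [hK.add], fun l m c v => by simp [hK.smul, smul_comm c]⟩
  constructor
  · intro l m u v
    induction l generalizing K α with
    | nil =>
      have h1 : (fun m => K ((u + v) :: m)) = (fun m => K (u :: m)) + fun m => K (v :: m) :=
        funext fun m => hK.add [] m u v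
      have h2 : (fun m => α ((u + v) :: m)) = (fun m => α (u :: m)) + fun m => α (v :: m) :=
        funext fun m => hα.add [] m u v
      simp only [List.nil_append, insertAt_cons]
      rw [h1, h2, insertAt_add_left hα, insertAt_add_right]
      abel
    | cons X l ih =>
      simp only [List.cons_append, insertAt_cons]
      rw [ih (hK.cons X) hα, ih (hsign hK) (hα.cons X)]
      abel
  · intro l m c v
    induction l generalizing K α with
    | nil =>
      have h1 : (fun m => K ((c • v) :: m)) = c • (fun m => K (v :: m)) :=
        funext fun m => hK.smul [] m c v
      have h2 : (fun m => α ((c • v) :: m)) = c • (fun m => α (v :: m)) :=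
        funext fun m => hα.smul [] m c v
      simp only [List.nil_append, insertAt_cons]
      rw [h1, h2, insertAt_smul_left hα, insertAt_smul_right, smul_sub]
    | cons X l ih =>
      simp only [List.cons_append, insertAt_cons]
      rw [ih (hK.cons X) hα, ih (hsign hK) (hα.cons X), smul_sub]

theorem IsSmooth.contract {α : V → List V → F} (h : IsSmooth α) (X : V) :
    IsSmooth (contract X α) :=
  ⟨fun l => h.contDiff (X :: l), fun x => (h.multilinear x).cons X⟩

theorem IsSmooth.add {α η : V → List V → F} (h : IsSmooth α) (h' : IsSmooth η) :
    IsSmooth (α + η) :=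
  ⟨fun l => (h.contDiff l).add (h'.contDiff l),
    fun x => (h.multilinear x).add_form (h'.multilinear x)⟩

theorem IsSmooth.smul {α : V → List V → F} (h : IsSmooth α) (c : ℝ) : IsSmooth (c • α) :=
  ⟨fun l => (h.contDiff l).const_smul c, fun x => (h.multilinear x).smul_form c⟩

theorem IsSmooth.sub {α η : V → List V → F} (h : IsSmooth α) (h' : IsSmooth η) :
    IsSmooth (α - η) := by
  have := h.add (h'.smul (-1))
  rwa [neg_one_smul, ← sub_eq_add_neg] at this

theorem IsSmooth.differentiableAt {α : V → List V → F} (h : IsSmooth α) (l : List V) (x : V) :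
    DifferentiableAt ℝ (fun y => α y l) x :=
  (h.contDiff l).differentiable (by simp) x

theorem IsSmooth.dirDeriv {α : V → List V → F} (h : IsSmooth α) (X : V) :
    IsSmooth (dirDeriv X α) := by
  refine ⟨fun l => ?_, fun x => ⟨fun l m u v => ?_, fun l m c v => ?_⟩⟩
  · exact ((h.contDiff l).fderiv_right (m := ∞) (by simp)).clm_apply contDiff_const
  · simp only [ListForm.dirDeriv, (h.multilinear _).add]
    rw [fderiv_fun_add (h.differentiableAt _ _) (h.differentiableAt _ _)]
    rfl
  · simp only [ListForm.dirDeriv, (h.multilinear _).smul]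
    rw [fderiv_fun_const_smul (h.differentiableAt _ _)]
    rfl

theorem dirDeriv_add (X : V) {α η : V → List V → F} (h : IsSmooth α) (h' : IsSmooth η) :
    dirDeriv X (α + η) = dirDeriv X α + dirDeriv X η := by
  ext x l
  simp only [dirDeriv, Pi.add_apply]
  rw [fderiv_fun_add (h.differentiableAt _ _) (h'.differentiableAt _ _)]
  rfl

theorem dirDeriv_smul (X : V) {α : V → List V → F} (h : IsSmooth α) (c : ℝ) :
    dirDeriv X (c • α) = c • dirDeriv X α := by
  ext x l
  simp only [dirDeriv, Pi.smul_apply]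
  rw [fderiv_fun_const_smul (h.differentiableAt _ _)]
  rfl

theorem contract_dirDeriv (X Y : V) (α : V → List V → F) :
    contract X (dirDeriv Y α) = dirDeriv Y (contract X α) := rfl

theorem extD_add {α η : V → List V → F} (h : IsSmooth α) (h' : IsSmooth η) :
    extD (α + η) = extD α + extD η := by
  ext x l
  induction l generalizing α η with
  | nil => simp [extD_nil]
  | cons X l ih =>
    have h1 : contract X (α + η) = contract X α + contract X η := rfl
    simp only [Pi.add_apply, extD_cons] at ih ⊢
    rw [dirDeriv_add X h h', h1, ih (h.contract X) (h'.contract X)]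
    simp only [Pi.add_apply]
    abel

theorem extD_smul {α : V → List V → F} (h : IsSmooth α) (c : ℝ) :
    extD (c • α) = c • extD α := by
  ext x l
  induction l generalizing α with
  | nil => simp [extD_nil]
  | cons X l ih =>
    have h1 : contract X (c • α) = c • contract X α := rfl
    simp only [Pi.smul_apply, extD_cons] at ih ⊢
    rw [dirDeriv_smul X h, h1, ih (h.contract X)]
    simp only [Pi.smul_apply, smul_sub]

theorem extD_sub {α η : V → List V → F} (h : IsSmooth α) (h' : IsSmooth η) :
    extD (α - η) = extD α - extD η := by
  have := extD_add h (h'.smul (-1))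
  rwa [extD_smul h', neg_one_smul, neg_one_smul, ← sub_eq_add_neg, ← sub_eq_add_neg] at this

/-- Cartan's formula for a constant vector field, whose Lie derivative acts on the coefficients
only. -/
theorem contract_extD (X : V) (α : V → List V → F) :
    contract X (extD α) = dirDeriv X α - extD (contract X α) := by
  ext x l
  exact extD_cons α x X l

theorem extD_map (A : F →L[ℝ] F') {α : V → List V → F} (h : IsSmooth α) :
    extD (fun x m => A (α x m)) = fun x m => A (extD α x m) := by
  ext x l
  induction l generalizing α with
  | nil => simp [extD_nil]
  | cons X l ih =>
    have h1 : contract X (fun x m => A (α x m)) = fun x m => A (contract X α x m) := rfl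
    rw [extD_cons, extD_cons, h1, ih (h.contract X), map_sub]
    congr 1
    simp only [dirDeriv]
    rw [show (fun y => A (α y l)) = A ∘ fun y => α y l from rfl,
      (A.hasFDerivAt.comp x (h.differentiableAt l x).hasFDerivAt).fderiv]
    rfl

theorem contDiff_extD {α : V → List V → F} (h : IsSmooth α) (l : List V) :
    ContDiff ℝ ∞ fun x => extD α x l := by
  induction l generalizing α with
  | nil => simpa only [extD_nil] using contDiff_const
  | cons X l ih =>
    simp only [extD_cons]
    exact ((h.dirDeriv X).contDiff l).sub (ih (h.contract X))

theorem dirDeriv_vec_add {α : V → List V → F} (u v : V) :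
    dirDeriv (u + v) α = dirDeriv u α + dirDeriv v α := by
  ext x l; simp [dirDeriv]

theorem dirDeriv_vec_smul {α : V → List V → F} (c : ℝ) (v : V) :
    dirDeriv (c • v) α = c • dirDeriv v α := by
  ext x l; simp [dirDeriv]

theorem contract_vec_add {α : V → List V → F} (h : IsSmooth α) (u v : V) :
    contract (u + v) α = contract u α + contract v α := by
  ext x l; exact (h.multilinear x).add [] l u v

theorem contract_vec_smul {α : V → List V → F} (h : IsSmooth α) (c : ℝ) (v : V) :
    contract (c • v) α = c • contract v α := by
  ext x l; exact (h.multilinear x).smul [] l c v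

theorem IsSmooth.extD {α : V → List V → F} (h : IsSmooth α) : IsSmooth (extD α) := by
  refine ⟨contDiff_extD h, fun x => ⟨fun l m u v => ?_, fun l m c v => ?_⟩⟩
  · induction l generalizing α with
    | nil =>
      simp only [List.nil_append, extD_cons]
      rw [dirDeriv_vec_add, contract_vec_add h, extD_add (h.contract u) (h.contract v)]
      simp only [Pi.add_apply]
      abel
    | cons X l ih =>
      simp only [List.cons_append, extD_cons]
      rw [ih (h.contract X), ((h.dirDeriv X).multilinear x).add]
      abel
  · induction l generalizing α with
    | nil =>
      simp only [List.nil_append, extD_cons]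
      rw [dirDeriv_vec_smul, contract_vec_smul h, extD_smul (h.contract v)]
      simp only [Pi.smul_apply, smul_sub]
    | cons X l ih =>
      simp only [List.cons_append, extD_cons]
      rw [ih (h.contract X), ((h.dirDeriv X).multilinear x).smul, smul_sub]

theorem isAlternating_dirDeriv {α : V → List V → F} (ha : ∀ x, IsAlternating (α x)) (X x : V) :
    IsAlternating (dirDeriv X α x) := by
  intro l m u v
  simp only [dirDeriv, fun y => ha y l m u v]
  simp

/-- With `u`, `v` at the head the value is `D_u ι_v α - D_v ι_u α + d ι_v ι_u α`, which is visibly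
antisymmetric in `u` and `v`. -/
theorem isAlternating_extD {α : V → List V → F} (h : IsSmooth α) (ha : ∀ x, IsAlternating (α x))
    (x : V) : IsAlternating (extD α x) := by
  intro l m u v
  induction l generalizing α with
  | nil =>
    have h1 : contract v (contract u α) = (-1 : ℝ) • contract u (contract v α) := by
      ext y k
      simpa [contract] using ha y [] k u v
    simp only [List.nil_append, extD_cons]
    rw [h1, extD_smul ((h.contract v).contract u)]
    simp only [dirDeriv, contract, Pi.smul_apply]
    module
  | cons X l ih =>
    simp only [List.cons_append, extD_cons]
    rw [ih (h.contract X) (fun y => (ha y).cons X), isAlternating_dirDeriv ha X x]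
    abel

/-- Symmetry of the second derivative; through `dirDeriv_extD` it is what makes `d²` vanish. -/
theorem dirDeriv_comm {α : V → List V → F} (h : IsSmooth α) (X Y : V) :
    dirDeriv X (dirDeriv Y α) = dirDeriv Y (dirDeriv X α) := by
  ext x l
  have hs : IsSymmSndFDerivAt ℝ (fun y => α y l) x :=
    (h.contDiff l).contDiffAt.isSymmSndFDerivAt
      (by simpa using WithTop.coe_le_coe.2 (OrderTop.le_top (2 : ℕ∞)))
  have hd : DifferentiableAt ℝ (fderiv ℝ fun y => α y l) x :=
    ((h.contDiff l).fderiv_right (m := ∞) (by simp)).differentiable (by simp) x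
  have key : ∀ Z W, dirDeriv Z (dirDeriv W α) x l = fderiv ℝ (fderiv ℝ fun y => α y l) x Z W := by
    intro Z W
    simp only [dirDeriv]
    rw [fderiv_clm_apply hd (by fun_prop)]
    simp
  rw [key, key, hs.eq]

theorem dirDeriv_extD {α : V → List V → F} (h : IsSmooth α) (X : V) :
    dirDeriv X (extD α) = extD (dirDeriv X α) := by
  ext x l
  induction l generalizing α with
  | nil => simp [dirDeriv, extD_nil]
  | cons Y l ih =>
    have h1 : dirDeriv X (extD α) x (Y :: l) = dirDeriv X (contract Y (extD α)) x l := rfl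
    rw [h1, contract_extD, sub_eq_add_neg, ← neg_one_smul ℝ (extD (contract Y α)),
      dirDeriv_add X (h.dirDeriv Y) ((h.contract Y).extD.smul _),
      dirDeriv_smul X (h.contract Y).extD, extD_cons, contract_dirDeriv, dirDeriv_comm h]
    simp only [Pi.add_apply, Pi.smul_apply]
    rw [ih (h.contract Y)]
    module

/-- Contraction gives `ι_Y d d = D_Y d - d D_Y + d d ι_Y`; the first two terms cancel and the last
is the induction hypothesis. -/
theorem extD_extD {α : V → List V → F} (h : IsSmooth α) : extD (extD α) = 0 := by
  ext x l
  induction l generalizing α with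
  | nil => simp [extD_nil]
  | cons Y l ih =>
    rw [extD_cons, contract_extD, extD_sub (h.dirDeriv Y) (h.contract Y).extD, dirDeriv_extD h]
    simp only [Pi.sub_apply]
    rw [ih (h.contract Y)]
    simp

end ListForm

/-! ### Insertions on list forms: parity, Leibniz rule and graded commutator -/

namespace ListForm

variable {V F F' : Type*} [NormedAddCommGroup V] [NormedSpace ℝ V] [FiniteDimensional ℝ V]
  [NormedAddCommGroup F] [NormedSpace ℝ F] [NormedAddCommGroup F'] [NormedSpace ℝ F']

/-- Smoothness is only assumed on fixed lists. In finite dimension this expansion reduces a first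
argument that varies with the point to finitely many fixed ones. -/
theorem IsSmooth.apply_eq_sum {α : V → List V → F} (h : IsSmooth α) (x v : V) (l : List V) :
    α x (v :: l) = ∑ j, (Module.finBasis ℝ V).equivFunL v j •
      α x (Module.finBasis ℝ V j :: l) := by
  let φ : V →ₗ[ℝ] F :=
    { toFun := fun v => α x (v :: l)
      map_add' := fun u v => (h.multilinear x).add [] l u v
      map_smul' := fun c v => (h.multilinear x).smul [] l c v }
  conv_lhs => rw [← (Module.finBasis ℝ V).sum_equivFun v]
  exact (map_sum φ _ _).trans (by simp [φ])

theorem IsSmooth.contDiff_apply {α : V → List V → F} (h : IsSmooth α) {k : V → V}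
    (hk : ContDiff ℝ ∞ k) (l : List V) : ContDiff ℝ ∞ fun x => α x (k x :: l) := by
  simp only [fun x => h.apply_eq_sum x (k x) l]
  refine ContDiff.sum fun j _ => ContDiff.smul ?_ (h.contDiff _)
  exact (_root_.contDiff_apply ℝ ℝ j).comp ((Module.finBasis ℝ V).equivFunL.contDiff.comp hk)

theorem IsSmooth.fderiv_apply {α : V → List V → F} (h : IsSmooth α) {k : V → V}
    (hk : ContDiff ℝ ∞ k) (l : List V) (x X : V) :
    fderiv ℝ (fun y => α y (k y :: l)) x X =
      fderiv ℝ (fun y => α y (k x :: l)) x X + α x (fderiv ℝ k x X :: l) := by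
  have hk' : ∀ j, HasFDerivAt (fun y => (Module.finBasis ℝ V).equivFunL (k y) j)
      ((ContinuousLinearMap.proj j).comp
        ((Module.finBasis ℝ V).equivFunL.toContinuousLinearMap.comp (fderiv ℝ k x))) x := by
    intro j
    exact ((ContinuousLinearMap.proj (R := ℝ) (φ := fun _ => ℝ) j).hasFDerivAt).comp x
      ((Module.finBasis ℝ V).equivFunL.toContinuousLinearMap.hasFDerivAt.comp x
        (hk.differentiable (by simp) x).hasFDerivAt)
  have hα := fun j => (h.differentiableAt (Module.finBasis ℝ V j :: l) x).hasFDerivAt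
  have h1 := HasFDerivAt.fun_sum (u := Finset.univ) fun j _ => (hk' j).fun_smul (hα j)
  have h2 := HasFDerivAt.fun_sum (u := Finset.univ) fun j _ =>
    (hα j).fun_const_smul ((Module.finBasis ℝ V).equivFunL (k x) j)
  simp only [← h.apply_eq_sum] at h1 h2
  rw [h1.fderiv, h2.fderiv, h.apply_eq_sum x (fderiv ℝ k x X)]
  simp [Finset.sum_add_distrib]

theorem HasParity.contract {s : ℝ} {K : V → List V → F} (h : HasParity s K) (X : V) :
    HasParity (-s) (contract X K) := by
  intro x l
  have := h x (X :: l)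
  simp only [List.length_cons, pow_succ, mul_neg, mul_one, neg_smul] at this
  simp only [ListForm.contract, neg_smul, ← this, neg_neg]

theorem HasParity.dirDeriv {s : ℝ} {K : V → List V → F} (hK : IsSmooth K) (h : HasParity s K)
    (X : V) : HasParity s (dirDeriv X K) := by
  intro x l
  have h1 := fderiv_fun_const_smul (hK.differentiableAt l x) ((-1 : ℝ) ^ l.length)
  have h2 := fderiv_fun_const_smul (hK.differentiableAt l x) s
  simp only [fun y => h y l] at h1
  simpa [ListForm.dirDeriv] using congrArg (fun A => A X) (h1.symm.trans h2)

theorem HasParity.smul {s : ℝ} {K : V → List V → F} (h : HasParity s K) (c : ℝ) :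
    HasParity s (c • K) := by
  intro x l
  simp only [Pi.smul_apply, smul_comm _ c, h x l]

theorem HasParity.add {s : ℝ} {K L : V → List V → F} (h : HasParity s K) (h' : HasParity s L) :
    HasParity s (K + L) := by
  intro x l
  simp only [Pi.add_apply, smul_add, h x l, h' x l]

theorem HasParity.sub {s : ℝ} {K L : V → List V → F} (h : HasParity s K) (h' : HasParity s L) :
    HasParity s (K - L) := by
  intro x l
  simp only [Pi.sub_apply, smul_sub, h x l, h' x l]

theorem HasParity.eq_zero {K : V → List V → F} (h : HasParity (-1) K) (x : V) : K x [] = 0 := by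
  have := h x []
  simp only [List.length_nil, pow_zero, one_smul, neg_smul] at this
  have h2 : (2 : ℝ) • K x [] = 0 := by
    rw [two_smul]
    nth_rewrite 1 [this]
    exact neg_add_cancel _
  simpa using h2

/-- Parity turns the length-dependent sign of the recursion into the constant `s`. This is the form
in which the recursion drives all later inductions. -/
theorem contract_insert {s : ℝ} {K : V → List V → V} (h : HasParity s K) {α : V → List V → F}
    (hα : IsSmooth α) (X : V) :
    contract X (insert K α) = insert (contract X K) α - s • insert K (contract X α) := by
  ext x l
  have : (fun m : List V => (-1 : ℝ) ^ m.length • K x m) = s • K x := funext (h x)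
  have h2 := insertAt_smul_left ((hα.contract X).multilinear x) s (K x) l
  simp only [contract, insert, insertAt_cons, this, Pi.sub_apply, Pi.smul_apply]
  exact congrArg (insertAt (fun m => K x (X :: m)) (α x) l - ·) h2

theorem insert_add_left {α : V → List V → F} (hα : IsSmooth α) (K L : V → List V → V) :
    insert (K + L) α = insert K α + insert L α := by
  ext x l; exact insertAt_add_left (hα.multilinear x) _ _ l

theorem insert_smul_left {α : V → List V → F} (hα : IsSmooth α) (c : ℝ) (K : V → List V → V) :
    insert (c • K) α = c • insert K α := by
  ext x l; exact insertAt_smul_left (hα.multilinear x) _ _ l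

theorem insert_sub_left {α : V → List V → F} (hα : IsSmooth α) (K L : V → List V → V) :
    insert (K - L) α = insert K α - insert L α := by
  rw [sub_eq_add_neg, ← neg_one_smul ℝ L, insert_add_left hα, insert_smul_left hα, neg_one_smul,
    sub_eq_add_neg]

theorem insert_add_right (K : V → List V → V) (α β : V → List V → F) :
    insert K (α + β) = insert K α + insert K β := by
  ext x l; exact insertAt_add_right _ _ _ l

theorem insert_smul_right (K : V → List V → V) (c : ℝ) (α : V → List V → F) :
    insert K (c • α) = c • insert K α := by
  ext x l; exact insertAt_smul_right _ _ _ l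

theorem insert_sub_right (K : V → List V → V) (α β : V → List V → F) :
    insert K (α - β) = insert K α - insert K β := by
  rw [sub_eq_add_neg, ← neg_one_smul ℝ β, insert_add_right, insert_smul_right, neg_one_smul,
    sub_eq_add_neg]

theorem insert_nil (K : V → List V → V) (α : V → List V → F) (x : V) :
    insert K α x [] = α x [K x []] := insertAt_nil _ _

/-- One argument of `α` is replaced by the arguments of `K`, so the degree is the sum of the degrees
minus one. -/
theorem HasParity.insert {s t : ℝ} {K : V → List V → V} {α : V → List V → F} (hα : IsSmooth α)
    (hs : s * s = 1) (h : HasParity s K) (h' : HasParity t α) :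
    HasParity (-(s * t)) (insert K α) := by
  intro x l
  induction l generalizing K α s t with
  | nil =>
    have h1 := h x []
    have h2 := h' x [K x []]
    simp only [List.length_nil, pow_zero, one_smul, insert_nil, List.length_singleton, pow_one]
      at h1 h2 ⊢
    have h3 := (hα.multilinear x).smul [] [] s (K x [])
    simp only [List.nil_append, ← h1] at h3
    rw [neg_smul, mul_smul, ← h2, smul_comm s, ← h3, neg_one_smul, neg_neg]
  | cons X l ih =>
    have h1 : ListForm.insert K α x (X :: l) = ListForm.contract X (ListForm.insert K α) x l := rfl
    rw [h1, contract_insert h hα]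
    have a := ih hα (by simpa using hs) (h.contract X) h'
    have b := ih (hα.contract X) hs h (h'.contract X)
    simp only [Pi.sub_apply, Pi.smul_apply, List.length_cons, pow_succ, smul_sub, mul_smul] at a b ⊢
    linear_combination (norm := module) - a + s • b

theorem contDiff_insert {s : ℝ} {K : V → List V → V} {α : V → List V → F} (hK : IsSmooth K)
    (hα : IsSmooth α) (h : HasParity s K) (l : List V) :
    ContDiff ℝ ∞ fun x => insert K α x l := by
  induction l generalizing K α s with
  | nil => simpa only [insert_nil] using hα.contDiff_apply (hK.contDiff []) []
  | cons X l ih =>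
    change ContDiff ℝ ∞ fun x => contract X (insert K α) x l
    rw [contract_insert h hα]
    exact (ih (hK.contract X) hα (h.contract X)).sub
      ((ih hK (hα.contract X) h).const_smul s)

theorem IsSmooth.insert {s : ℝ} {K : V → List V → V} {α : V → List V → F} (hK : IsSmooth K)
    (hα : IsSmooth α) (h : HasParity s K) : IsSmooth (insert K α) :=
  ⟨contDiff_insert hK hα h, fun x => (hK.multilinear x).insertAt (hα.multilinear x)⟩

/-- The Leibniz rule. Its analytic content is the empty list, where a varying vector is plugged into
a varying form; the rest follows by contraction. -/
theorem dirDeriv_insert {s : ℝ} {K : V → List V → V} {α : V → List V → F} (hK : IsSmooth K)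
    (hα : IsSmooth α) (h : HasParity s K) (X : V) :
    dirDeriv X (insert K α) = insert (dirDeriv X K) α + insert K (dirDeriv X α) := by
  ext x l
  induction l generalizing K α s with
  | nil =>
    simp only [dirDeriv, Pi.add_apply, insert_nil]
    rw [hα.fderiv_apply (hK.contDiff [])]
    exact add_comm _ _
  | cons Y l ih =>
    change dirDeriv X (contract Y (insert K α)) x l =
      contract Y (insert (dirDeriv X K) α) x l + contract Y (insert K (dirDeriv X α)) x l
    rw [contract_insert h hα, contract_insert (h.dirDeriv hK X) hα,
      contract_insert h (hα.dirDeriv X), sub_eq_add_neg, ← neg_smul,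
      dirDeriv_add X ((hK.contract Y).insert hα (h.contract Y))
        ((hK.insert (hα.contract Y) h).smul _), dirDeriv_smul X (hK.insert (hα.contract Y) h)]
    simp only [Pi.add_apply, Pi.sub_apply, Pi.smul_apply]
    rw [ih (hK.contract Y) hα (h.contract Y), ih hK (hα.contract Y) h]
    simp only [Pi.add_apply, contract_dirDeriv]
    module

/-- The sign `(-1) ^ (k l)` in terms of `s = (-1) ^ k` and `t = (-1) ^ l`. -/
def koszulSign (s t : ℝ) : ℝ := (1 + s + t - s * t) / 2

/-- The graded commutator of two insertions. -/
theorem insert_insert {s t : ℝ} (hs : s = 1 ∨ s = -1) (ht : t = 1 ∨ t = -1)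
    {K L : V → List V → V} {α : V → List V → F} (hK : IsSmooth K) (hL : IsSmooth L)
    (hα : IsSmooth α) (ha : ∀ x, IsAlternating (α x)) (hKs : HasParity s K)
    (hLt : HasParity t L) :
    insert K (insert L α) + (koszulSign s t * s * t) • insert L (insert K α) =
      insert (insert K L) α + (koszulSign s t * s * t) • insert (insert L K) α := by
  ext x l
  induction l generalizing K L α s t with
  | nil =>
    have e1 : insert K (insert L α) x [] = contract (K x []) (insert L α) x [] := insert_nil _ _ _
    have e2 : insert L (insert K α) x [] = contract (L x []) (insert K α) x [] := insert_nil _ _ _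
    have e3 := ha x [] [] (K x []) (L x [])
    have e4 : ∀ k, α x [k, 0] = 0 := fun k => by simpa using (hα.multilinear x).smul [k] [] 0 0
    have e5 : ∀ k, α x [0, k] = 0 := fun k => by simpa using (hα.multilinear x).smul [] [k] 0 0
    simp only [Pi.add_apply, Pi.smul_apply]
    rw [e1, e2, contract_insert hKs hα, contract_insert hLt hα]
    simp only [Pi.sub_apply, Pi.smul_apply, insert_nil, contract] at e3 ⊢
    simp only [List.nil_append] at e3
    -- An odd form vanishes on the empty list, so only the case of two even forms has content, and
    -- there it is the antisymmetry of `α` in the two vectors.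
    rcases hs with rfl | rfl
    · rcases ht with rfl | rfl
      · rw [e3]
        norm_num [koszulSign]
      · rw [hLt.eq_zero, e4, e5]
        norm_num [koszulSign]
    · rw [hKs.eq_zero, e4, e5]
      norm_num [koszulSign]
  | cons X l ih =>
    have hs' : s * s = 1 := by rcases hs with rfl | rfl <;> norm_num
    have ht' : t * t = 1 := by rcases ht with rfl | rfl <;> norm_num
    -- Contraction with `X` falls on `K`, on `L` or on `α`. The first two flip the parity of the
    -- form hit, so the induction hypothesis is needed for all signs.
    have a := ih (s := -s) (by rcases hs with rfl | rfl <;> simp) ht (hK.contract X) hL hα ha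
      (hKs.contract X) hLt
    have b := ih (t := -t) hs (by rcases ht with rfl | rfl <;> simp) hK (hL.contract X) hα ha
      hKs (hLt.contract X)
    have c := ih hs ht hK hL (hα.contract X) (fun x => (ha x).cons X) hKs hLt
    change contract X (insert K (insert L α)) x l +
        (koszulSign s t * s * t) • contract X (insert L (insert K α)) x l =
      contract X (insert (insert K L) α) x l +
        (koszulSign s t * s * t) • contract X (insert (insert L K) α) x l
    rw [contract_insert hKs (hL.insert hα hLt), contract_insert hLt (hK.insert hα hKs),
      contract_insert (hKs.insert hL hs' hLt) hα, contract_insert (hLt.insert hK ht' hKs) hα,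
      contract_insert hKs hL, contract_insert hLt hK, contract_insert hKs hα,
      contract_insert hLt hα, insert_sub_right, insert_sub_right, insert_smul_right,
      insert_smul_right, insert_sub_left hα, insert_sub_left hα, insert_smul_left hα,
      insert_smul_left hα]
    simp only [Pi.add_apply, Pi.sub_apply, Pi.smul_apply] at a b c ⊢
    rcases hs with rfl | rfl <;> rcases ht with rfl | rfl <;> norm_num [koszulSign] at a b c ⊢
    · linear_combination (norm := module) a - b + c
    · linear_combination (norm := module) a - b - c
    · linear_combination (norm := module) a + b - c
    · linear_combination (norm := module) a + b + c

end ListForm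

/-! ### Lie derivatives and the bracket on list forms -/

namespace ListForm

variable {V F F' : Type*} [NormedAddCommGroup V] [NormedSpace ℝ V] [FiniteDimensional ℝ V]
  [NormedAddCommGroup F] [NormedSpace ℝ F] [NormedAddCommGroup F'] [NormedSpace ℝ F']

theorem HasParity.extD {s : ℝ} {α : V → List V → F} (hα : IsSmooth α) (h : HasParity s α) :
    HasParity (-s) (extD α) := by
  intro x l
  induction l generalizing α s with
  | nil => simp [extD_nil]
  | cons X l ih =>
    have a := h.dirDeriv hα X x l
    have b := ih (hα.contract X) (h.contract X)
    rw [extD_cons]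
    simp only [List.length_cons, pow_succ, mul_smul, smul_sub] at a b ⊢
    linear_combination (norm := module) b - a

theorem HasParity.lie {s t : ℝ} {K : V → List V → V} {α : V → List V → F} (hK : IsSmooth K)
    (hα : IsSmooth α) (hs : s * s = 1) (h : HasParity s K) (h' : HasParity t α) :
    HasParity (s * t) (lie s K α) := by
  have h1 := (h.insert hα hs h').extD (hK.insert hα h)
  have h2 := h.insert hα.extD hs (h'.extD hα)
  rw [neg_neg] at h1
  rw [mul_neg, neg_neg] at h2
  exact h1.add (h2.smul s)

theorem IsSmooth.lie {s : ℝ} {K : V → List V → V} {α : V → List V → F} (hK : IsSmooth K)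
    (hα : IsSmooth α) (h : HasParity s K) : IsSmooth (lie s K α) :=
  (hK.insert hα h).extD.add ((hK.insert hα.extD h).smul s)

theorem contract_add (X : V) (α β : V → List V → F) :
    contract X (α + β) = contract X α + contract X β := rfl

theorem contract_sub (X : V) (α β : V → List V → F) :
    contract X (α - β) = contract X α - contract X β := rfl

theorem contract_smul (X : V) (c : ℝ) (α : V → List V → F) :
    contract X (c • α) = c • contract X α := rfl

/-- Moving `ι_X` through `d` produces `D_X` in both summands. By the Leibniz rule the two terms `i_K
D_X α` cancel, and only the derivative that hits `K` remains. -/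
theorem contract_lie {s : ℝ} {K : V → List V → V} {α : V → List V → F} (hK : IsSmooth K)
    (hα : IsSmooth α) (hs : s * s = 1) (h : HasParity s K) (X : V) :
    contract X (lie s K α) =
      insert (dirDeriv X K) α - lie (-s) (contract X K) α + s • lie s K (contract X α) := by
  simp only [lie]
  rw [contract_add, contract_smul, contract_extD, contract_insert h hα, contract_insert h hα.extD,
    contract_extD, dirDeriv_insert hK hα h, insert_sub_right,
    extD_sub ((hK.contract X).insert hα (h.contract X)) ((hK.insert (hα.contract X) h).smul s),
    extD_smul (hK.insert (hα.contract X) h)]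
  ext x l
  simp only [Pi.add_apply, Pi.sub_apply, Pi.smul_apply, smul_sub, smul_add, smul_smul, hs]
  module

theorem lie_nil {s : ℝ} {K : V → List V → V} {α : V → List V → F} (h : HasParity s K) (x : V) :
    lie s K α x [] = dirDeriv (K x []) α x [] := by
  have h0 := h x []
  simp only [List.length_nil, pow_zero, one_smul] at h0
  simp only [lie, Pi.add_apply, Pi.smul_apply, extD_nil, insert_nil, extD_cons, zero_add, sub_zero]
  rw [← Pi.smul_apply, ← Pi.smul_apply, ← dirDeriv_vec_smul, ← h0]

theorem lie_add_right {s : ℝ} {K : V → List V → V} {α β : V → List V → F} (hK : IsSmooth K)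
    (hα : IsSmooth α) (hβ : IsSmooth β) (h : HasParity s K) :
    lie s K (α + β) = lie s K α + lie s K β := by
  simp only [lie]
  rw [insert_add_right, extD_add hα hβ, insert_add_right,
    extD_add (hK.insert hα h) (hK.insert hβ h), smul_add]
  abel

theorem lie_smul_right {s : ℝ} {K : V → List V → V} {α : V → List V → F} (hK : IsSmooth K)
    (hα : IsSmooth α) (h : HasParity s K) (c : ℝ) :
    lie s K (c • α) = c • lie s K α := by
  simp only [lie]
  rw [insert_smul_right, extD_smul hα, insert_smul_right, extD_smul (hK.insert hα h), smul_add,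
    smul_comm]

theorem lie_sub_right {s : ℝ} {K : V → List V → V} {α β : V → List V → F} (hK : IsSmooth K)
    (hα : IsSmooth α) (hβ : IsSmooth β) (h : HasParity s K) :
    lie s K (α - β) = lie s K α - lie s K β := by
  have := lie_add_right hK hα (hβ.smul (-1)) h
  rwa [lie_smul_right hK hβ h, neg_one_smul, neg_one_smul, ← sub_eq_add_neg,
    ← sub_eq_add_neg] at this

theorem lie_sub_smul_left {s : ℝ} {K L : V → List V → V} {α : V → List V → F} (hK : IsSmooth K)
    (hL : IsSmooth L) (hα : IsSmooth α) (h : HasParity s K) (h' : HasParity s L) (c : ℝ) :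
    lie s (K - c • L) α = lie s K α - c • lie s L α := by
  simp only [lie]
  rw [insert_sub_left hα, insert_sub_left hα.extD, insert_smul_left hα, insert_smul_left hα.extD,
    extD_sub (hK.insert hα h) ((hL.insert hα h').smul c), extD_smul (hL.insert hα h')]
  module

/-- The Frölicher–Nijenhuis bracket of vector-valued forms of parities `s` and `t`. -/
def bracket (s t : ℝ) (K L : V → List V → V) : V → List V → V :=
  s • lie s K L - (koszulSign s t * t) • lie t L K

theorem IsSmooth.bracket {s t : ℝ} {K L : V → List V → V} (hK : IsSmooth K) (hL : IsSmooth L)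
    (hKs : HasParity s K) (hLt : HasParity t L) : IsSmooth (bracket s t K L) :=
  ((hK.lie hL hKs).smul _).sub ((hL.lie hK hLt).smul _)

theorem HasParity.bracket {s t : ℝ} {K L : V → List V → V} (hs : s * s = 1) (ht : t * t = 1)
    (hK : IsSmooth K) (hL : IsSmooth L) (hKs : HasParity s K) (hLt : HasParity t L) :
    HasParity (s * t) (bracket s t K L) :=
  ((hKs.lie hK hL hs hLt).smul _).sub (mul_comm s t ▸ (hLt.lie hL hK ht hKs).smul _)

/-- The recursion for the bracket that makes induction possible in `lie_insert`. The terms with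
`D_X` appear because the bracket differentiates the coefficients of its arguments. -/
theorem contract_bracket {s t : ℝ} (hs : s = 1 ∨ s = -1) (ht : t = 1 ∨ t = -1)
    {K L : V → List V → V} (hK : IsSmooth K) (hL : IsSmooth L)
    (hKs : HasParity s K) (hLt : HasParity t L) (X : V) :
    contract X (bracket s t K L) =
      (s • insert (dirDeriv X K) L - (koszulSign s t * t) • insert (dirDeriv X L) K) +
      (bracket (-s) t (contract X K) L + s • bracket s (-t) K (contract X L)) := by
  have hs' : s * s = 1 := by rcases hs with rfl | rfl <;> norm_num
  have ht' : t * t = 1 := by rcases ht with rfl | rfl <;> norm_num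
  simp only [bracket]
  rw [contract_sub, contract_smul, contract_smul, contract_lie hK hL hs' hKs,
    contract_lie hL hK ht' hLt]
  rcases hs with rfl | rfl <;> rcases ht with rfl | rfl <;> norm_num [koszulSign] <;> abel

/-- The graded commutator of a Lie derivative and an insertion. -/
theorem lie_insert {s t : ℝ} (hs : s = 1 ∨ s = -1) (ht : t = 1 ∨ t = -1)
    {K L : V → List V → V} {α : V → List V → F} (hK : IsSmooth K) (hL : IsSmooth L)
    (hα : IsSmooth α) (ha : ∀ x, IsAlternating (α x)) (hKs : HasParity s K)
    (hLt : HasParity t L) :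
    lie s K (insert L α) - (koszulSign s t * s) • insert L (lie s K α) =
      s • insert (bracket s t K L) α +
        (koszulSign s t * s * t) • lie (-(s * t)) (insert L K) α := by
  have hs' : ∀ {s : ℝ}, s = 1 ∨ s = -1 → s * s = 1 := by
    rintro _ (rfl | rfl) <;> norm_num
  ext x l
  induction l generalizing K L α s t with
  | nil =>
    have hLK : HasParity (-(s * t)) (insert L K) := mul_comm t s ▸ hLt.insert hK (hs' ht) hKs
    have e1 : dirDeriv (K x []) (insert L α) x [] =
        α x [dirDeriv (K x []) L x []] + dirDeriv (K x []) (contract (L x []) α) x [] := by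
      rw [dirDeriv_insert hL hα hLt]
      simp only [Pi.add_apply, insert_nil]
      rfl
    have e2 : insert L (lie s K α) x [] = α x [dirDeriv (L x []) K x []] -
        dirDeriv (K x [L x []]) α x [] + s • dirDeriv (K x []) (contract (L x []) α) x [] := by
      rw [insert_nil]
      change contract (L x []) (lie s K α) x [] = _
      rw [contract_lie hK hα (hs' hs) hKs]
      simp only [Pi.add_apply, Pi.sub_apply, Pi.smul_apply, lie_nil hKs, lie_nil (hKs.contract _),
        insert_nil]
      rfl
    have e3 : insert (bracket s t K L) α x [] = s • α x [dirDeriv (K x []) L x []] -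
        (koszulSign s t * t) • α x [dirDeriv (L x []) K x []] := by
      rw [bracket, insert_sub_left hα, insert_smul_left hα, insert_smul_left hα]
      simp only [Pi.sub_apply, Pi.smul_apply, insert_nil, lie_nil hKs, lie_nil hLt]
    have z1 : ∀ {β : V → List V → F} y m, dirDeriv 0 β y m = 0 := by simp [dirDeriv]
    have z2 : ∀ {β : V → List V → V} y m, dirDeriv 0 β y m = 0 := by simp [dirDeriv]
    have z3 : α x [0] = 0 := by simpa using (hα.multilinear x).smul [] [] 0 0
    have z4 : K x [0] = 0 := by simpa using (hK.multilinear x).smul [] [] 0 0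
    simp only [Pi.add_apply, Pi.sub_apply, Pi.smul_apply]
    rw [lie_nil hKs, lie_nil hLK, e1, e2, e3, insert_nil]
    rcases hs with rfl | rfl
    -- An even form vanishes on lists of length one, since its value there equals its own negative.
    · have hK1 : K x [L x []] = 0 := by
        have := hKs x [L x []]
        simp only [List.length_singleton, pow_one, neg_smul, one_smul] at this
        have h2 : (2 : ℝ) • K x [L x []] = 0 := by
          rw [two_smul]
          nth_rewrite 1 [← this]
          exact neg_add_cancel _
        simpa using h2
      rw [hK1, z1]
      rcases ht with rfl | rfl
      · norm_num [koszulSign]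
      · rw [hLt.eq_zero, (hLt.dirDeriv hL _).eq_zero, z2, z3]
        norm_num [koszulSign]
    · rw [hKs.eq_zero, (hKs.dirDeriv hK _).eq_zero, z1, z2, z3]
      rcases ht with rfl | rfl
      · norm_num [koszulSign]
      · rw [hLt.eq_zero, z4, z1]
        norm_num [koszulSign]
  | cons X l ih =>
    have hLK : HasParity (-(s * t)) (insert L K) := mul_comm t s ▸ hLt.insert hK (hs' ht) hKs
    have hst : (-(s * t)) * (-(s * t)) = 1 := by
      rw [neg_mul_neg, mul_mul_mul_comm, hs' hs, hs' ht, one_mul]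
    have a := ih (s := -s) (by rcases hs with rfl | rfl <;> simp) ht (hK.contract X) hL hα ha
      (hKs.contract X) hLt
    have b := ih (t := -t) hs (by rcases ht with rfl | rfl <;> simp) hK (hL.contract X) hα ha
      hKs (hLt.contract X)
    have c := ih hs ht hK hL (hα.contract X) (fun x => (ha x).cons X) hKs hLt
    -- The terms in which `D_X` hits `K` are not covered by the three induction hypotheses; they
    -- cancel by the commutator of the insertions of `D_X K` and `L`.
    have n := congrFun (congrFun (insert_insert hs ht (hK.dirDeriv X) hL hα ha
      (hKs.dirDeriv hK X) hLt) x) l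
    change contract X (lie s K (insert L α)) x l -
        (koszulSign s t * s) • contract X (insert L (lie s K α)) x l =
      s • contract X (insert (bracket s t K L) α) x l +
        (koszulSign s t * s * t) • contract X (lie (-(s * t)) (insert L K) α) x l
    rw [contract_lie hK (hL.insert hα hLt) (hs' hs) hKs, contract_insert hLt (hK.lie hα hKs),
      contract_insert (hKs.bracket (hs' hs) (hs' ht) hK hL hLt) hα,
      contract_lie (hL.insert hK hLt) hα hst hLK,
      contract_lie hK hα (hs' hs) hKs, contract_insert hLt hα, contract_bracket hs ht hK hL hKs hLt,
      contract_insert hLt hK, dirDeriv_insert hL hK hLt,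
      insert_add_left hα, insert_add_left hα, insert_sub_left hα, insert_smul_left hα,
      insert_smul_left hα, insert_add_left hα, insert_smul_left hα,
      insert_add_right, insert_sub_right, insert_smul_right, neg_neg,
      lie_sub_right hK ((hL.contract X).insert hα (hLt.contract X))
        ((hL.insert (hα.contract X) hLt).smul t) hKs,
      lie_smul_right hK (hL.insert (hα.contract X) hLt) hKs,
      lie_sub_smul_left ((hL.contract X).insert hK (hLt.contract X))
        (hL.insert (hK.contract X) hLt) hα
        (by simpa [mul_comm] using (hLt.contract X).insert hK (by simpa using hs' ht) hKs)
        (by simpa [mul_comm] using hLt.insert (hK.contract X) (hs' ht) (hKs.contract X))]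
    simp only [Pi.add_apply, Pi.sub_apply, Pi.smul_apply] at a b c n ⊢
    rcases hs with rfl | rfl <;> rcases ht with rfl | rfl <;> norm_num [koszulSign] at a b c n ⊢
    · linear_combination (norm := module) n - a + b - c
    · linear_combination (norm := module) n - a + b + c
    · linear_combination (norm := module) n - a - b + c
    · linear_combination (norm := module) n - a - b - c

/-- Since `d² = 0`, one summand of the Lie derivative dies on each side and the others agree up to
the sign. -/
theorem extD_lie {s : ℝ} {K : V → List V → V} {α : V → List V → F}
    (hK : IsSmooth K) (hα : IsSmooth α) (h : HasParity s K) :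
    extD (lie s K α) = s • lie s K (extD α) := by
  simp only [lie]
  rw [extD_add (hK.insert hα h).extD ((hK.insert hα.extD h).smul s), extD_extD (hK.insert hα h),
    extD_smul (hK.insert hα.extD h), extD_extD hα]
  have : insert K (0 : V → List V → F) = 0 := by
    simpa using insert_smul_right K 0 (0 : V → List V → F)
  rw [this]
  simp

/-- The graded commutator of two Lie derivatives. -/
theorem lie_lie {s t : ℝ} (hs : s = 1 ∨ s = -1) (ht : t = 1 ∨ t = -1)
    {K L : V → List V → V} {α : V → List V → F} (hK : IsSmooth K) (hL : IsSmooth L)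
    (hα : IsSmooth α) (ha : ∀ x, IsAlternating (α x)) (hKs : HasParity s K)
    (hLt : HasParity t L) :
    lie s K (lie t L α) - koszulSign s t • lie t L (lie s K α) =
      lie (s * t) (bracket s t K L) α := by
  have hs' : ∀ {s : ℝ}, s = 1 ∨ s = -1 → s * s = 1 := by
    rintro _ (rfl | rfl) <;> norm_num
  have hst : (-(s * t)) * (-(s * t)) = 1 := by
    rw [neg_mul_neg, mul_mul_mul_comm, hs' hs, hs' ht, one_mul]
  have hLK : HasParity (-(s * t)) (insert L K) := mul_comm t s ▸ hLt.insert hK (hs' ht) hKs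
  -- As `𝓛_L` is the commutator of `d` and `i_L`, and `𝓛_K` commutes with `d` up to sign, the claim
  -- is a signed combination of `d` applied to `lie_insert` for `α` and of `lie_insert` for `dα`.
  -- The Lie derivatives along `i_L K` cancel.
  have a := lie_insert hs ht hK hL hα ha hKs hLt
  have b := lie_insert hs ht hK hL hα.extD (isAlternating_extD hα ha) hKs hLt
  have c := congrArg extD a
  rw [extD_sub (hK.lie (hL.insert hα hLt) hKs) ((hL.insert (hK.lie hα hKs) hLt).smul _),
    extD_smul (hL.insert (hK.lie hα hKs) hLt),
    extD_add (((hK.bracket hL hKs hLt).insert hα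
      (hKs.bracket (hs' hs) (hs' ht) hK hL hLt)).smul s)
      (((hL.insert hK hLt).lie hα hLK).smul _),
    extD_smul ((hK.bracket hL hKs hLt).insert hα (hKs.bracket (hs' hs) (hs' ht) hK hL hLt)),
    extD_smul ((hL.insert hK hLt).lie hα hLK), extD_lie (hL.insert hK hLt) hα hLK,
    extD_lie hK (hL.insert hα hLt) hKs] at c
  have e1 : lie s K (lie t L α) =
      lie s K (extD (insert L α)) + t • lie s K (insert L (extD α)) := by
    conv_lhs => arg 3; rw [lie]
    rw [lie_add_right hK (hL.insert hα hLt).extD ((hL.insert hα.extD hLt).smul t) hKs,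
      lie_smul_right hK (hL.insert hα.extD hLt) hKs]
  have e2 : lie t L (lie s K α) =
      extD (insert L (lie s K α)) + (t * s) • insert L (lie s K (extD α)) := by
    rw [lie, extD_lie hK hα hKs, insert_smul_right, smul_smul]
  have e3 : lie (s * t) (bracket s t K L) α = extD (insert (bracket s t K L) α) +
      (s * t) • insert (bracket s t K L) (extD α) := rfl
  rw [e1, e2, e3]
  rcases hs with rfl | rfl <;> rcases ht with rfl | rfl <;> norm_num [koszulSign] at b c ⊢
  · linear_combination (norm := module) b + c
  · linear_combination (norm := module) c - b
  · linear_combination (norm := module) b - c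
  · linear_combination (norm := module) - b - c

end ListForm

/-! ### Alternating maps as functions of lists -/

section PermSum

variable {R : Type*} [AddCommMonoid R]

/-- The permutation of `Fin (n + 1)` that sends `j` to `0` and acts as `τ` on the other entries. -/
def permSendToZero {n : ℕ} (q : Fin (n + 1) × Equiv.Perm (Fin n)) : Equiv.Perm (Fin (n + 1)) :=
  Equiv.Perm.decomposeFin.symm (0, q.2) * q.1.cycleRange

theorem permSendToZero_self {n : ℕ} (j : Fin (n + 1)) (τ : Equiv.Perm (Fin n)) :
    permSendToZero (j, τ) j = 0 := by
  simp [permSendToZero]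

theorem permSendToZero_succAbove {n : ℕ} (j : Fin (n + 1)) (τ : Equiv.Perm (Fin n)) (i : Fin n) :
    permSendToZero (j, τ) (j.succAbove i) = (τ i).succ := by
  simp [permSendToZero]

theorem sign_permSendToZero {n : ℕ} (j : Fin (n + 1)) (τ : Equiv.Perm (Fin n)) :
    Equiv.Perm.sign (permSendToZero (j, τ)) = (-1) ^ (j : ℕ) * Equiv.Perm.sign τ := by
  simp [permSendToZero, mul_comm]

/-- The index `j` is recovered as the preimage of `0`, which gives injectivity; both sides have `(n
+ 1)!` elements. -/
theorem permSendToZero_bijective (n : ℕ) : Function.Bijective (permSendToZero (n := n)) := by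
  rw [Fintype.bijective_iff_injective_and_card]
  constructor
  · rintro ⟨j, τ⟩ ⟨j', τ'⟩ h
    have hj : j = j' := by
      apply (permSendToZero (j', τ')).injective
      rw [← h, permSendToZero_self, h, permSendToZero_self]
    subst hj
    have := mul_right_cancel h
    simpa using this
  · simp [Fintype.card_perm, Nat.factorial_succ]

/-- Permutations are sorted by the slot `j` that receives the first vector. -/
theorem sum_perm_fin_succ {n : ℕ} (f : Equiv.Perm (Fin (n + 1)) → R) :
    ∑ σ, f σ = ∑ j, ∑ τ, f (permSendToZero (j, τ)) := by
  rw [← (permSendToZero_bijective n).sum_comp, Fintype.sum_prod_type]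

end PermSum

/-! ### Recursion for the antisymmetrized sum defining insertion -/

section InsertSum

variable {V : Type*} [NormedAddCommGroup V] [NormedSpace ℝ V]

/-- The unnormalized antisymmetrization of `η (K (w₁, …, w_k), w_{k+1}, …)`. -/
def insertSum {k p n : ℕ} (h : k + p = n) (K : V [⋀^Fin k]→L[ℝ] V)
    (η : V [⋀^Fin (p + 1)]→L[ℝ] ℝ) (w : Fin n → V) : ℝ :=
  ∑ σ : Equiv.Perm (Fin n), (Equiv.Perm.sign σ : ℝ) *
    η (Fin.cons (K fun i => w (σ (Fin.cast h (Fin.castAdd p i))))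
      fun j => w (σ (Fin.cast h (Fin.natAdd k j))))

/-- To reach the front, `X` passes `b` vectors of `u` and then `Y`. -/
theorem map_cons_insertNth {p : ℕ} (η : V [⋀^Fin (p + 2)]→L[ℝ] ℝ) (b : Fin (p + 1)) (Y X : V)
    (u : Fin p → V) :
    η (Fin.cons Y (b.insertNth X u)) = -((-1) ^ (b : ℕ) * η.curryLeft X (Fin.cons Y u)) := by
  have h1 := (η.curryLeft Y).map_insertNth b X u
  have h2 := η.map_insertNth 1 X (Fin.cons Y u)
  have h3 : (1 : Fin (p + 2)).insertNth X (Fin.cons Y u : Fin (p + 1) → V) =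
      (Fin.cons Y (Fin.cons X u) : Fin (p + 2) → V) := by
    rw [← Fin.succ_zero_eq_one, Fin.insertNth_succ_cons, Fin.insertNth_zero']
  rw [h3] at h2
  simp only [ContinuousAlternatingMap.curryLeft_apply_apply, Matrix.vecCons] at h1 h2 ⊢
  rw [h1, h2]
  simp

/-- The part of the sum in which the first vector is fed to `K` or to `η`. -/
theorem insertSum_cons {k p n : ℕ} (h : k + p = n + 1) (K : V [⋀^Fin k]→L[ℝ] V)
    (η : V [⋀^Fin (p + 1)]→L[ℝ] ℝ) (X : V) (v : Fin n → V) :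
    insertSum h K η (Fin.cons X v) =
      (∑ a : Fin k, ∑ τ : Equiv.Perm (Fin n), (-1 : ℝ) ^ (a : ℕ) * (Equiv.Perm.sign τ : ℝ) *
        η (Fin.cons
          (K fun i => (Fin.cons X v : Fin (n + 1) → V) (permSendToZero
            (Fin.cast h (Fin.castAdd p a), τ) (Fin.cast h (Fin.castAdd p i))))
          fun j => (Fin.cons X v : Fin (n + 1) → V) (permSendToZero
            (Fin.cast h (Fin.castAdd p a), τ) (Fin.cast h (Fin.natAdd k j))))) +
      ∑ b : Fin p, ∑ τ : Equiv.Perm (Fin n), (-1 : ℝ) ^ (k + b : ℕ) * (Equiv.Perm.sign τ : ℝ) *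
        η (Fin.cons
          (K fun i => (Fin.cons X v : Fin (n + 1) → V) (permSendToZero
            (Fin.cast h (Fin.natAdd k b), τ) (Fin.cast h (Fin.castAdd p i))))
          fun j => (Fin.cons X v : Fin (n + 1) → V) (permSendToZero
            (Fin.cast h (Fin.natAdd k b), τ) (Fin.cast h (Fin.natAdd k j)))) := by
  rw [insertSum, sum_perm_fin_succ, ← (finCongr h).sum_comp, Fin.sum_univ_add]
  simp only [sign_permSendToZero, finCongr_apply]
  simp

/-- The sign `(-1)^a` of the permutation cancels that of moving `X` to the front inside `K`. Thus
all `k + 1` slots `a` contribute equally, which turns `1/(k+1)!` into `1/k!`. -/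
theorem insertSum_cons_left {k p n : ℕ} (h : k + 1 + p = n + 1) (h' : k + p = n)
    (K : V [⋀^Fin (k + 1)]→L[ℝ] V) (η : V [⋀^Fin (p + 1)]→L[ℝ] ℝ) (X : V) (v : Fin n → V)
    (a : Fin (k + 1)) (τ : Equiv.Perm (Fin n)) :
    (-1 : ℝ) ^ (a : ℕ) * (Equiv.Perm.sign τ : ℝ) *
        η (Fin.cons
          (K fun i => (Fin.cons X v : Fin (n + 1) → V) (permSendToZero
            (Fin.cast h (Fin.castAdd p a), τ) (Fin.cast h (Fin.castAdd p i))))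
          fun j => (Fin.cons X v : Fin (n + 1) → V) (permSendToZero
            (Fin.cast h (Fin.castAdd p a), τ) (Fin.cast h (Fin.natAdd (k + 1) j)))) =
      (Equiv.Perm.sign τ : ℝ) *
        η (Fin.cons (K.curryLeft X fun i => v (τ (Fin.cast h' (Fin.castAdd p i))))
          fun j => v (τ (Fin.cast h' (Fin.natAdd k j)))) := by
  have e1 : (fun i => (Fin.cons X v : Fin (n + 1) → V) (permSendToZero
      (Fin.cast h (Fin.castAdd p a), τ) (Fin.cast h (Fin.castAdd p i)))) =
      a.insertNth X fun i => v (τ (Fin.cast h' (Fin.castAdd p i))) := by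
    refine (Fin.eq_insertNth_iff).2 ⟨?_, ?_⟩
    · simp [permSendToZero_self]
    · ext i
      have : Fin.cast h (Fin.castAdd p (a.succAbove i)) =
          (Fin.cast h (Fin.castAdd p a)).succAbove (Fin.cast h' (Fin.castAdd p i)) := by
        ext
        simp only [Fin.succAbove, Fin.lt_def]
        split_ifs <;> simp_all
        omega
      simp only [Fin.removeNth, this, permSendToZero_succAbove, Fin.cons_succ]
  have e2 : (fun j => (Fin.cons X v : Fin (n + 1) → V) (permSendToZero
      (Fin.cast h (Fin.castAdd p a), τ) (Fin.cast h (Fin.natAdd (k + 1) j)))) =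
      fun j => v (τ (Fin.cast h' (Fin.natAdd k j))) := by
    ext j
    have : Fin.cast h (Fin.natAdd (k + 1) j) =
        (Fin.cast h (Fin.castAdd p a)).succAbove (Fin.cast h' (Fin.natAdd k j)) := by
      ext
      simp only [Fin.succAbove, Fin.lt_def]
      split_ifs with hlt
      · simp at hlt; omega
      · simp; omega
    simp only [this, permSendToZero_succAbove, Fin.cons_succ]
  rw [e1, e2, K.map_insertNth, ContinuousAlternatingMap.curryLeft_apply_apply]
  have e3 := fun c y => η.toMultilinearMap.cons_smul (fun j => v (τ (Fin.cast h' (Fin.natAdd k j))))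
    c y
  have e4 : ∀ (c : ℤ) (y : V), η (Fin.cons (c • y) fun j => v (τ (Fin.cast h' (Fin.natAdd k j)))) =
      c * η (Fin.cons y fun j => v (τ (Fin.cast h' (Fin.natAdd k j)))) := by
    intro c y
    rw [← Int.cast_smul_eq_zsmul ℝ]
    exact e3 c y
  rw [e4]
  push_cast
  have : (-1 : ℝ) ^ (a : ℕ) * (-1) ^ (a : ℕ) = 1 := by rw [← mul_pow]; norm_num
  linear_combination (Equiv.Perm.sign τ : ℝ) * η (Fin.cons (K (Matrix.vecCons X fun i =>
    v (τ (Fin.cast h' (Fin.castAdd p i))))) fun j => v (τ (Fin.cast h' (Fin.natAdd k j)))) * this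

/-- The permutation contributes `(-1)^(k+b)` and moving `X` to the front of `η` contributes
`-(-1)^b`. The result does not depend on `b`, so the `p + 1` slots turn `1/(p+1)!` into `1/p!`. -/
theorem insertSum_cons_right {k p n : ℕ} (h : k + (p + 1) = n + 1) (h' : k + p = n)
    (K : V [⋀^Fin k]→L[ℝ] V) (η : V [⋀^Fin (p + 2)]→L[ℝ] ℝ) (X : V) (v : Fin n → V)
    (b : Fin (p + 1)) (τ : Equiv.Perm (Fin n)) :
    (-1 : ℝ) ^ (k + b : ℕ) * (Equiv.Perm.sign τ : ℝ) *
        η (Fin.cons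
          (K fun i => (Fin.cons X v : Fin (n + 1) → V) (permSendToZero
            (Fin.cast h (Fin.natAdd k b), τ) (Fin.cast h (Fin.castAdd (p + 1) i))))
          fun j => (Fin.cons X v : Fin (n + 1) → V) (permSendToZero
            (Fin.cast h (Fin.natAdd k b), τ) (Fin.cast h (Fin.natAdd k j)))) =
      -((-1) ^ k * ((Equiv.Perm.sign τ : ℝ) *
        η.curryLeft X (Fin.cons (K fun i => v (τ (Fin.cast h' (Fin.castAdd p i))))
          fun j => v (τ (Fin.cast h' (Fin.natAdd k j)))))) := by
  have e1 : (fun j => (Fin.cons X v : Fin (n + 1) → V) (permSendToZero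
      (Fin.cast h (Fin.natAdd k b), τ) (Fin.cast h (Fin.natAdd k j)))) =
      b.insertNth X fun j => v (τ (Fin.cast h' (Fin.natAdd k j))) := by
    refine (Fin.eq_insertNth_iff).2 ⟨?_, ?_⟩
    · simp [permSendToZero_self]
    · ext i
      have : Fin.cast h (Fin.natAdd k (b.succAbove i)) =
          (Fin.cast h (Fin.natAdd k b)).succAbove (Fin.cast h' (Fin.natAdd k i)) := by
        ext
        simp only [Fin.succAbove, Fin.lt_def]
        split_ifs <;> simp_all <;> omega
      simp only [Fin.removeNth, this, permSendToZero_succAbove, Fin.cons_succ]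
  have e2 : (fun i => (Fin.cons X v : Fin (n + 1) → V) (permSendToZero
      (Fin.cast h (Fin.natAdd k b), τ) (Fin.cast h (Fin.castAdd (p + 1) i)))) =
      fun i => v (τ (Fin.cast h' (Fin.castAdd p i))) := by
    ext i
    have : Fin.cast h (Fin.castAdd (p + 1) i) =
        (Fin.cast h (Fin.natAdd k b)).succAbove (Fin.cast h' (Fin.castAdd p i)) := by
      ext
      simp only [Fin.succAbove, Fin.lt_def]
      split_ifs with hlt
      · simp
      · simp at hlt; omega
    simp only [this, permSendToZero_succAbove, Fin.cons_succ]
  rw [e1, e2, map_cons_insertNth]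
  have : (-1 : ℝ) ^ (b : ℕ) * (-1) ^ (b : ℕ) = 1 := by rw [← mul_pow]; norm_num
  rw [pow_add]
  linear_combination -(-1 : ℝ) ^ k * (Equiv.Perm.sign τ : ℝ) *
    η.curryLeft X (Fin.cons (K fun i => v (τ (Fin.cast h' (Fin.castAdd p i))))
          fun j => v (τ (Fin.cast h' (Fin.natAdd k j)))) * this

end InsertSum

/-! ### Comparison of alternating maps, `extDeriv` and `insertForm` with list forms -/

namespace ListForm

variable {V F F' : Type*} [NormedAddCommGroup V] [NormedSpace ℝ V]
  [NormedAddCommGroup F'] [NormedSpace ℝ F'] [NormedAddCommGroup F] [NormedSpace ℝ F]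

/-- An alternating map as a function of lists, zero on lists of the wrong length. -/
def ofAlt {p : ℕ} (η : V [⋀^Fin p]→L[ℝ] F) (l : List V) : F :=
  if h : l.length = p then η fun i => l.get (Fin.cast h.symm i) else 0

theorem ofAlt_of_length_ne {p : ℕ} (η : V [⋀^Fin p]→L[ℝ] F) {l : List V} (h : l.length ≠ p) :
    ofAlt η l = 0 := dif_neg h

theorem ofAlt_ofFn {p : ℕ} (η : V [⋀^Fin p]→L[ℝ] F) (v : Fin p → V) :
    ofAlt η (List.ofFn v) = η v := by
  rw [ofAlt, dif_pos (List.length_ofFn)]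
  congr 1
  ext i
  simp

theorem ofAlt_add {p : ℕ} (η θ : V [⋀^Fin p]→L[ℝ] F) (l : List V) :
    ofAlt (η + θ) l = ofAlt η l + ofAlt θ l := by
  unfold ofAlt; split_ifs <;> simp

theorem ofAlt_smul {p : ℕ} (c : ℝ) (η : V [⋀^Fin p]→L[ℝ] F) (l : List V) :
    ofAlt (c • η) l = c • ofAlt η l := by
  unfold ofAlt; split_ifs <;> simp

theorem ofAlt_zero {p : ℕ} (l : List V) : ofAlt (0 : V [⋀^Fin p]→L[ℝ] F) l = 0 := by
  unfold ofAlt; split_ifs <;> simp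

theorem ofAlt_sub {p : ℕ} (η θ : V [⋀^Fin p]→L[ℝ] F) (l : List V) :
    ofAlt (η - θ) l = ofAlt η l - ofAlt θ l := by
  unfold ofAlt; split_ifs <;> simp

theorem ofAlt_comp {p : ℕ} (A : F →L[ℝ] F') (η : V [⋀^Fin p]→L[ℝ] F) (l : List V) :
    ofAlt (A.compContinuousAlternatingMap η) l = A (ofAlt η l) := by
  unfold ofAlt; split_ifs <;> simp

theorem ofAlt_cons {p : ℕ} (η : V [⋀^Fin (p + 1)]→L[ℝ] F) (X : V) (l : List V) :
    ofAlt η (X :: l) = ofAlt (η.curryLeft X) l := by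
  unfold ofAlt
  simp only [List.length_cons, Nat.add_right_cancel_iff]
  split_ifs with h
  · rw [ContinuousAlternatingMap.curryLeft_apply_apply]
    congr 1
    ext i
    refine Fin.cases rfl (fun i => ?_) i
    simp
  · rfl

theorem ofAlt_zero_cons (η : V [⋀^Fin 0]→L[ℝ] F) (X : V) (l : List V) :
    ofAlt η (X :: l) = 0 := ofAlt_of_length_ne η (by simp)

theorem isMultilinear_ofAlt {p : ℕ} (η : V [⋀^Fin p]→L[ℝ] F) : IsMultilinear (ofAlt η) := by
  constructor
  · intro l m u v
    induction l generalizing p with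
    | nil =>
      cases p with
      | zero => simp [ofAlt_zero_cons]
      | succ p => simp [ofAlt_cons, ofAlt_add]
    | cons X l ih =>
      cases p with
      | zero => simp [ofAlt_zero_cons]
      | succ p => simp only [List.cons_append, ofAlt_cons, ih]
  · intro l m c v
    induction l generalizing p with
    | nil =>
      cases p with
      | zero => simp [ofAlt_zero_cons]
      | succ p => simp [ofAlt_cons, ofAlt_smul]
    | cons X l ih =>
      cases p with
      | zero => simp [ofAlt_zero_cons]
      | succ p => simp only [List.cons_append, ofAlt_cons, ih]

theorem isAlternating_ofAlt {p : ℕ} (η : V [⋀^Fin p]→L[ℝ] F) : IsAlternating (ofAlt η) := by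
  intro l m u v
  induction l generalizing p with
  | nil =>
    match p with
    | 0 => simp [ofAlt_zero_cons]
    | 1 => simp [ofAlt_cons, ofAlt_zero_cons]
    | p + 2 =>
      -- Polarization of the vanishing of the double contraction with `u + v`.
      have key : (η.curryLeft u).curryLeft v = -(η.curryLeft v).curryLeft u := by
        have := η.curryLeft_same (u + v)
        simp only [map_add, ContinuousAlternatingMap.curryLeft_add,
          _root_.add_apply, ContinuousAlternatingMap.curryLeft_same, zero_add,
          add_zero] at this
        exact eq_neg_of_add_eq_zero_left ((add_comm _ _).trans this)
      simp only [List.nil_append, ofAlt_cons, key]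
      rw [← neg_one_smul ℝ, ofAlt_smul, neg_one_smul]
  | cons X l ih =>
    cases p with
    | zero => simp [ofAlt_zero_cons]
    | succ p => simp only [List.cons_append, ofAlt_cons, ih]

theorem hasParity_ofAlt {p : ℕ} (η : V → V [⋀^Fin p]→L[ℝ] F) :
    HasParity ((-1) ^ p) fun x => ofAlt (η x) := by
  intro x l
  by_cases h : l.length = p
  · rw [h]
  · simp [ofAlt_of_length_ne _ h]

theorem isSmooth_ofAlt {p : ℕ} {η : V → V [⋀^Fin p]→L[ℝ] F} (h : ContDiff ℝ ∞ η) :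
    IsSmooth fun x => ofAlt (η x) := by
  refine ⟨fun l => ?_, fun x => isMultilinear_ofAlt _⟩
  unfold ofAlt
  split_ifs with hl
  · exact (ContinuousAlternatingMap.apply ℝ V F _).contDiff.comp h
  · exact contDiff_const

theorem fderiv_ofAlt {p : ℕ} {η : V → V [⋀^Fin p]→L[ℝ] F} {x : V} (h : DifferentiableAt ℝ η x)
    (X : V) (l : List V) :
    fderiv ℝ (fun y => ofAlt (η y) l) x X = ofAlt (fderiv ℝ η x X) l := by
  unfold ofAlt
  split_ifs with hl
  · exact fderiv_continuousAlternatingMap_apply_const_apply h _ _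
  · simp

theorem differentiableAt_curryLeft {p : ℕ} {η : V → V [⋀^Fin (p + 1)]→L[ℝ] F} {x : V}
    (h : DifferentiableAt ℝ η x) (X : V) : DifferentiableAt ℝ (fun y => (η y).curryLeft X) x := by
  let A : (V [⋀^Fin (p + 1)]→L[ℝ] F) →L[ℝ] (V [⋀^Fin p]→L[ℝ] F) :=
    (ContinuousLinearMap.apply ℝ (V [⋀^Fin p]→L[ℝ] F) X).comp
      (ContinuousAlternatingMap.curryLeftLI (𝕜 := ℝ) (E := V) (F := F) (n := p)).toContinuousLinearMap
  exact (A.differentiableAt (x := η x)).comp x h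

/-- In the alternating sum for `dη` the first term differentiates along `X`. In all others `X`
remains the first argument, and the shift of the index by one gives the minus sign. -/
theorem curryLeft_extDeriv {p : ℕ} {η : V → V [⋀^Fin (p + 1)]→L[ℝ] F} {x : V}
    (h : DifferentiableAt ℝ η x) (X : V) :
    (extDeriv η x).curryLeft X = fderiv ℝ η x X - extDeriv (fun y => (η y).curryLeft X) x := by
  have h' : DifferentiableAt ℝ (fun y => (η y).curryLeft X) x :=
      differentiableAt_curryLeft h X
  ext v
  rw [ContinuousAlternatingMap.curryLeft_apply_apply, extDeriv_apply h, Fin.sum_univ_succ,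
    ContinuousAlternatingMap.sub_apply, extDeriv_apply h', sub_eq_add_neg, ← Finset.sum_neg_distrib]
  congr 1
  · simp only [Fin.val_zero, pow_zero, one_smul, Fin.removeNth_zero, Matrix.cons_val_zero]
    exact fderiv_continuousAlternatingMap_apply_const_apply h _ _
  · refine Finset.sum_congr rfl fun i _ => ?_
    simp only [Fin.val_succ, pow_succ, mul_neg, mul_one, neg_smul, Matrix.cons_val_succ,
      ContinuousAlternatingMap.curryLeft_apply_apply, neg_inj]
    congr 3
    ext y
    congr 1
    ext j
    refine Fin.cases ?_ (fun j => ?_) j <;> simp [Fin.removeNth]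

theorem ofAlt_extDeriv {p : ℕ} {η : V → V [⋀^Fin p]→L[ℝ] F} {x : V}
    (h : DifferentiableAt ℝ η x) (l : List V) :
    ofAlt (extDeriv η x) l = extD (fun y => ofAlt (η y)) x l := by
  induction l generalizing p with
  | nil => rw [extD_nil, ofAlt_of_length_ne _ (by simp)]
  | cons X l ih =>
    rw [extD_cons, ofAlt_cons, dirDeriv, fderiv_ofAlt h]
    cases p with
    | zero =>
      -- A function has no contraction, so only the directional derivative survives in degree zero.
      have h0 : contract X (fun y => ofAlt (η y)) = 0 := by
        ext y m; exact ofAlt_zero_cons _ _ _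
      have h1 : (extDeriv η x).curryLeft X = fderiv ℝ η x X := by
        ext v
        rw [ContinuousAlternatingMap.curryLeft_apply_apply, extDeriv_apply h, Fin.sum_univ_one]
        simp only [Fin.val_zero, pow_zero, one_smul, Fin.removeNth_zero, Matrix.cons_val_zero]
        exact fderiv_continuousAlternatingMap_apply_const_apply h _ _
      have h2 : extD (0 : V → List V → F) x l = 0 := by
        clear ih
        suffices ∀ β : V → List V → F, β = 0 → extD β x l = 0 from this 0 rfl
        induction l with
        | nil => intro β _; exact extD_nil _ _
        | cons Y l ih =>
          rintro β rfl
          rw [extD_cons, ih (contract Y 0) rfl]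
          simp [dirDeriv]
      rw [h0, h1, h2, sub_zero]
    | succ p =>
      have h' : DifferentiableAt ℝ (fun y => (η y).curryLeft X) x :=
      differentiableAt_curryLeft h X
      have h0 : contract X (fun y => ofAlt (η y)) = fun y => ofAlt ((η y).curryLeft X) := by
        ext y m; exact ofAlt_cons _ _ _
      rw [curryLeft_extDeriv h, ofAlt_sub, h0, ih h']

theorem insertAt_eq_zero {α : List V → F} (hα : ∀ X l, α (X :: l) = 0) (K : List V → V)
    (l : List V) : insertAt K α l = 0 := by
  induction l generalizing K α with
  | nil => rw [insertAt_nil, hα]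
  | cons X l ih => rw [insertAt_cons, ih hα, ih (fun Y m => hα X (Y :: m)), sub_zero]

theorem insertAt_zero_left {α : List V → F} (hα : IsMultilinear α) (l : List V) :
    insertAt (fun _ => 0) α l = 0 := by
  have h := insertAt_smul_left hα 0 0 l
  rw [zero_smul, zero_smul] at h
  exact h

theorem insertSum_cast {k p n : ℕ} (h : k + p = n) (K : V [⋀^Fin k]→L[ℝ] V)
    (η : V [⋀^Fin (p + 1)]→L[ℝ] ℝ) (w : Fin n → V) :
    insertSum h K η w = insertSum rfl K η fun i => w (Fin.cast h i) := by
  subst h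
  rfl

/-- Splitting the sum by whether the first vector enters `K` or `η` reproduces the recursion of
`insertAt`; the factorials absorb the number of equal slots. -/
theorem insertSum_eq_insertAt {k p : ℕ} (K : V [⋀^Fin k]→L[ℝ] V) (η : V [⋀^Fin (p + 1)]→L[ℝ] ℝ)
    (l : List V) (h : k + p = l.length) :
    ((k.factorial : ℝ) * (p.factorial : ℝ))⁻¹ * insertSum h K η l.get =
      insertAt (ofAlt K) (ofAlt η) l := by
  induction l generalizing k p with
  | nil =>
    obtain ⟨rfl, rfl⟩ : k = 0 ∧ p = 0 := by simpa using h
    rw [insertAt_nil]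
    have h1 : ofAlt K [] = K ![] := ofAlt_ofFn K ![]
    have h2 : ofAlt η [ofAlt K []] = η ![ofAlt K []] := ofAlt_ofFn η ![ofAlt K []]
    rw [h2, h1]
    have : IsEmpty (Fin ([] : List V).length) := inferInstanceAs (IsEmpty (Fin 0))
    rw [insertSum, Fintype.sum_eq_single 1 fun σ hσ => absurd (Subsingleton.elim σ 1) hσ]
    simp only [Nat.factorial_zero, Nat.cast_one, mul_one, inv_one, one_mul, Equiv.Perm.sign_one,
      Units.val_one, Int.cast_one]
    congr 1
    ext i
    obtain rfl : i = 0 := Fin.fin_one_eq_zero i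
    simp only [Fin.cons_zero, Matrix.cons_val_zero]
    congr 1
    exact Subsingleton.elim _ _
  | cons X l ih =>
    have hget : (X :: l).get = (Fin.cons X l.get : Fin (l.length + 1) → V) := by
      ext i
      refine Fin.cases ?_ (fun i => ?_) i <;> simp
    have hsgn : (fun m : List V => (-1 : ℝ) ^ m.length • ofAlt K m) = (-1 : ℝ) ^ k • ofAlt K :=
      funext fun m => hasParity_ofAlt (fun _ : V => K) 0 m
    have hη : (fun m => ofAlt η (X :: m)) = ofAlt (η.curryLeft X) := funext (ofAlt_cons η X)
    rw [hget, insertSum_cons h, insertAt_cons, hsgn, hη,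
      insertAt_smul_left (isMultilinear_ofAlt _), mul_add, sub_eq_add_neg]
    congr 1
    · cases k with
      | zero =>
        have h0 : (fun m => ofAlt K (X :: m)) = fun _ => 0 := funext (ofAlt_zero_cons K X)
        rw [h0, insertAt_zero_left (isMultilinear_ofAlt _)]
        simp
      | succ k =>
        have h' : k + p = l.length := by simp at h; omega
        have h0 : (fun m => ofAlt K (X :: m)) = ofAlt (K.curryLeft X) := funext (ofAlt_cons K X)
        simp only [insertSum_cons_left h h']
        rw [h0, ← ih (K.curryLeft X) η h', Finset.sum_const, Finset.card_univ, Fintype.card_fin,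
          insertSum, Nat.factorial_succ]
        have : (k.factorial : ℝ) ≠ 0 := by positivity
        have : (p.factorial : ℝ) ≠ 0 := by positivity
        have : (k : ℝ) + 1 ≠ 0 := by positivity
        push_cast
        rw [nsmul_eq_mul]
        push_cast
        field_simp
    · cases p with
      | zero =>
        rw [insertAt_eq_zero (ofAlt_zero_cons _)]
        simp
      | succ p =>
        have h' : k + p = l.length := by simp at h; omega
        simp only [insertSum_cons_right h h']
        rw [← ih K (η.curryLeft X) h', Finset.sum_const, Finset.card_univ, Fintype.card_fin,
          insertSum, Nat.factorial_succ, Finset.sum_neg_distrib, ← Finset.mul_sum]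
        have : (k.factorial : ℝ) ≠ 0 := by positivity
        have : (p.factorial : ℝ) ≠ 0 := by positivity
        have : (p : ℝ) + 1 ≠ 0 := by positivity
        push_cast
        rw [nsmul_eq_mul, smul_eq_mul]
        push_cast
        field_simp

theorem insertAt_of_length_ne {k p : ℕ} (K : V [⋀^Fin k]→L[ℝ] V) (η : V [⋀^Fin (p + 1)]→L[ℝ] F)
    (l : List V) (h : l.length ≠ k + p) : insertAt (ofAlt K) (ofAlt η) l = 0 := by
  induction l generalizing k p with
  | nil =>
    rw [insertAt_nil]
    by_cases hk : k = 0
    · exact ofAlt_of_length_ne _ (by simp at h ⊢; omega)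
    · rw [ofAlt_of_length_ne K (by simpa using Ne.symm hk)]
      simpa using (isMultilinear_ofAlt η).smul [] [] 0 0
  | cons X l ih =>
    have hsgn : (fun m : List V => (-1 : ℝ) ^ m.length • ofAlt K m) = (-1 : ℝ) ^ k • ofAlt K :=
      funext fun m => hasParity_ofAlt (fun _ : V => K) 0 m
    have hη : (fun m => ofAlt η (X :: m)) = ofAlt (η.curryLeft X) := funext (ofAlt_cons η X)
    rw [insertAt_cons, hsgn, hη, insertAt_smul_left (isMultilinear_ofAlt _)]
    have e1 : insertAt (fun m => ofAlt K (X :: m)) (ofAlt η) l = 0 := by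
      cases k with
      | zero =>
        rw [show (fun m => ofAlt K (X :: m)) = fun _ => 0 from funext (ofAlt_zero_cons K X),
          insertAt_zero_left (isMultilinear_ofAlt _)]
      | succ k =>
        rw [show (fun m => ofAlt K (X :: m)) = ofAlt (K.curryLeft X) from funext (ofAlt_cons K X)]
        exact ih _ _ (by simp at h; omega)
    have e2 : insertAt (ofAlt K) (ofAlt (η.curryLeft X)) l = 0 := by
      cases p with
      | zero => exact insertAt_eq_zero (ofAlt_zero_cons _) _ _
      | succ p => exact ih _ _ (by simp at h; omega)
    rw [e1, e2, smul_zero, sub_zero]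

theorem ofAlt_insertForm {k p : ℕ} (K : V [⋀^Fin k]→L[ℝ] V) (η : V [⋀^Fin (p + 1)]→L[ℝ] ℝ) :
    ofAlt (insertForm K η) = insertAt (ofAlt K) (ofAlt η) := by
  ext l
  by_cases h : l.length = k + p
  · rw [← insertSum_eq_insertAt K η l h.symm, ofAlt, dif_pos h, insertForm_apply,
      insertSum_cast]
    rfl
  · rw [insertAt_of_length_ne K η l h, ofAlt_of_length_ne _ h]

end ListForm

/-! ### Smoothness of fields of alternating maps -/

section AltSmooth

variable {X V V' F F' : Type*} [NormedAddCommGroup X] [NormedSpace ℝ X]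
  [NormedAddCommGroup V] [NormedSpace ℝ V] [NormedAddCommGroup V'] [NormedSpace ℝ V']
  [NormedAddCommGroup F] [NormedSpace ℝ F] [NormedAddCommGroup F'] [NormedSpace ℝ F']
  {n : WithTop ℕ∞} {s : Set X}

/-- Induction on the degree: the first argument is expanded in a basis, and contraction with a fixed
basis vector is a continuous linear operation on `η`. -/
theorem ContDiffOn.alternating_apply [FiniteDimensional ℝ V] {p : ℕ} {η : X → V [⋀^Fin p]→L[ℝ] F}
    (hη : ContDiffOn ℝ n η s) {v : X → Fin p → V} (hv : ∀ i, ContDiffOn ℝ n (fun x => v x i) s) :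
    ContDiffOn ℝ n (fun x => η x (v x)) s := by
  induction p with
  | zero =>
    have : (fun x => η x (v x)) = fun x => ContinuousAlternatingMap.apply ℝ V F ![] (η x) := by
      ext x
      rw [Subsingleton.elim (v x) ![]]
      rfl
    rw [this]
    exact (ContinuousAlternatingMap.apply ℝ V F ![]).contDiff.comp_contDiffOn hη
  | succ p ih =>
    let A : V → (V [⋀^Fin (p + 1)]→L[ℝ] F) →L[ℝ] (V [⋀^Fin p]→L[ℝ] F) := fun Y =>
      (ContinuousLinearMap.apply ℝ (V [⋀^Fin p]→L[ℝ] F) Y).comp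
        (ContinuousAlternatingMap.curryLeftLI (𝕜 := ℝ) (E := V) (F := F)
          (n := p)).toContinuousLinearMap
    have h1 : ContDiffOn ℝ n (fun x => (η x).curryLeft (v x 0)) s := by
      have hsum : ∀ x, (η x).curryLeft (v x 0) =
          ∑ j, (Module.finBasis ℝ V).equivFunL (v x 0) j • A (Module.finBasis ℝ V j) (η x) := by
        intro x
        conv_lhs => rw [← (Module.finBasis ℝ V).sum_equivFun (v x 0), map_sum]
        simp [A]
      simp only [hsum]
      refine ContDiffOn.sum fun j _ => ?_
      have h3 : ContDiffOn ℝ n (fun x => (Module.finBasis ℝ V).equivFunL (v x 0) j) s :=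
        (contDiff_apply ℝ ℝ j).comp_contDiffOn
          ((Module.finBasis ℝ V).equivFunL.contDiff.comp_contDiffOn (hv 0))
      have h4 : ContDiffOn ℝ n (fun x => A (Module.finBasis ℝ V j) (η x)) s :=
        (A (Module.finBasis ℝ V j)).contDiff.comp_contDiffOn hη
      exact h3.smul h4
    have h2 := ih h1 (v := fun x i => v x i.succ) fun i => hv i.succ
    refine h2.congr fun x _ => ?_
    rw [ContinuousAlternatingMap.curryLeft_apply_apply]
    congr 1
    ext i
    refine Fin.cases rfl (fun i => rfl) i

/-- Evaluation on tuples of basis vectors is linear and injective. A linear left inverse is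
continuous because its domain is finite-dimensional, so smooth values on these tuples give a smooth
field. -/
theorem contDiffOn_alternating [FiniteDimensional ℝ V] [FiniteDimensional ℝ F] {p : ℕ}
    {η : X → V [⋀^Fin p]→L[ℝ] F} (h : ∀ v, ContDiffOn ℝ n (fun x => η x v) s) :
    ContDiffOn ℝ n η s := by
  let b := Module.finBasis ℝ V
  let Φ : (V [⋀^Fin p]→L[ℝ] F) →ₗ[ℝ] ((Fin p → Fin (Module.finrank ℝ V)) → F) :=
    { toFun := fun η r => η fun i => b (r i)
      map_add' := fun _ _ => rfl
      map_smul' := fun _ _ => rfl }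
  have hΦ : LinearMap.ker Φ = ⊥ := by
    rw [LinearMap.ker_eq_bot]
    intro η θ hηθ
    apply ContinuousAlternatingMap.toContinuousMultilinearMap_injective
    apply ContinuousMultilinearMap.toMultilinearMap_injective
    exact Module.Basis.ext_multilinear (fun _ => b) fun r => congrFun hηθ r
  obtain ⟨Λ, hΛ⟩ := Φ.exists_leftInverse_of_injective hΦ
  have hη : η = fun x => Λ.toContinuousLinearMap (Φ (η x)) :=
    funext fun x => (LinearMap.congr_fun hΛ (η x)).symm
  rw [hη]
  refine Λ.toContinuousLinearMap.contDiff.comp_contDiffOn ?_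
  exact contDiffOn_pi.2 fun r => h _

theorem ContDiffOn.alternating_comp [FiniteDimensional ℝ V] [FiniteDimensional ℝ V']
    [FiniteDimensional ℝ F] {p : ℕ}
    {η : X → V' [⋀^Fin p]→L[ℝ] F} {A : X → V →L[ℝ] V'}
    (hη : ContDiffOn ℝ n η s) (hA : ContDiffOn ℝ n A s) :
    ContDiffOn ℝ n (fun x => (η x).compContinuousLinearMap (A x)) s :=
  contDiffOn_alternating fun _ => hη.alternating_apply fun _ => hA.clm_apply contDiffOn_const

theorem ContDiffOn.comp_alternating [FiniteDimensional ℝ V] [FiniteDimensional ℝ F'] {p : ℕ}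
    {η : X → V [⋀^Fin p]→L[ℝ] F} {A : X → F →L[ℝ] F'}
    (hη : ContDiffOn ℝ n η s) (hA : ContDiffOn ℝ n A s) :
    ContDiffOn ℝ n (fun x => (A x).compContinuousAlternatingMap (η x)) s :=
  contDiffOn_alternating fun _ => hA.clm_apply (hη.alternating_apply fun _ => contDiffOn_const)

theorem ContDiffOn.insertForm [FiniteDimensional ℝ V] {k p : ℕ} {K : X → V [⋀^Fin k]→L[ℝ] V}
    {η : X → V [⋀^Fin (p + 1)]→L[ℝ] ℝ} (hK : ContDiffOn ℝ n K s) (hη : ContDiffOn ℝ n η s) :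
    ContDiffOn ℝ n (fun x => insertForm (K x) (η x)) s := by
  refine contDiffOn_alternating fun v => ?_
  simp only [insertForm_apply]
  refine contDiffOn_const.mul (ContDiffOn.sum fun σ _ => contDiffOn_const.mul ?_)
  refine hη.alternating_apply fun i => ?_
  refine Fin.cases ?_ (fun j => ?_) i
  · exact hK.alternating_apply fun _ => contDiffOn_const
  · exact contDiffOn_const

theorem ContDiffOn.extDeriv {p : ℕ} {η : V → V [⋀^Fin p]→L[ℝ] F} {W : Set V} (hW : IsOpen W)
    (hη : ContDiffOn ℝ ∞ η W) : ContDiffOn ℝ ∞ (extDeriv η) W :=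
  (ContinuousAlternatingMap.alternatizeUncurryFinCLM ℝ V F).contDiff.comp_contDiffOn
    (hη.fderiv_of_isOpen hW (by simp))

/-- Transport of an alternating map along an equality of degrees. -/
def castAlt {m n : ℕ} (h : m = n) (η : V [⋀^Fin m]→L[ℝ] F) : V [⋀^Fin n]→L[ℝ] F := h ▸ η

theorem ContDiffOn.castAlt {a b : ℕ} (h : a = b) {η : X → V [⋀^Fin a]→L[ℝ] F}
    (hη : ContDiffOn ℝ n η s) : ContDiffOn ℝ n (fun x => castAlt h (η x)) s := by
  subst h
  exact hη

theorem ofAlt_castAlt {a b : ℕ} (h : a = b) (η : V [⋀^Fin a]→L[ℝ] F) :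
    ListForm.ofAlt (castAlt h η) = ListForm.ofAlt η := by
  subst h
  rfl

end AltSmooth

/-- Pointwise naturality of insertion: relatedness moves `A` past `K` in the first slot of `η`. -/
theorem insertForm_comp {V V' : Type*} [AddCommGroup V] [Module ℝ V] [TopologicalSpace V]
    [AddCommGroup V'] [Module ℝ V'] [TopologicalSpace V'] {k p : ℕ}
    {K : V [⋀^Fin k]→L[ℝ] V} {K' : V' [⋀^Fin k]→L[ℝ] V'}
    (A : V →L[ℝ] V') (hA : ∀ v, A (K v) = K' fun i => A (v i)) (η : V' [⋀^Fin (p + 1)]→L[ℝ] ℝ) :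
    insertForm K (η.compContinuousLinearMap A) = (insertForm K' η).compContinuousLinearMap A := by
  ext v
  rw [ContinuousAlternatingMap.compContinuousLinearMap_apply, insertForm_apply, insertForm_apply]
  congr 1
  refine Finset.sum_congr rfl fun σ _ => ?_
  congr 1
  rw [ContinuousAlternatingMap.compContinuousLinearMap_apply]
  congr 1
  ext i
  refine Fin.cases ?_ (fun j => rfl) i
  exact hA _

/-- Insertion into a one-form is evaluation. -/
theorem insertForm_ofSubsingleton {V : Type*} [AddCommGroup V] [Module ℝ V] [TopologicalSpace V]
    {k : ℕ} (K : V [⋀^Fin k]→L[ℝ] V) (φ : V →L[ℝ] ℝ)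
    (v : Fin k → V) :
    insertForm (p := 0) K (ContinuousAlternatingMap.ofSubsingleton ℝ V ℝ (0 : Fin 1) φ) v =
      φ (K v) := by
  rw [insertForm_apply]
  have h : ∀ σ : Equiv.Perm (Fin (k + 0)), (Equiv.Perm.sign σ : ℝ) *
      ContinuousAlternatingMap.ofSubsingleton ℝ V ℝ (0 : Fin 1) φ
        (Fin.cons (K fun i => v (σ (Fin.castAdd 0 i))) fun j => v (σ (Fin.natAdd k j))) =
      φ (K v) := by
    intro σ
    have h1 : (K fun i => v (σ (Fin.castAdd 0 i))) = Equiv.Perm.sign σ • K v :=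
      K.toAlternatingMap.map_perm v σ
    have h2 : ((Equiv.Perm.sign σ : ℤ) : ℝ) * ((Equiv.Perm.sign σ : ℤ) : ℝ) = 1 := by
      rcases Int.units_eq_one_or (Equiv.Perm.sign σ) with h | h <;> simp [h]
    rw [h1]
    change _ * φ (Equiv.Perm.sign σ • K v) = _
    rw [Units.smul_def, ← Int.cast_smul_eq_zsmul ℝ, map_smul, smul_eq_mul, ← mul_assoc, h2, one_mul]
  rw [Finset.sum_congr rfl fun σ _ => h σ]
  simp [Fintype.card_perm, Nat.factorial_ne_zero]

/-! ### The Frölicher–Nijenhuis bracket on open subsets of a vector space -/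

section Flat

open Filter Topology

variable {V V' : Type*} [NormedAddCommGroup V] [NormedSpace ℝ V] [FiniteDimensional ℝ V]
  [NormedAddCommGroup V'] [NormedSpace ℝ V'] [FiniteDimensional ℝ V'] {k l : ℕ}

/-- The Lie derivative along a vector-valued form on a vector space. -/
def flatLie (K : V → V [⋀^Fin k]→L[ℝ] V) :
    ∀ {p : ℕ}, (V → V [⋀^Fin p]→L[ℝ] ℝ) → V → V [⋀^Fin (k + p)]→L[ℝ] ℝ
  | 0, f => fun x => (-1 : ℝ) ^ k • insertForm (K x) (extDeriv f x)
  | _ + 1, η => fun x => extDeriv (fun y => insertForm (K y) (η y)) x +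
      (-1 : ℝ) ^ k • insertForm (K x) (extDeriv η x)

/-- The Frölicher–Nijenhuis bracket on a vector space, in terms of components. -/
def flatBracket (K : V → V [⋀^Fin k]→L[ℝ] V) (L : V → V [⋀^Fin l]→L[ℝ] V) (x : V) :
    V [⋀^Fin (k + l)]→L[ℝ] V :=
  ∑ j, (ContinuousLinearMap.toSpanSingleton ℝ (Module.finBasis ℝ V j)).compContinuousAlternatingMap
    ((-1 : ℝ) ^ k • flatLie K (fun y => ((Module.finBasis ℝ V).coord
        j).toContinuousLinearMap.compContinuousAlternatingMap (L y)) x -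
      ((-1 : ℝ) ^ (k * l) * (-1) ^ l) • castAlt (add_comm l k)
        (flatLie L (fun y => ((Module.finBasis ℝ V).coord
          j).toContinuousLinearMap.compContinuousAlternatingMap (K y)) x))

theorem ContDiffOn.flatLie {W : Set V} (hW : IsOpen W) {K : V → V [⋀^Fin k]→L[ℝ] V}
    (hK : ContDiffOn ℝ ∞ K W) {p : ℕ} {η : V → V [⋀^Fin p]→L[ℝ] ℝ} (hη : ContDiffOn ℝ ∞ η W) :
    ContDiffOn ℝ ∞ (flatLie K η) W := by
  cases p with
  | zero => exact (hK.insertForm (hη.extDeriv hW)).const_smul _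
  | succ p =>
    exact ((hK.insertForm hη).extDeriv hW).add ((hK.insertForm (hη.extDeriv hW)).const_smul _)

theorem ContDiffOn.flatBracket {W : Set V} (hW : IsOpen W) {K : V → V [⋀^Fin k]→L[ℝ] V}
    {L : V → V [⋀^Fin l]→L[ℝ] V} (hK : ContDiffOn ℝ ∞ K W) (hL : ContDiffOn ℝ ∞ L W) :
    ContDiffOn ℝ ∞ (flatBracket K L) W := by
  refine ContDiffOn.sum fun j _ => ContDiffOn.comp_alternating ?_ contDiffOn_const
  refine ContDiffOn.sub (ContDiffOn.const_smul _ ?_) (ContDiffOn.const_smul _ ?_)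
  · exact ContDiffOn.flatLie hW hK (hL.comp_alternating contDiffOn_const)
  · exact (ContDiffOn.flatLie hW hL (hK.comp_alternating contDiffOn_const)).castAlt _

/-- Locality. Equality of germs is concluded, rather than of values, so that the statement can be
iterated; it permits cutting off forms and replacing them by their chart expressions. -/
theorem flatLie_congr {K K' : V → V [⋀^Fin k]→L[ℝ] V} {p : ℕ} {η η' : V → V [⋀^Fin p]→L[ℝ] ℝ}
    {x : V} (hK : K =ᶠ[𝓝 x] K') (hη : η =ᶠ[𝓝 x] η') : flatLie K η =ᶠ[𝓝 x] flatLie K' η' := by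
  cases p with
  | zero =>
    filter_upwards [hK, hη.extDeriv] with y h1 h2
    simp only [flatLie, h1, h2]
  | succ p =>
    have h3 : (fun y => insertForm (K y) (η y)) =ᶠ[𝓝 x] fun y => insertForm (K' y) (η' y) := by
      filter_upwards [hK, hη] with y h1 h2
      rw [h1, h2]
    filter_upwards [hK, hη.extDeriv, h3.extDeriv] with y h1 h2 h3
    simp only [flatLie, h1, h2, h3]

theorem flatBracket_congr {K K' : V → V [⋀^Fin k]→L[ℝ] V} {L L' : V → V [⋀^Fin l]→L[ℝ] V}
    {x : V} (hK : K =ᶠ[𝓝 x] K') (hL : L =ᶠ[𝓝 x] L') :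
    flatBracket K L =ᶠ[𝓝 x] flatBracket K' L' := by
  have h1 := fun j => flatLie_congr hK (η := fun y => ((Module.finBasis ℝ V).coord
        j).toContinuousLinearMap.compContinuousAlternatingMap (L y))
      (hL.fun_comp (((Module.finBasis ℝ V).coord
        j).toContinuousLinearMap.compContinuousAlternatingMap ·))
  have h2 := fun j => flatLie_congr hL (η := fun y => ((Module.finBasis ℝ V).coord
        j).toContinuousLinearMap.compContinuousAlternatingMap (K y))
      (hK.fun_comp (((Module.finBasis ℝ V).coord
        j).toContinuousLinearMap.compContinuousAlternatingMap ·))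
  filter_upwards [eventually_all.2 h1, eventually_all.2 h2] with y h1 h2
  refine Finset.sum_congr rfl fun j _ => ?_
  rw [h1 j, h2 j]
  rfl

theorem koszulSign_pow (k l : ℕ) : ListForm.koszulSign ((-1) ^ k) ((-1) ^ l) = (-1) ^ (k * l) := by
  rw [pow_mul]
  rcases neg_one_pow_eq_or ℝ k with h | h <;> rcases neg_one_pow_eq_or ℝ l with h' | h' <;>
    norm_num [ListForm.koszulSign, h, h']

theorem ofAlt_flatLie {K : V → V [⋀^Fin k]→L[ℝ] V} (hK : ContDiff ℝ ∞ K) {p : ℕ}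
    {η : V → V [⋀^Fin p]→L[ℝ] ℝ} (hη : ContDiff ℝ ∞ η) :
    (fun x => ListForm.ofAlt (flatLie K η x)) =
      ListForm.lie ((-1) ^ k) (fun x => ListForm.ofAlt (K x)) fun x => ListForm.ofAlt (η x) := by
  have hd : (fun x => ListForm.ofAlt (extDeriv η x)) =
      ListForm.extD fun x => ListForm.ofAlt (η x) := by
    ext x m
    exact ListForm.ofAlt_extDeriv (hη.differentiable (by simp) x) m
  have hi : ∀ {q : ℕ} (θ : V → V [⋀^Fin (q + 1)]→L[ℝ] ℝ),
      (fun x => ListForm.ofAlt (insertForm (K x) (θ x))) =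
        ListForm.insert (fun x => ListForm.ofAlt (K x)) fun x => ListForm.ofAlt (θ x) :=
    fun θ => funext fun x => ListForm.ofAlt_insertForm _ _
  cases p with
  | zero =>
    -- On functions `flatLie` has no summand `d i_K`. The list version has one, but it vanishes
    -- because insertion into a form of degree zero does.
    have h0 : ListForm.insert (fun x => ListForm.ofAlt (K x)) (fun x => ListForm.ofAlt (η x)) =
        fun x => ListForm.ofAlt (0 : V [⋀^Fin 0]→L[ℝ] ℝ) := by
      ext x m
      rw [ListForm.ofAlt_zero]
      exact ListForm.insertAt_eq_zero (ListForm.ofAlt_zero_cons _) _ _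
    have h1 : ListForm.extD (fun _ : V => ListForm.ofAlt (0 : V [⋀^Fin 0]→L[ℝ] ℝ)) = 0 := by
      ext x m
      rw [← ListForm.ofAlt_extDeriv (differentiableAt_const _)]
      have : extDeriv (fun _ : V => (0 : V [⋀^Fin 0]→L[ℝ] ℝ)) x = 0 := by
        have h := extDeriv_smul (0 : ℝ) (fun _ : V => (0 : V [⋀^Fin 0]→L[ℝ] ℝ)) (x := x)
        rw [zero_smul, zero_smul] at h
        exact h
      rw [this, ListForm.ofAlt_zero]
      rfl
    rw [ListForm.lie, h0, h1, zero_add, ← hd, ← hi]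
    ext x m
    exact ListForm.ofAlt_smul _ _ _
  | succ p =>
    rw [ListForm.lie, ← hd, ← hi, ← hi]
    have hsm : ContDiff ℝ ∞ fun y => insertForm (K y) (η y) :=
      contDiffOn_univ.1 (hK.contDiffOn.insertForm hη.contDiffOn)
    ext x m
    change ListForm.ofAlt (_ + _) m = _
    rw [ListForm.ofAlt_add, ListForm.ofAlt_smul,
      ListForm.ofAlt_extDeriv (hsm.differentiable (by simp) x)]
    rfl

/-- The bracket on lists differentiates vector-valued forms, whereas `flatLie` acts on real ones;
applied to coordinate functionals, this compares the two componentwise. -/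
theorem ListForm.lie_map {F F' : Type*} [NormedAddCommGroup F] [NormedSpace ℝ F]
    [NormedAddCommGroup F'] [NormedSpace ℝ F'] (A : F →L[ℝ] F') {s : ℝ} {K : V → List V → V}
    {α : V → List V → F} (hK : IsSmooth K) (hα : IsSmooth α) (h : HasParity s K) :
    lie s K (fun x m => A (α x m)) = fun x m => A (lie s K α x m) := by
  have hi : ∀ β : V → List V → F, insert K (fun x m => A (β x m)) = fun x m => A (insert K β x m) :=
    fun β => funext fun x => funext fun m => insertAt_map A.toLinearMap (K x) (β x) m
  simp only [lie]
  rw [hi, extD_map A (hK.insert hα h), extD_map A hα, hi]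
  ext x m
  simp

theorem ofAlt_flatBracket {K : V → V [⋀^Fin k]→L[ℝ] V} {L : V → V [⋀^Fin l]→L[ℝ] V}
    (hK : ContDiff ℝ ∞ K) (hL : ContDiff ℝ ∞ L) :
    (fun x => ListForm.ofAlt (flatBracket K L x)) =
      ListForm.bracket ((-1) ^ k) ((-1) ^ l) (fun x => ListForm.ofAlt (K x))
        fun x => ListForm.ofAlt (L x) := by
  have key : ∀ {k l : ℕ} {K : V → V [⋀^Fin k]→L[ℝ] V} {L : V → V [⋀^Fin l]→L[ℝ] V},
      ContDiff ℝ ∞ K → ContDiff ℝ ∞ L → ∀ (φ : V →L[ℝ] ℝ) (x : V) (m : List V),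
      ListForm.ofAlt (flatLie K (fun y => φ.compContinuousAlternatingMap (L y)) x) m =
        φ (ListForm.lie ((-1) ^ k) (fun x => ListForm.ofAlt (K x))
          (fun x => ListForm.ofAlt (L x)) x m) := by
    intro k l K L hK hL φ x m
    have h1 : ContDiff ℝ ∞ fun y => φ.compContinuousAlternatingMap (L y) :=
      contDiffOn_univ.1 (hL.contDiffOn.comp_alternating contDiffOn_const)
    have h2 := congrFun (congrFun (ofAlt_flatLie hK h1) x) m
    have h3 : (fun x => ListForm.ofAlt (φ.compContinuousAlternatingMap (L x))) =
        fun x m => φ (ListForm.ofAlt (L x) m) := by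
      ext x m; exact ListForm.ofAlt_comp _ _ _
    rw [h3, ListForm.lie_map φ (ListForm.isSmooth_ofAlt hK) (ListForm.isSmooth_ofAlt hL)
      (ListForm.hasParity_ofAlt K)] at h2
    exact h2
  ext x m
  have hsum : ∀ {ι : Type} (s : Finset ι) (f : ι → V [⋀^Fin (k + l)]→L[ℝ] V),
      ListForm.ofAlt (∑ j ∈ s, f j) m = ∑ j ∈ s, ListForm.ofAlt (f j) m := by
    intro ι s f
    classical
    induction s using Finset.induction_on with
    | empty => simp [ListForm.ofAlt_zero]
    | insert a s ha ih => rw [Finset.sum_insert ha, Finset.sum_insert ha, ListForm.ofAlt_add, ih]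
  rw [flatBracket, hsum, ListForm.bracket, koszulSign_pow]
  simp only [ListForm.ofAlt_comp, ListForm.ofAlt_sub, ListForm.ofAlt_smul, ofAlt_castAlt,
    key hK hL, key hL hK]
  conv_rhs => rw [← (Module.finBasis ℝ V).sum_repr ((((-1 : ℝ) ^ k •
    ListForm.lie ((-1) ^ k) (fun x => ListForm.ofAlt (K x)) fun x => ListForm.ofAlt (L x)) -
    ((-1 : ℝ) ^ (k * l) * (-1) ^ l) • ListForm.lie ((-1) ^ l) (fun x => ListForm.ofAlt (L x))
      fun x => ListForm.ofAlt (K x)) x m)]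
  refine Finset.sum_congr rfl fun j _ => ?_
  simp [ContinuousLinearMap.toSpanSingleton_apply]

/-- The defining identity of the bracket, for globally defined forms. -/
theorem flatLie_flatBracket_of_contDiff {K : V → V [⋀^Fin k]→L[ℝ] V} {L : V → V [⋀^Fin l]→L[ℝ] V}
    (hK : ContDiff ℝ ∞ K) (hL : ContDiff ℝ ∞ L) {p : ℕ} {η : V → V [⋀^Fin p]→L[ℝ] ℝ}
    (hη : ContDiff ℝ ∞ η) (x : V) (v : Fin (k + l + p) → V) :
    flatLie (flatBracket K L) η x v =
      flatLie K (flatLie L η) x (fun i => v (Fin.cast (Nat.add_assoc k l p).symm i)) -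
        (-1 : ℝ) ^ (k * l) * flatLie L (flatLie K η) x
          (fun i => v (Fin.cast (by omega : l + (k + p) = k + l + p) i)) := by
  have hB : ContDiff ℝ ∞ (flatBracket K L) :=
    contDiffOn_univ.1 (ContDiffOn.flatBracket isOpen_univ hK.contDiffOn hL.contDiffOn)
  have hLη : ContDiff ℝ ∞ (flatLie L η) :=
    contDiffOn_univ.1 (ContDiffOn.flatLie isOpen_univ hL.contDiffOn hη.contDiffOn)
  have hKη : ContDiff ℝ ∞ (flatLie K η) :=
    contDiffOn_univ.1 (ContDiffOn.flatLie isOpen_univ hK.contDiffOn hη.contDiffOn)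
  have main := ListForm.lie_lie (neg_one_pow_eq_or ℝ k) (neg_one_pow_eq_or ℝ l)
    (ListForm.isSmooth_ofAlt hK) (ListForm.isSmooth_ofAlt hL) (ListForm.isSmooth_ofAlt hη)
    (fun x => ListForm.isAlternating_ofAlt (η x)) (ListForm.hasParity_ofAlt K)
    (ListForm.hasParity_ofAlt L)
  rw [← ofAlt_flatLie hL hη, ← ofAlt_flatLie hK hη, ← ofAlt_flatLie hK hLη,
    ← ofAlt_flatLie hL hKη, ← ofAlt_flatBracket hK hL, ← pow_add, ← ofAlt_flatLie hB hη,
    koszulSign_pow] at main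
  -- Evaluated on a list, the three terms of different nominal degree have the same argument; the
  -- casts reappear only through `List.ofFn_congr`.
  have h1 := congrFun (congrFun main x) (List.ofFn v)
  simp only [Pi.sub_apply, Pi.smul_apply, ListForm.ofAlt_ofFn, smul_eq_mul] at h1
  rw [← h1]
  congr 1
  · rw [← ListForm.ofAlt_ofFn, List.ofFn_congr (Nat.add_assoc k l p)]
  · rw [← ListForm.ofAlt_ofFn (flatLie L (flatLie K η) x),
      List.ofFn_congr (by omega : k + l + p = l + (k + p))]

/-- A locally smooth map agrees near a point with a globally smooth one. -/
theorem ContDiffOn.exists_contDiff_eventuallyEq {F : Type*} [NormedAddCommGroup F]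
    [NormedSpace ℝ F] {W : Set V} (hW : IsOpen W) {f : V → F} (hf : ContDiffOn ℝ ∞ f W) {x : V}
    (hx : x ∈ W) : ∃ g : V → F, ContDiff ℝ ∞ g ∧ f =ᶠ[𝓝 x] g := by
  obtain ⟨r, hr, hrW⟩ := Metric.nhds_basis_closedBall.mem_iff.1 (hW.mem_nhds hx)
  -- The support of `χ` is the closed ball of radius `r`, which lies in `W`, so the product vanishes
  -- near every point outside `W`.
  let χ : ContDiffBump x := ⟨r / 2, r, half_pos hr, half_lt_self hr⟩
  refine ⟨fun y => χ y • f y, contDiff_iff_contDiffAt.2 fun y => ?_, ?_⟩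
  · by_cases hy : y ∈ W
    · exact χ.contDiff.contDiffAt.smul ((hf y hy).contDiffAt (hW.mem_nhds hy))
    · have hy' : y ∈ (tsupport χ)ᶜ := by
        rw [χ.tsupport_eq]
        exact fun h => hy (hrW h)
      have h0 : (fun y => χ y • f y) =ᶠ[𝓝 y] fun _ => 0 := by
        filter_upwards [(isClosed_tsupport χ).isOpen_compl.mem_nhds hy'] with z hz
        rw [image_eq_zero_of_notMem_tsupport hz, zero_smul]
      exact contDiffAt_const.congr_of_eventuallyEq h0
  · filter_upwards [χ.eventuallyEq_one] with y hy
    rw [hy, Pi.one_apply, one_smul]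

/-- The defining identity of the bracket. -/
theorem flatLie_flatBracket {W : Set V} (hW : IsOpen W) {K : V → V [⋀^Fin k]→L[ℝ] V}
    {L : V → V [⋀^Fin l]→L[ℝ] V} (hK : ContDiffOn ℝ ∞ K W) (hL : ContDiffOn ℝ ∞ L W) {p : ℕ}
    {η : V → V [⋀^Fin p]→L[ℝ] ℝ} (hη : ContDiffOn ℝ ∞ η W) {x : V} (hx : x ∈ W)
    (v : Fin (k + l + p) → V) :
    flatLie (flatBracket K L) η x v =
      flatLie K (flatLie L η) x (fun i => v (Fin.cast (Nat.add_assoc k l p).symm i)) -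
        (-1 : ℝ) ^ (k * l) * flatLie L (flatLie K η) x
          (fun i => v (Fin.cast (by omega : l + (k + p) = k + l + p) i)) := by
  obtain ⟨K', hK', hKK⟩ := hK.exists_contDiff_eventuallyEq hW hx
  obtain ⟨L', hL', hLL⟩ := hL.exists_contDiff_eventuallyEq hW hx
  obtain ⟨η', hη', hηη⟩ := hη.exists_contDiff_eventuallyEq hW hx
  rw [(flatLie_congr (flatBracket_congr hKK hLL) hηη).eq_of_nhds,
    (flatLie_congr hKK (flatLie_congr hLL hηη)).eq_of_nhds,
    (flatLie_congr hLL (flatLie_congr hKK hηη)).eq_of_nhds]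
  exact flatLie_flatBracket_of_contDiff hK' hL' hη' x v

/-- Pullback commutes with `d`, and with insertion of related forms, hence with the Lie derivatives
built from them. -/
theorem flatLie_pullback {W : Set V} {W' : Set V'} (hW : IsOpen W) (hW' : IsOpen W')
    {K : V → V [⋀^Fin k]→L[ℝ] V} {K' : V' → V' [⋀^Fin k]→L[ℝ] V'} {f : V → V'}
    (hf : ContDiffOn ℝ ∞ f W) (hWW : Set.MapsTo f W W') (hK' : ContDiffOn ℝ ∞ K' W')
    (hKK : ∀ x ∈ W, ∀ v, fderiv ℝ f x (K x v) = K' (f x) fun i => fderiv ℝ f x (v i))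
    {p : ℕ} {η : V' → V' [⋀^Fin p]→L[ℝ] ℝ} (hη : ContDiffOn ℝ ∞ η W') {x : V} (hx : x ∈ W) :
    flatLie K (fun y => (η (f y)).compContinuousLinearMap (fderiv ℝ f y)) x =
      (flatLie K' η (f x)).compContinuousLinearMap (fderiv ℝ f x) := by
  have hfx : ContDiffAt ℝ ∞ f x := (hf x hx).contDiffAt (hW.mem_nhds hx)
  have hfx' : W' ∈ 𝓝 (f x) := hW'.mem_nhds (hWW hx)
  have hd : ∀ {q : ℕ} {θ : V' → V' [⋀^Fin q]→L[ℝ] ℝ}, ContDiffOn ℝ ∞ θ W' →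
      extDeriv (fun y => (θ (f y)).compContinuousLinearMap (fderiv ℝ f y)) x =
        (extDeriv θ (f x)).compContinuousLinearMap (fderiv ℝ f x) := fun hθ =>
    extDeriv_pullback (((hθ _ (hWW hx)).contDiffAt hfx').differentiableAt (by simp)) hfx
      (by simpa using WithTop.coe_le_coe.2 (OrderTop.le_top (2 : ℕ∞)))
  cases p with
  | zero =>
    simp only [flatLie]
    rw [hd hη, insertForm_comp _ (hKK x hx)]
    rfl
  | succ p =>
    simp only [flatLie]
    rw [hd hη, insertForm_comp _ (hKK x hx)]
    have h1 : (fun y => insertForm (K y) ((η (f y)).compContinuousLinearMap (fderiv ℝ f y)))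
        =ᶠ[𝓝 x] fun y => (insertForm (K' (f y)) (η (f y))).compContinuousLinearMap
          (fderiv ℝ f y) := by
      filter_upwards [hW.mem_nhds hx] with y hy
      exact insertForm_comp _ (hKK y hy) _
    rw [h1.extDeriv_eq, hd (hK'.insertForm hη)]
    rfl

/-- Brackets of related forms are related. -/
theorem flatBracket_related {W : Set V} {W' : Set V'} (hW : IsOpen W) (hW' : IsOpen W')
    {K : V → V [⋀^Fin k]→L[ℝ] V} {K' : V' → V' [⋀^Fin k]→L[ℝ] V'}
    {L : V → V [⋀^Fin l]→L[ℝ] V} {L' : V' → V' [⋀^Fin l]→L[ℝ] V'} {f : V → V'}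
    (hf : ContDiffOn ℝ ∞ f W) (hWW : Set.MapsTo f W W')
    (hK : ContDiffOn ℝ ∞ K W) (hL : ContDiffOn ℝ ∞ L W)
    (hK' : ContDiffOn ℝ ∞ K' W') (hL' : ContDiffOn ℝ ∞ L' W')
    (hKK : ∀ x ∈ W, ∀ v, fderiv ℝ f x (K x v) = K' (f x) fun i => fderiv ℝ f x (v i))
    (hLL : ∀ x ∈ W, ∀ v, fderiv ℝ f x (L x v) = L' (f x) fun i => fderiv ℝ f x (v i))
    {x : V} (hx : x ∈ W) (v : Fin (k + l) → V) :
    fderiv ℝ f x (flatBracket K L x v) = flatBracket K' L' (f x) fun i => fderiv ℝ f x (v i) := by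
  refine SeparatingDual.eq_iff_forall_dual_eq (R := ℝ).2 fun φ => ?_
  -- A linear functional, taken as a function, is its own differential. The Lie derivatives of `θ`
  -- and of its pullback `θ₀` along the brackets are therefore, up to one common sign, the two sides
  -- tested against `φ`.
  let θ : V' → V' [⋀^Fin 0]→L[ℝ] ℝ := fun y =>
    ContinuousAlternatingMap.constOfIsEmpty ℝ V' (Fin 0) (φ y)
  have hθ : ContDiff ℝ ∞ θ :=
    (ContinuousAlternatingMap.constOfIsEmptyLIE ℝ V' ℝ (Fin 0)).contDiff.comp φ.contDiff
  let θ₀ : V → V [⋀^Fin 0]→L[ℝ] ℝ := fun y =>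
    (θ (f y)).compContinuousLinearMap (fderiv ℝ f y)
  have hθ₀ : ContDiffOn ℝ ∞ θ₀ W :=
    (hθ.comp_contDiffOn hf).alternating_comp (hf.fderiv_of_isOpen hW (by simp))
  have hθ₀' : θ₀ = fun y => ContinuousAlternatingMap.constOfIsEmpty ℝ V (Fin 0) (φ (f y)) := rfl
  have hfx : DifferentiableAt ℝ f x :=
    ((hf x hx).contDiffAt (hW.mem_nhds hx)).differentiableAt (by simp)
  have e1 : flatLie (flatBracket K L) θ₀ x v =
      (-1) ^ (k + l) * φ (fderiv ℝ f x (flatBracket K L x v)) := by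
    simp only [flatLie, hθ₀', extDeriv_constOfIsEmpty]
    change (-1 : ℝ) ^ (k + l) * insertForm _ _ _ = _
    rw [insertForm_ofSubsingleton]
    have : fderiv ℝ (fun y => φ (f y)) x = φ.comp (fderiv ℝ f x) :=
      (φ.hasFDerivAt.comp x hfx.hasFDerivAt).fderiv
    rw [this]
    rfl
  have e2 : ∀ w, flatLie (flatBracket K' L') θ (f x) w =
      (-1) ^ (k + l) * φ (flatBracket K' L' (f x) w) := by
    intro w
    simp only [flatLie, θ, extDeriv_constOfIsEmpty]
    change (-1 : ℝ) ^ (k + l) * insertForm _ _ _ = _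
    rw [insertForm_ofSubsingleton]
    have : fderiv ℝ (fun y => φ y) (f x) = φ := φ.fderiv
    rw [this]
  have h1 := flatLie_flatBracket hW hK hL hθ₀ hx v
  have h2 := flatLie_flatBracket hW' hK' hL' hθ.contDiffOn (hWW hx) fun i => fderiv ℝ f x (v i)
  have hpK : ∀ {y}, y ∈ W → flatLie K θ₀ y =
      (flatLie K' θ (f y)).compContinuousLinearMap (fderiv ℝ f y) :=
    fun hy => flatLie_pullback hW hW' hf hWW hK' hKK hθ.contDiffOn hy
  have hpL : ∀ {y}, y ∈ W → flatLie L θ₀ y =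
      (flatLie L' θ (f y)).compContinuousLinearMap (fderiv ℝ f y) :=
    fun hy => flatLie_pullback hW hW' hf hWW hL' hLL hθ.contDiffOn hy
  have hKL : flatLie K (flatLie L θ₀) x = _ :=
    (flatLie_congr EventuallyEq.rfl
      (eventually_of_mem (hW.mem_nhds hx) fun y hy => hpL hy)).eq_of_nhds.trans
    (flatLie_pullback hW hW' hf hWW hK' hKK (ContDiffOn.flatLie hW' hL' hθ.contDiffOn) hx)
  have hLK : flatLie L (flatLie K θ₀) x = _ :=
    (flatLie_congr EventuallyEq.rfl
      (eventually_of_mem (hW.mem_nhds hx) fun y hy => hpK hy)).eq_of_nhds.trans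
    (flatLie_pullback hW hW' hf hWW hL' hLL (ContDiffOn.flatLie hW' hK' hθ.contDiffOn) hx)
  rw [hKL, hLK, e1] at h1
  rw [e2] at h2
  have h3 := h1.trans h2.symm
  exact mul_left_cancel₀ (pow_ne_zero _ (by norm_num)) h3

end Flat

/-! ### Forms in charts -/

section Charts

open Filter Topology

variable {E : Type*} [NormedAddCommGroup E] [NormedSpace ℝ E]
  {H : Type*} [TopologicalSpace H] {I : ModelWithCorners ℝ E H} [I.Boundaryless]
  {N : Type*} [TopologicalSpace N] [ChartedSpace H N] [IsManifold I ∞ N]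
  {E' : Type*} [NormedAddCommGroup E'] [NormedSpace ℝ E']
  {H' : Type*} [TopologicalSpace H'] {J : ModelWithCorners ℝ E' H'} [J.Boundaryless]
  {M : Type*} [TopologicalSpace M] [ChartedSpace H' M] [IsManifold J ∞ M]

/-- Without boundary the model has full range, so derivatives within the range are ordinary
derivatives. -/
theorem chartDeriv_chartInvDeriv (a : N) {y : E} (hy : y ∈ (extChartAt I a).target) (v : E) :
    chartDeriv I a ((extChartAt I a).symm y) (chartInvDeriv I a y v) = v := by
  have : IsManifold I 1 N := .of_le (n := ∞) (by simp)
  have h := mfderiv_extChartAt_comp_mfderivWithin_extChartAt_symm (I := I) hy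
  rw [I.range_eq_univ, mfderivWithin_univ] at h
  exact DFunLike.congr_fun h v

theorem chartInvDeriv_chartDeriv (a : N) {y : E} (hy : y ∈ (extChartAt I a).target)
    (v : TangentSpace I ((extChartAt I a).symm y)) :
    chartInvDeriv I a y (chartDeriv I a ((extChartAt I a).symm y) v) = v := by
  have : IsManifold I 1 N := .of_le (n := ∞) (by simp)
  have h := mfderivWithin_extChartAt_symm_comp_mfderiv_extChartAt (I := I) hy
  rw [I.range_eq_univ, mfderivWithin_univ] at h
  exact DFunLike.congr_fun h v

theorem exists_symm_eq (a : N) {q : N} (hq : q ∈ (extChartAt I a).source) :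
    ∃ y ∈ (extChartAt I a).target, (extChartAt I a).symm y = q :=
  ⟨extChartAt I a q, (extChartAt I a).map_source hq, (extChartAt I a).left_inv hq⟩

theorem chartDeriv_injective (a : N) {q : N} (hq : q ∈ (extChartAt I a).source) :
    Function.Injective (chartDeriv I a q) := by
  obtain ⟨y, hy, rfl⟩ := exists_symm_eq a hq
  exact Function.LeftInverse.injective (chartInvDeriv_chartDeriv a hy)

theorem FormField.inChart_chartDeriv {p : ℕ} (η : FormField I N p) (a : N) {q : N}
    (hq : q ∈ (extChartAt I a).source) (w : Fin p → TangentSpace I q) :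
    η.inChart a (extChartAt I a q) (fun i => chartDeriv I a q (w i)) = η q w := by
  obtain ⟨y, hy, rfl⟩ := exists_symm_eq a hq
  rw [(extChartAt I a).right_inv hy]
  change η _ (fun i => chartInvDeriv I a y (chartDeriv I a _ (w i))) = _
  simp only [chartInvDeriv_chartDeriv a hy]

theorem VectorFormField.inChart_chartDeriv {k : ℕ} (K : VectorFormField I N k) (a : N) {q : N}
    (hq : q ∈ (extChartAt I a).source) (w : Fin k → TangentSpace I q) :
    K.inChart a (extChartAt I a q) (fun i => chartDeriv I a q (w i)) =
      chartDeriv I a q (K q w) := by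
  obtain ⟨y, hy, rfl⟩ := exists_symm_eq a hq
  rw [(extChartAt I a).right_inv hy]
  change chartDeriv I a _ (K _ (fun i => chartInvDeriv I a y (chartDeriv I a _ (w i)))) = _
  simp only [chartInvDeriv_chartDeriv a hy]

/-- The coordinate expression of a map. -/
def chartMap (I : ModelWithCorners ℝ E H) (J : ModelWithCorners ℝ E' H') (f : N → M) (a : N)
    (b : M) (y : E) : E' := extChartAt J b (f ((extChartAt I a).symm y))

/-- The domain of the coordinate expression of a map. -/
def chartDomain (I : ModelWithCorners ℝ E H) (J : ModelWithCorners ℝ E' H') (f : N → M) (a : N)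
    (b : M) : Set E :=
  (extChartAt I a).target ∩ (extChartAt I a).symm ⁻¹' (f ⁻¹' (extChartAt J b).source)

theorem isOpen_chartDomain {f : N → M} (hf : Continuous f) (a : N) (b : M) :
    IsOpen (chartDomain I J f a b) :=
  (continuousOn_extChartAt_symm (I := I) a).isOpen_inter_preimage (isOpen_extChartAt_target a)
    ((isOpen_extChartAt_source b).preimage hf)

theorem mapsTo_chartMap (f : N → M) (a : N) (b : M) :
    Set.MapsTo (chartMap I J f a b) (chartDomain I J f a b) (extChartAt J b).target :=
  fun _ hy => (extChartAt J b).map_source hy.2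

theorem contDiffOn_chartMap {f : N → M} (hf : ContMDiff I J ∞ f) (a : N) (b : M) :
    ContDiffOn ℝ ∞ (chartMap I J f a b) (chartDomain I J f a b) :=
  (contMDiff_iff.1 hf).2 a b

theorem fderiv_chartMap {f : N → M} {a : N} {b : M} {y : E} (hy : y ∈ chartDomain I J f a b)
    (hf : MDifferentiableAt I J f ((extChartAt I a).symm y)) (v : E) :
    fderiv ℝ (chartMap I J f a b) y v =
      chartDeriv J b (f ((extChartAt I a).symm y))
        (mfderiv I J f ((extChartAt I a).symm y) (chartInvDeriv I a y v)) := by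
  have : IsManifold I 1 N := .of_le (n := ∞) (by simp)
  have : IsManifold J 1 M := .of_le (n := ∞) (by simp)
  have h1 : MDifferentiableAt 𝓘(ℝ, E) I (extChartAt I a).symm y := by
    have := mdifferentiableWithinAt_extChartAt_symm (I := I) hy.1
    rwa [I.range_eq_univ, mdifferentiableWithinAt_univ] at this
  have h2 : MDifferentiableAt J 𝓘(ℝ, E') (extChartAt J b) (f ((extChartAt I a).symm y)) :=
    mdifferentiableAt_extChartAt (by simpa using hy.2)
  have h3 : mfderiv 𝓘(ℝ, E) 𝓘(ℝ, E') (chartMap I J f a b) y = _ :=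
    (h2.hasMFDerivAt.comp y (hf.hasMFDerivAt.comp y h1.hasMFDerivAt)).mfderiv
  rw [mfderiv_eq_fderiv] at h3
  exact DFunLike.congr_fun h3 v

/-- Relatedness of vector-valued forms by a smooth map, in charts. -/
theorem inChart_related {k : ℕ} {K : VectorFormField I N k} {K' : VectorFormField J M k} {f : N → M}
    (hf : ContMDiff I J ∞ f)
    (hK : ∀ (q : N) (X : Fin k → TangentSpace I q),
      mfderiv I J f q (K q X) = K' (f q) fun i => mfderiv I J f q (X i))
    {a : N} {b : M} {y : E} (hy : y ∈ chartDomain I J f a b) (v : Fin k → E) :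
    fderiv ℝ (chartMap I J f a b) y (K.inChart a y v) =
      K'.inChart b (chartMap I J f a b y) fun i => fderiv ℝ (chartMap I J f a b) y (v i) := by
  have hd := hf.mdifferentiableAt (x := (extChartAt I a).symm y) (by simp)
  simp only [fderiv_chartMap hy hd]
  rw [chartMap, VectorFormField.inChart_chartDeriv K' b hy.2, ← hK]
  change chartDeriv J b _ (mfderiv I J f _ (chartInvDeriv I a y (chartDeriv I a _ _))) = _
  rw [chartInvDeriv_chartDeriv a hy.1]
  rfl

/-- A transition map is the coordinate expression of the identity, so a change of chart is an
instance of pullback. -/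
theorem inChart_eq_pullback {p : ℕ} (η : FormField I N p) {a b : N} {y : E}
    (hy : y ∈ chartDomain I I (id : N → N) a b) :
    η.inChart a y = (η.inChart b (chartMap I I id a b y)).compContinuousLinearMap
      (fderiv ℝ (chartMap I I id a b) y) := by
  ext v
  rw [ContinuousAlternatingMap.compContinuousLinearMap_apply]
  have h : (⇑(fderiv ℝ (chartMap I I (id : N → N) a b) y) ∘ v) = fun i =>
      chartDeriv I b ((extChartAt I a).symm y) (chartInvDeriv I a y (v i)) := by
    ext i
    rw [Function.comp_apply, fderiv_chartMap hy mdifferentiableAt_id, mfderiv_id]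
    rfl
  rw [h, chartMap]
  exact (FormField.inChart_chartDeriv η b hy.2 _).symm

/-- The differential is defined at each point in that point's own chart. It agrees with the one in a
fixed chart because `extDeriv` commutes with pullback by the transition map. -/
theorem extDifferential_inChart {p : ℕ} {η : FormField I N p} (hη : η ∈ smoothForms I N p) (a : N)
    {y : E} (hy : y ∈ (extChartAt I a).target) :
    (extDifferential η).inChart a y = extDeriv (η.inChart a) y := by
  set q := (extChartAt I a).symm y with hq
  have hyd : y ∈ chartDomain I I (id : N → N) a q := ⟨hy, mem_extChartAt_source q⟩
  have hopen := isOpen_chartDomain (I := I) (J := I) (f := (id : N → N)) continuous_id a q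
  have h1 : η.inChart a =ᶠ[𝓝 y] fun z =>
      (η.inChart q (chartMap I I id a q z)).compContinuousLinearMap (fderiv ℝ (chartMap I I id a q) z) :=
    eventually_of_mem (hopen.mem_nhds hyd) fun z hz => inChart_eq_pullback η hz
  have hs : ContDiffAt ℝ ∞ (η.inChart q) (chartMap I I id a q y) :=
    (hη q).contDiffAt ((isOpen_extChartAt_target q).mem_nhds (mapsTo_chartMap _ _ _ hyd))
  rw [h1.extDeriv_eq, extDeriv_pullback (r := ∞) (hs.differentiableAt (by simp))
    ((contDiffOn_chartMap contMDiff_id a q).contDiffAt (hopen.mem_nhds hyd))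
    (by simpa using WithTop.coe_le_coe.2 (OrderTop.le_top (2 : ℕ∞)))]
  ext v
  simp only [ContinuousAlternatingMap.compContinuousLinearMap_apply, FormField.inChart,
    extDifferential]
  change extDeriv (η.inChart q) (extChartAt I q q) _ = extDeriv (η.inChart q) (extChartAt I q q) _
  congr 1
  ext i
  simp only [Function.comp_apply]
  rw [fderiv_chartMap hyd mdifferentiableAt_id, mfderiv_id]
  rfl

theorem insertField_inChart {k p : ℕ} (K : VectorFormField I N k) (η : FormField I N (p + 1))
    (a : N) {y : E} (hy : y ∈ (extChartAt I a).target) :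
    (insertField K η).inChart a y = insertForm (K.inChart a y) (η.inChart a y) := by
  refine (insertForm_comp (chartInvDeriv I a y) (fun v => ?_) _).symm
  exact chartInvDeriv_chartDeriv a hy _

variable [FiniteDimensional ℝ E] [FiniteDimensional ℝ E']

theorem insertField_mem {k p : ℕ} {K : VectorFormField I N k} (hK : K ∈ vectorForms I N k)
    {η : FormField I N (p + 1)} (hη : η ∈ smoothForms I N (p + 1)) :
    insertField K η ∈ smoothForms I N (k + p) := fun a =>
  ((hK a).insertForm (hη a)).congr fun _ hy => insertField_inChart K η a hy

theorem lieDerivative_inChart {k p : ℕ} {K : VectorFormField I N k} (hK : K ∈ vectorForms I N k)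
    {η : FormField I N p} (hη : η ∈ smoothForms I N p) (a : N) {y : E}
    (hy : y ∈ (extChartAt I a).target) :
    (lieDerivative K η).inChart a y = flatLie (K.inChart a) (η.inChart a) y := by
  cases p with
  | zero =>
    have h : (lieDerivative K η).inChart a y =
        (-1 : ℝ) ^ k • (insertField K (extDifferential η)).inChart a y := rfl
    rw [h, insertField_inChart _ _ _ hy, extDifferential_inChart hη a hy]
    rfl
  | succ p =>
    have h : (lieDerivative K η).inChart a y = (extDifferential (insertField K η)).inChart a y +
        (-1 : ℝ) ^ k • (insertField K (extDifferential η)).inChart a y := rfl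
    have h2 : (insertField K η).inChart a =ᶠ[𝓝 y]
        fun z => insertForm (K.inChart a z) (η.inChart a z) :=
      eventually_of_mem ((isOpen_extChartAt_target a).mem_nhds hy) fun z hz =>
        insertField_inChart K η a hz
    rw [h, insertField_inChart _ _ _ hy, extDifferential_inChart hη a hy,
      extDifferential_inChart (insertField_mem hK hη) a hy, h2.extDeriv_eq]
    rfl

theorem lieDerivative_mem {k p : ℕ} {K : VectorFormField I N k} (hK : K ∈ vectorForms I N k)
    {η : FormField I N p} (hη : η ∈ smoothForms I N p) :
    lieDerivative K η ∈ smoothForms I N (k + p) := fun a =>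
  (ContDiffOn.flatLie (isOpen_extChartAt_target a) (hK a) (hη a)).congr fun _ hy =>
    lieDerivative_inChart hK hη a hy

/-- `B` is in every chart the Frölicher–Nijenhuis bracket of `K` and `L`. -/
def IsChartBracket {k l : ℕ} (K : VectorFormField I N k) (L : VectorFormField I N l)
    (B : VectorFormField I N (k + l)) : Prop :=
  ∀ (a : N), ∀ y ∈ (extChartAt I a).target, B.inChart a y =
    flatBracket (K.inChart a) (L.inChart a) y

theorem IsChartBracket.mem_vectorForms {k l : ℕ} {K : VectorFormField I N k}
    {L : VectorFormField I N l} {B : VectorFormField I N (k + l)} (h : IsChartBracket K L B)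
    (hK : K ∈ vectorForms I N k) (hL : L ∈ vectorForms I N l) : B ∈ vectorForms I N (k + l) :=
  fun a => (ContDiffOn.flatBracket (isOpen_extChartAt_target a) (hK a) (hL a)).congr (h a)

/-- Each Lie derivative becomes `flatLie` in the chart at `x`; locality allows this also for the
inner one in a composition, and then `flatLie_flatBracket` applies. -/
theorem IsChartBracket.isFrolicherNijenhuisBracket {k l : ℕ} {K : VectorFormField I N k}
    {L : VectorFormField I N l} {B : VectorFormField I N (k + l)} (h : IsChartBracket K L B)
    (hK : K ∈ vectorForms I N k) (hL : L ∈ vectorForms I N l) :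
    IsFrolicherNijenhuisBracket K L B := by
  intro p η hη x X
  have hB := h.mem_vectorForms hK hL
  have hx := mem_extChartAt_source (I := I) x
  have hy := mem_extChartAt_target (I := I) x
  have hmem := (isOpen_extChartAt_target (I := I) x).mem_nhds hy
  rw [← FormField.inChart_chartDeriv _ x hx, ← FormField.inChart_chartDeriv _ x hx,
    ← FormField.inChart_chartDeriv (lieDerivative L (lieDerivative K η)) x hx,
    lieDerivative_inChart hB hη x hy, lieDerivative_inChart hK (lieDerivative_mem hL hη) x hy,
    lieDerivative_inChart hL (lieDerivative_mem hK hη) x hy,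
    (flatLie_congr (eventually_of_mem hmem (h x)) EventuallyEq.rfl).eq_of_nhds,
    (flatLie_congr EventuallyEq.rfl (eventually_of_mem hmem fun z hz =>
      lieDerivative_inChart hL hη x hz)).eq_of_nhds,
    (flatLie_congr EventuallyEq.rfl (eventually_of_mem hmem fun z hz =>
      lieDerivative_inChart hK hη x hz)).eq_of_nhds]
  exact flatLie_flatBracket (isOpen_extChartAt_target x) (hK x) (hL x) (hη x) hy _

/-- The Frölicher–Nijenhuis bracket, computed at each point in the preferred chart. -/
def fnBracket {k l : ℕ} (K : VectorFormField I N k) (L : VectorFormField I N l) :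
    VectorFormField I N (k + l) := fun x =>
  (chartDeriv I x x).inverse.compContinuousAlternatingMap
    ((flatBracket (K.inChart x) (L.inChart x) (extChartAt I x x)).compContinuousLinearMap
      (chartDeriv I x x))

theorem chartDeriv_fnBracket {k l : ℕ} (K : VectorFormField I N k) (L : VectorFormField I N l)
    (x : N) (X : Fin (k + l) → TangentSpace I x) :
    chartDeriv I x x (fnBracket K L x X) =
      flatBracket (K.inChart x) (L.inChart x) (extChartAt I x x)
        fun i => chartDeriv I x x (X i) := by
  have : IsManifold I 1 N := .of_le (n := ∞) (by simp)
  have hinv : (chartDeriv I x x).IsInvertible :=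
    isInvertible_mfderiv_extChartAt (mem_extChartAt_source (I := I) x)
  exact DFunLike.congr_fun hinv.self_comp_inverse _

/-- Independence of the chart: the transition map relates the two coordinate expressions of `K`, and
those of `L`, hence also their brackets by `flatBracket_related`. -/
theorem isChartBracket_fnBracket {k l : ℕ} {K : VectorFormField I N k} {L : VectorFormField I N l}
    (hK : K ∈ vectorForms I N k) (hL : L ∈ vectorForms I N l) :
    IsChartBracket K L (fnBracket K L) := by
  intro a y hy
  set q := (extChartAt I a).symm y with hq
  have hyd : y ∈ chartDomain I I (id : N → N) a q := ⟨hy, mem_extChartAt_source q⟩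
  have hopen := isOpen_chartDomain (I := I) (J := I) (f := (id : N → N)) continuous_id a q
  have hid : ∀ {k : ℕ} (K : VectorFormField I N k) (x : N) (X : Fin k → TangentSpace I x),
      mfderiv I I (id : N → N) x (K x X) = K (id x) fun i => mfderiv I I id x (X i) := by
    intro k K x X
    simp only [mfderiv_id]
    rfl
  ext v
  have h := flatBracket_related hopen (isOpen_extChartAt_target q)
    (contDiffOn_chartMap contMDiff_id a q) (mapsTo_chartMap _ _ _)
    ((hK a).mono Set.inter_subset_left) ((hL a).mono Set.inter_subset_left) (hK q) (hL q)
    (fun z hz w => inChart_related contMDiff_id (hid K) hz w)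
    (fun z hz w => inChart_related contMDiff_id (hid L) hz w) hyd v
  simp only [fderiv_chartMap hyd mdifferentiableAt_id, mfderiv_id] at h
  have h2 := h.trans (chartDeriv_fnBracket K L q fun i => chartInvDeriv I a y (v i)).symm
  have h3 := chartDeriv_injective q (mem_extChartAt_source (I := I) q) h2
  have h4 := congrArg (chartDeriv I a q) h3
  exact h4.symm.trans (chartDeriv_chartInvDeriv a hy _)

end Charts

/-! ### Existence and uniqueness of the bracket -/

section Uniqueness

open Filter Topology

variable {E : Type*} [NormedAddCommGroup E] [NormedSpace ℝ E] [FiniteDimensional ℝ E]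
  {H : Type*} [TopologicalSpace H] {I : ModelWithCorners ℝ E H} [I.Boundaryless]
  {N : Type*} [TopologicalSpace N] [ChartedSpace H N] [IsManifold I ∞ N] [T2Space N]

/-- A function as a form of degree zero. -/
def FormField.ofFun (g : N → ℝ) : FormField I N 0 := fun x =>
  ContinuousAlternatingMap.constOfIsEmpty ℝ _ (Fin 0) (g x)

theorem FormField.ofFun_mem {g : N → ℝ} (hg : ContMDiff I 𝓘(ℝ, ℝ) ∞ g) :
    FormField.ofFun g ∈ smoothForms I N 0 := by
  intro a
  have h := contDiffOn_chartMap hg a 0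
  have h2 : chartDomain I 𝓘(ℝ, ℝ) g a 0 = (extChartAt I a).target := by
    rw [chartDomain, extChartAt_model_space_eq_id]
    simp only [PartialEquiv.refl_source, Set.preimage_univ, Set.inter_univ]
  rw [h2] at h
  exact (ContinuousAlternatingMap.constOfIsEmptyLIE ℝ E ℝ (Fin 0)).contDiff.comp_contDiffOn h

/-- The function is `φ` of the chart times a bump function. The bump is one near `x`, so it does not
affect the differential there; Hausdorffness makes the extension by zero smooth. -/
theorem exists_smoothForm_extDifferential (x : N) (φ : E →L[ℝ] ℝ) :
    ∃ η ∈ smoothForms I N 0, extDifferential η x =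
      ContinuousAlternatingMap.ofSubsingleton ℝ (TangentSpace I x) ℝ (0 : Fin 1)
        (φ.comp (chartDeriv I x x)) := by
  let χ : SmoothBumpFunction I x := Classical.arbitrary _
  let g : N → ℝ := fun q => χ q • φ (extChartAt I x q)
  have hg : ContMDiff I 𝓘(ℝ, ℝ) ∞ g := by
    refine χ.contMDiff_smul ?_
    exact φ.contMDiff.comp_contMDiffOn contMDiffOn_extChartAt
  refine ⟨FormField.ofFun g, FormField.ofFun_mem hg, ?_⟩
  have h1 : (FormField.ofFun (I := I) g).inChart x =ᶠ[𝓝 (extChartAt I x x)] fun y =>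
      ContinuousAlternatingMap.constOfIsEmpty ℝ E (Fin 0) (φ y) := by
    have hc : Tendsto (extChartAt I x).symm (𝓝 (extChartAt I x x)) (𝓝 x) := by
      have := continuousAt_extChartAt_symm (I := I) x
      rwa [ContinuousAt, extChartAt_to_inv] at this
    filter_upwards [hc.eventually χ.eventuallyEq_one,
      (isOpen_extChartAt_target (I := I) x).mem_nhds (mem_extChartAt_target x)] with y h1 h2
    ext v
    change χ _ • φ _ = φ y
    rw [h1, (extChartAt I x).right_inv h2, Pi.one_apply, one_smul]
  rw [extDifferential, h1.extDeriv_eq, extDeriv_constOfIsEmpty, φ.fderiv]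
  rfl

/-- On functions the Lie derivative along `C` is `g ↦ (-1)^(k+l) dg ∘ C`, and differentials of
global functions separate tangent vectors. -/
theorem IsFrolicherNijenhuisBracket.unique {k l : ℕ} {K : VectorFormField I N k}
    {L : VectorFormField I N l} {B B' : VectorFormField I N (k + l)}
    (h : IsFrolicherNijenhuisBracket K L B) (h' : IsFrolicherNijenhuisBracket K L B') :
    B = B' := by
  ext x X
  apply chartDeriv_injective x (mem_extChartAt_source (I := I) x)
  refine SeparatingDual.eq_iff_forall_dual_eq (R := ℝ).2 fun φ => ?_
  obtain ⟨η, hη, hd⟩ := exists_smoothForm_extDifferential (I := I) x φ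
  have e : ∀ C : VectorFormField I N (k + l), lieDerivative C η x X =
      (-1) ^ (k + l) * φ (chartDeriv I x x (C x X)) := by
    intro C
    change (-1 : ℝ) ^ (k + l) * insertForm (C x) (extDifferential η x) X = _
    rw [hd, insertForm_ofSubsingleton]
    rfl
  have h1 := (h 0 η hη x X).trans (h' 0 η hη x X).symm
  rw [e, e] at h1
  exact mul_left_cancel₀ (pow_ne_zero _ (by norm_num)) h1

theorem IsFrolicherNijenhuisBracket.isChartBracket {k l : ℕ} {K : VectorFormField I N k}
    {L : VectorFormField I N l} {B : VectorFormField I N (k + l)}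
    (h : IsFrolicherNijenhuisBracket K L B) (hK : K ∈ vectorForms I N k)
    (hL : L ∈ vectorForms I N l) : IsChartBracket K L B := by
  have hc := isChartBracket_fnBracket hK hL
  rwa [← h.unique (hc.isFrolicherNijenhuisBracket hK hL)] at hc

theorem existsUnique_frolicherNijenhuisBracket {k l : ℕ} {K : VectorFormField I N k}
    {L : VectorFormField I N l} (hK : K ∈ vectorForms I N k) (hL : L ∈ vectorForms I N l) :
    ∃! B : VectorFormField I N (k + l),
      B ∈ vectorForms I N (k + l) ∧ IsFrolicherNijenhuisBracket K L B := by
  have hc := isChartBracket_fnBracket hK hL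
  exact ⟨fnBracket K L, ⟨hc.mem_vectorForms hK hL, hc.isFrolicherNijenhuisBracket hK hL⟩,
    fun B hB => hB.2.unique (hc.isFrolicherNijenhuisBracket hK hL)⟩

end Uniqueness

/-! ### Naturality of the bracket under maps of manifolds -/

section Related

variable {E : Type*} [NormedAddCommGroup E] [NormedSpace ℝ E] [FiniteDimensional ℝ E]
  {H : Type*} [TopologicalSpace H] {I : ModelWithCorners ℝ E H} [I.Boundaryless]
  {N : Type*} [TopologicalSpace N] [ChartedSpace H N] [IsManifold I ∞ N]
  {E' : Type*} [NormedAddCommGroup E'] [NormedSpace ℝ E'] [FiniteDimensional ℝ E']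
  {H' : Type*} [TopologicalSpace H'] {J : ModelWithCorners ℝ E' H'} [J.Boundaryless]
  {M : Type*} [TopologicalSpace M] [ChartedSpace H' M] [IsManifold J ∞ M]

/-- Brackets of forms related by a smooth map are related. -/
theorem IsChartBracket.related {k l : ℕ} {K : VectorFormField I N k} {L : VectorFormField I N l}
    {B : VectorFormField I N (k + l)} {K' : VectorFormField J M k} {L' : VectorFormField J M l}
    {B' : VectorFormField J M (k + l)} (hB : IsChartBracket K L B) (hB' : IsChartBracket K' L' B')
    (hK : K ∈ vectorForms I N k) (hL : L ∈ vectorForms I N l)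
    (hK' : K' ∈ vectorForms J M k) (hL' : L' ∈ vectorForms J M l) {f : N → M}
    (hf : ContMDiff I J ∞ f)
    (hKK : ∀ (q : N) (X : Fin k → TangentSpace I q),
      mfderiv I J f q (K q X) = K' (f q) fun i => mfderiv I J f q (X i))
    (hLL : ∀ (q : N) (X : Fin l → TangentSpace I q),
      mfderiv I J f q (L q X) = L' (f q) fun i => mfderiv I J f q (X i))
    (q : N) (X : Fin (k + l) → TangentSpace I q) :
    mfderiv I J f q (B q X) = B' (f q) fun i => mfderiv I J f q (X i) := by
  have hq := mem_extChartAt_source (I := I) q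
  have hfq := mem_extChartAt_source (I := J) (f q)
  obtain ⟨y, hy, hyq⟩ : ∃ y ∈ chartDomain I J f q (f q), (extChartAt I q).symm y = q := by
    refine ⟨extChartAt I q q, ⟨mem_extChartAt_target q, ?_⟩, extChartAt_to_inv q⟩
    simp
  -- The claim is stated at points of the form `(extChartAt I a).symm y`, where the tangent spaces
  -- match those of the chart lemmas; `q` is of this form only propositionally.
  have key : ∀ (a : N) (b : M) (y : E), y ∈ chartDomain I J f a b →
      ∀ X : Fin (k + l) → TangentSpace I ((extChartAt I a).symm y),
      mfderiv I J f _ (B _ X) = B' (f _) fun i => mfderiv I J f _ (X i) := by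
    intro a b y hy X
    have h := flatBracket_related (isOpen_chartDomain hf.continuous a b)
      (isOpen_extChartAt_target b) (contDiffOn_chartMap hf a b) (mapsTo_chartMap _ _ _)
      ((hK a).mono Set.inter_subset_left) ((hL a).mono Set.inter_subset_left) (hK' b) (hL' b)
      (fun z hz w => inChart_related hf hKK hz w)
      (fun z hz w => inChart_related hf hLL hz w) hy fun i => chartDeriv I a _ (X i)
    rw [← hB a y hy.1, ← hB' b _ (mapsTo_chartMap _ _ _ hy)] at h
    have hd := hf.mdifferentiableAt (x := (extChartAt I a).symm y) (by simp)
    simp only [fderiv_chartMap hy hd, chartInvDeriv_chartDeriv a hy.1] at h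
    rw [chartMap, VectorFormField.inChart_chartDeriv B' b hy.2] at h
    have h3 := chartDeriv_injective b hy.2 h
    rw [← h3]
    have h4 : B.inChart a y (fun i => chartDeriv I a _ (X i)) = chartDeriv I a _ (B _ X) := by
      have := VectorFormField.inChart_chartDeriv B a ((extChartAt I a).map_target hy.1) X
      rwa [(extChartAt I a).right_inv hy.1] at this
    rw [h4, chartInvDeriv_chartDeriv a hy.1]
  have h5 := key q (f q) y hy
  rw [hyq] at h5
  exact h5 X

end Related

/-! ### Brackets and maps from an open subset of a vector space -/

section FlatRelated

open Filter Topology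

variable {P : Type*} [NormedAddCommGroup P] [NormedSpace ℝ P]
  {E : Type*} [NormedAddCommGroup E] [NormedSpace ℝ E]
  {H : Type*} [TopologicalSpace H] {I : ModelWithCorners ℝ E H} [I.Boundaryless]
  {N : Type*} [TopologicalSpace N] [ChartedSpace H N] [IsManifold I ∞ N]

theorem fderiv_extChartAt_comp {f : P → N} {a : N} {w : P}
    (hf : MDifferentiableAt 𝓘(ℝ, P) I f w) (ha : f w ∈ (extChartAt I a).source) (v : P) :
    fderiv ℝ (extChartAt I a ∘ f) w v = chartDeriv I a (f w) (mfderiv 𝓘(ℝ, P) I f w v) := by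
  have : IsManifold I 1 N := .of_le (n := ∞) (by simp)
  have h2 : MDifferentiableAt I 𝓘(ℝ, E) (extChartAt I a) (f w) :=
    mdifferentiableAt_extChartAt (by simpa using ha)
  have h3 := (h2.hasMFDerivAt.comp w hf.hasMFDerivAt).mfderiv
  rw [mfderiv_eq_fderiv] at h3
  exact DFunLike.congr_fun h3 v

theorem contDiffOn_extChartAt_comp {f : P → N} {W : Set P}
    (hf : ContMDiffOn 𝓘(ℝ, P) I ∞ f W) (a : N) :
    ContDiffOn ℝ ∞ (extChartAt I a ∘ f) (W ∩ f ⁻¹' (extChartAt I a).source) := by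
  rw [← contMDiffOn_iff_contDiffOn]
  refine (contMDiffOn_extChartAt (x := a)).comp (hf.mono Set.inter_subset_left) fun w hw => ?_
  simpa using hw.2

variable [FiniteDimensional ℝ P] [FiniteDimensional ℝ E]

/-- If forms `A`, `C` on an open subset of a vector space are related to `K`, `L` by a smooth map,
then so are their brackets. -/
theorem IsChartBracket.related_flatBracket {k l : ℕ} {K : VectorFormField I N k}
    {L : VectorFormField I N l} {B : VectorFormField I N (k + l)} (hB : IsChartBracket K L B)
    (hK : K ∈ vectorForms I N k) (hL : L ∈ vectorForms I N l) {f : P → N} {W : Set P}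
    (hW : IsOpen W) (hf : ContMDiffOn 𝓘(ℝ, P) I ∞ f W) {A : P → P [⋀^Fin k]→L[ℝ] P}
    {C : P → P [⋀^Fin l]→L[ℝ] P} (hA : ContDiffOn ℝ ∞ A W) (hC : ContDiffOn ℝ ∞ C W)
    (hAK : ∀ w ∈ W, ∀ v : Fin k → P, mfderiv 𝓘(ℝ, P) I f w (A w v) =
      K (f w) fun i => mfderiv 𝓘(ℝ, P) I f w (v i))
    (hCL : ∀ w ∈ W, ∀ v : Fin l → P, mfderiv 𝓘(ℝ, P) I f w (C w v) =
      L (f w) fun i => mfderiv 𝓘(ℝ, P) I f w (v i))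
    {w : P} (hw : w ∈ W) (v : Fin (k + l) → P) :
    mfderiv 𝓘(ℝ, P) I f w (flatBracket A C w v) =
      B (f w) fun i => mfderiv 𝓘(ℝ, P) I f w (v i) := by
  set a := f w with ha
  set W' := W ∩ f ⁻¹' (extChartAt I a).source with hW'
  have hW'o : IsOpen W' := hf.continuousOn.isOpen_inter_preimage hW (isOpen_extChartAt_source a)
  have hw' : w ∈ W' := ⟨hw, mem_extChartAt_source (I := I) a⟩
  have hd : ∀ z ∈ W', MDifferentiableAt 𝓘(ℝ, P) I f z := fun z hz =>
    (hf.contMDiffAt (hW.mem_nhds hz.1)).mdifferentiableAt (by simp)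
  have rel : ∀ {j : ℕ} (A : P → P [⋀^Fin j]→L[ℝ] P) (K : VectorFormField I N j),
      (∀ w ∈ W, ∀ v : Fin j → P, mfderiv 𝓘(ℝ, P) I f w (A w v) =
        K (f w) fun i => mfderiv 𝓘(ℝ, P) I f w (v i)) →
      ∀ z ∈ W', ∀ v : Fin j → P, fderiv ℝ (extChartAt I a ∘ f) z (A z v) =
        K.inChart a ((extChartAt I a ∘ f) z) fun i => fderiv ℝ (extChartAt I a ∘ f) z (v i) := by
    intro j A K h z hz v
    simp only [fderiv_extChartAt_comp (hd z hz) hz.2, h z hz.1]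
    exact (VectorFormField.inChart_chartDeriv K a hz.2 _).symm
  have h := flatBracket_related hW'o (isOpen_extChartAt_target a)
    (contDiffOn_extChartAt_comp hf a) (fun z hz => (extChartAt I a).map_source hz.2)
    (hA.mono Set.inter_subset_left) (hC.mono Set.inter_subset_left) (hK a) (hL a)
    (rel A K hAK) (rel C L hCL) hw' v
  rw [← hB a ((extChartAt I a ∘ f) w) ((extChartAt I a).map_source hw'.2)] at h
  simp only [fderiv_extChartAt_comp (hd w hw') hw'.2] at h
  exact chartDeriv_injective a hw'.2
    (h.trans (VectorFormField.inChart_chartDeriv B a hw'.2 _))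

end FlatRelated

/-! ### Submersions in local coordinates -/

section Submersion

universe u

variable {E : Type u} [NormedAddCommGroup E] [NormedSpace ℝ E]
  {H : Type*} [TopologicalSpace H] {I : ModelWithCorners ℝ E H} [I.Boundaryless]
  {N : Type*} [TopologicalSpace N] [ChartedSpace H N] [IsManifold I ∞ N]
  {E' : Type*} [NormedAddCommGroup E'] [NormedSpace ℝ E']
  {H' : Type*} [TopologicalSpace H'] {J : ModelWithCorners ℝ E' H'} [J.Boundaryless]
  {M : Type*} [TopologicalSpace M] [ChartedSpace H' M] [IsManifold J ∞ M]

variable (I J) in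
/-- Smooth coordinates on open subsets of `N` and `M` in which `f : N → M` is the projection
`E' × F → E'`: `dom` are the coordinates on `N`, with inverse `symm`, and `cod` those on `M`. -/
structure SubmersionCoords (f : N → M) (F : Type*) [NormedAddCommGroup F] [NormedSpace ℝ F] where
  dom : N → E' × F
  symm : E' × F → N
  cod : M → E'
  source : Set N
  target : Set (E' × F)
  codSource : Set M
  isOpen_source : IsOpen source
  isOpen_target : IsOpen target
  isOpen_codSource : IsOpen codSource
  mapsTo_dom : Set.MapsTo dom source target
  mapsTo_symm : Set.MapsTo symm target source
  mapsTo_map : Set.MapsTo f source codSource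
  left_inv : ∀ q ∈ source, symm (dom q) = q
  right_inv : ∀ u ∈ target, dom (symm u) = u
  injOn_cod : Set.InjOn cod codSource
  fst_dom : ∀ q ∈ source, (dom q).1 = cod (f q)
  contMDiffOn_dom : ContMDiffOn I 𝓘(ℝ, E' × F) ∞ dom source
  contMDiffOn_symm : ContMDiffOn 𝓘(ℝ, E' × F) I ∞ symm target
  contMDiffOn_cod : ContMDiffOn J 𝓘(ℝ, E') ∞ cod codSource

/-- The local normal form of a submersion. Its domain is shrunk into the chart at `a`, so that one
coordinate expression of a form serves on all of it. -/
theorem Manifold.IsSubmersion.exists_coords [FiniteDimensional ℝ E] {f : N → M}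
    (hf : Manifold.IsSubmersion I J ∞ f) (a : N) :
    ∃ (F : Type u) (_ : NormedAddCommGroup F) (_ : NormedSpace ℝ F) (_ : FiniteDimensional ℝ F)
      (c : SubmersionCoords I J f F), a ∈ c.source ∧ c.source ⊆ (extChartAt I a).source := by
  obtain ⟨F, _, _, h⟩ := hf.isSubmersionAt a
  have : FiniteDimensional ℝ F := by
    -- The complement `F` embeds into `E` through the splitting `E ≃ E' × F`.
    refine FiniteDimensional.of_injective
      (h.equiv.symm.toLinearMap ∘ₗ LinearMap.inr ℝ E' F) ?_
    exact h.equiv.symm.injective.comp LinearMap.inr_injective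
  let φ := h.domChart.extend I
  let S := φ.source ∩ (extChartAt I a).source
  have hφs : φ.source = h.domChart.source := h.domChart.extend_source
  have hsymm : ContMDiffOn 𝓘(ℝ, E) I ∞ φ.symm φ.target := by
    have := contMDiffOn_extend_symm h.domChart_mem_maximalAtlas
    rwa [← h.domChart.extend_target'] at this
  have hTo : IsOpen (φ.target ∩ φ.symm ⁻¹' (extChartAt I a).source) :=
    hsymm.continuousOn.isOpen_inter_preimage h.domChart.isOpen_extend_target
      (isOpen_extChartAt_source a)
  have hequiv : ContMDiff 𝓘(ℝ, E) 𝓘(ℝ, E' × F) ∞ h.equiv := h.equiv.contDiff.contMDiff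
  have hequiv' : ContMDiff 𝓘(ℝ, E' × F) 𝓘(ℝ, E) ∞ h.equiv.symm := h.equiv.symm.contDiff.contMDiff
  refine ⟨F, inferInstance, inferInstance, this,
    { dom := fun q => h.equiv (φ q)
      symm := fun u => φ.symm (h.equiv.symm u)
      cod := h.codChart.extend J
      source := S
      target := h.equiv.symm ⁻¹' (φ.target ∩ φ.symm ⁻¹' (extChartAt I a).source)
      codSource := h.codChart.source
      isOpen_source := h.domChart.isOpen_extend_source.inter (isOpen_extChartAt_source a)
      isOpen_target := hTo.preimage h.equiv.symm.continuous
      isOpen_codSource := h.codChart.open_source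
      mapsTo_dom := fun q hq => by
        simpa [φ.left_inv hq.1] using ⟨φ.map_source hq.1, by simpa [S] using hq.2⟩
      mapsTo_symm := fun u hu => ⟨φ.map_target hu.1, hu.2⟩
      mapsTo_map := fun q hq => h.source_subset_preimage_source (hφs ▸ hq.1)
      left_inv := fun q hq => by simp [φ.left_inv hq.1]
      right_inv := fun u hu => by simp [φ.right_inv hu.1]
      injOn_cod := fun x hx y hy hxy => (h.codChart.extend J).injOn
        (by rwa [h.codChart.extend_source]) (by rwa [h.codChart.extend_source]) hxy
      fst_dom := fun q hq => by
        have := h.writtenInCharts (φ.map_source hq.1)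
        simp only [Function.comp_apply] at this
        rw [← this]
        exact congrArg (fun z => h.codChart.extend J (f z)) (φ.left_inv hq.1)
      contMDiffOn_dom := hequiv.comp_contMDiffOn
        ((OpenPartialHomeomorph.contMDiffOn_extend h.domChart_mem_maximalAtlas).mono
          fun q hq => hφs ▸ hq.1)
      contMDiffOn_symm := hsymm.comp hequiv'.contMDiffOn fun u hu => hu.1
      contMDiffOn_cod :=
        OpenPartialHomeomorph.contMDiffOn_extend h.codChart_mem_maximalAtlas },
    ⟨hφs ▸ h.mem_domChart_source, mem_extChartAt_source a⟩, Set.inter_subset_right⟩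

end Submersion

/-! ### Coordinates on a fibre product -/

namespace SubmersionCoords

open Filter Topology

variable {E : Type*} [NormedAddCommGroup E] [NormedSpace ℝ E]
  {H : Type*} [TopologicalSpace H] {I : ModelWithCorners ℝ E H} [I.Boundaryless]
  {N : Type*} [TopologicalSpace N] [ChartedSpace H N] [IsManifold I ∞ N]
  {E' : Type*} [NormedAddCommGroup E'] [NormedSpace ℝ E']
  {H' : Type*} [TopologicalSpace H'] {J : ModelWithCorners ℝ E' H'} [J.Boundaryless]
  {M : Type*} [TopologicalSpace M] [ChartedSpace H' M] [IsManifold J ∞ M]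
  {F : Type*} [NormedAddCommGroup F] [NormedSpace ℝ F] {s : N → M}
  (c : SubmersionCoords I J s F)

/-- The differential of the coordinates on the domain of a submersion. -/
def deriv (q : N) : TangentSpace I q →L[ℝ] E' × F :=
  (NormedSpace.fromTangentSpace (𝕜 := ℝ) (c.dom q)).toContinuousLinearMap.comp
    (mfderiv I 𝓘(ℝ, E' × F) c.dom q)

theorem mdifferentiableAt_dom {q : N} (hq : q ∈ c.source) :
    MDifferentiableAt I 𝓘(ℝ, E' × F) c.dom q :=
  (c.contMDiffOn_dom.contMDiffAt (c.isOpen_source.mem_nhds hq)).mdifferentiableAt (by simp)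

theorem mdifferentiableAt_cod {x : M} (hx : x ∈ c.codSource) :
    MDifferentiableAt J 𝓘(ℝ, E') c.cod x :=
  (c.contMDiffOn_cod.contMDiffAt (c.isOpen_codSource.mem_nhds hx)).mdifferentiableAt (by simp)

theorem deriv_injective {q : N} (hq : q ∈ c.source) : Function.Injective (c.deriv q) := by
  have h1 : MDifferentiableAt 𝓘(ℝ, E' × F) I c.symm (c.dom q) :=
    (c.contMDiffOn_symm.contMDiffAt
      (c.isOpen_target.mem_nhds (c.mapsTo_dom hq))).mdifferentiableAt (by simp)
  have h2 := (h1.hasMFDerivAt.comp q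
    (c.mdifferentiableAt_dom hq).hasMFDerivAt).congr_of_eventuallyEq
    (f₁ := id) (eventually_of_mem (c.isOpen_source.mem_nhds hq)
      fun q' hq' => (c.left_inv q' hq').symm)
  have h3 := h2.mfderiv
  rw [mfderiv_id] at h3
  exact Function.LeftInverse.injective (g := mfderiv 𝓘(ℝ, E' × F) I c.symm (c.dom q))
    fun X => (DFunLike.congr_fun h3 X).symm

/-- The derivative of the identity that the first coordinate is `cod ∘ s`. -/
theorem fst_deriv (hs : ContMDiff I J ∞ s) {q : N} (hq : q ∈ c.source) (X : TangentSpace I q) :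
    (c.deriv q X).1 = mfderiv J 𝓘(ℝ, E') c.cod (s q) (mfderiv I J s q X) := by
  have h1 := (c.mdifferentiableAt_cod (c.mapsTo_map hq)).hasMFDerivAt.comp q
    (hs.mdifferentiableAt (x := q) (by simp)).hasMFDerivAt
  have h2 := ((ContinuousLinearMap.fst ℝ E' F).hasMFDerivAt.comp q
    (c.mdifferentiableAt_dom hq).hasMFDerivAt).congr_of_eventuallyEq (f₁ := c.cod ∘ s)
    (eventually_of_mem (c.isOpen_source.mem_nhds hq) fun q' hq' => (c.fst_dom q' hq').symm)
  exact DFunLike.congr_fun (h2.mfderiv.symm.trans h1.mfderiv) X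

variable (t : N → M) (b : N)

/-- The second component of the parametrization of `{(q, r) | s q = t r}` by `E × F`. -/
def pairSnd (_c : SubmersionCoords I J s F) (b : N) (w : E × F) : N := (extChartAt I b).symm w.1

/-- The common value of `s` and `t` on the parametrized pairs, in coordinates. -/
def pairBase (y : E) : E' := c.cod (t ((extChartAt I b).symm y))

/-- The first component of the parametrization of `{(q, r) | s q = t r}` by `E × F`. -/
def pairFst (w : E × F) : N := c.symm (c.pairBase t b w.1, w.2)

/-- The domain of `pairBase`. -/
def baseDomain : Set E :=
  (extChartAt I b).target ∩ (extChartAt I b).symm ⁻¹' (t ⁻¹' c.codSource)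

/-- The domain of the parametrization of `{(q, r) | s q = t r}`. -/
def pairDomain : Set (E × F) :=
  (Prod.fst ⁻¹' c.baseDomain t b) ∩ (fun w => (c.pairBase t b w.1, w.2)) ⁻¹' c.target

variable {t b}

theorem isOpen_baseDomain (ht : ContMDiff I J ∞ t) : IsOpen (c.baseDomain t b) :=
  (continuousOn_extChartAt_symm (I := I) b).isOpen_inter_preimage (isOpen_extChartAt_target b)
    (c.isOpen_codSource.preimage ht.continuous)

theorem contDiffOn_pairBase (ht : ContMDiff I J ∞ t) :
    ContDiffOn ℝ ∞ (c.pairBase t b) (c.baseDomain t b) := by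
  rw [← contMDiffOn_iff_contDiffOn]
  refine c.contMDiffOn_cod.comp (t := c.codSource) ?_ fun y hy => hy.2
  exact ht.comp_contMDiffOn ((contMDiffOn_extChartAt_symm b).mono Set.inter_subset_left)

theorem contDiffOn_pairBase_prod (ht : ContMDiff I J ∞ t) :
    ContDiffOn ℝ ∞ (fun w : E × F => (c.pairBase t b w.1, w.2))
      (Prod.fst ⁻¹' c.baseDomain t b) :=
  ((c.contDiffOn_pairBase ht).comp contDiffOn_fst fun _ hw => hw).prodMk contDiffOn_snd

theorem isOpen_pairDomain (ht : ContMDiff I J ∞ t) : IsOpen (c.pairDomain t b) :=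
  (c.contDiffOn_pairBase_prod ht).continuousOn.isOpen_inter_preimage
    ((c.isOpen_baseDomain ht).preimage continuous_fst) c.isOpen_target

theorem contMDiffOn_pairFst (ht : ContMDiff I J ∞ t) :
    ContMDiffOn 𝓘(ℝ, E × F) I ∞ (c.pairFst t b) (c.pairDomain t b) :=
  c.contMDiffOn_symm.comp
    ((c.contDiffOn_pairBase_prod ht).mono Set.inter_subset_left).contMDiffOn fun _ hw => hw.2

theorem contMDiffOn_pairSnd :
    ContMDiffOn 𝓘(ℝ, E × F) I ∞ (c.pairSnd b) (c.pairDomain t b) :=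
  (contMDiffOn_extChartAt_symm b).comp contDiff_fst.contMDiff.contMDiffOn fun _ hw => hw.1.1

theorem mapsTo_pairFst : Set.MapsTo (c.pairFst t b) (c.pairDomain t b) c.source :=
  fun _ hw => c.mapsTo_symm hw.2

theorem dom_pairFst {w : E × F} (hw : w ∈ c.pairDomain t b) :
    c.dom (c.pairFst t b w) = (c.pairBase t b w.1, w.2) := c.right_inv _ hw.2

theorem map_pairFst {w : E × F} (hw : w ∈ c.pairDomain t b) :
    s (c.pairFst t b w) = t (c.pairSnd b w) := by
  have hq := c.mapsTo_pairFst hw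
  refine c.injOn_cod (c.mapsTo_map hq) hw.1.2 ?_
  rw [← c.fst_dom _ hq, c.dom_pairFst hw]
  rfl

/-- The parameters are the chart coordinates of `r` and the fibre coordinates of `q`; the base
coordinates of `q` are then forced by `s q = t r`. -/
theorem exists_mem_pairDomain {q r : N} (hq : q ∈ c.source) (hqr : s q = t r) :
    ∃ w ∈ c.pairDomain t r, c.pairFst t r w = q ∧ c.pairSnd r w = r := by
  have hr : (extChartAt I r).symm (extChartAt I r r) = r := extChartAt_to_inv r
  have hd : (c.pairBase t r (extChartAt I r r), (c.dom q).2) = c.dom q := by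
    refine Prod.ext ?_ rfl
    rw [c.fst_dom q hq, hqr, pairBase, hr]
  refine ⟨(extChartAt I r r, (c.dom q).2), ⟨⟨mem_extChartAt_target r, ?_⟩, ?_⟩, ?_, hr⟩
  · change t _ ∈ c.codSource
    rw [hr, ← hqr]
    exact c.mapsTo_map hq
  · change (_, _) ∈ c.target
    rw [hd]
    exact c.mapsTo_dom hq
  · change c.symm (_, _) = q
    rw [hd, c.left_inv q hq]

theorem mdifferentiableAt_pairFst (ht : ContMDiff I J ∞ t) {w : E × F}
    (hw : w ∈ c.pairDomain t b) : MDifferentiableAt 𝓘(ℝ, E × F) I (c.pairFst t b) w :=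
  ((c.contMDiffOn_pairFst ht).contMDiffAt
    ((c.isOpen_pairDomain ht).mem_nhds hw)).mdifferentiableAt (by simp)

theorem mdifferentiableAt_pairSnd (ht : ContMDiff I J ∞ t) {w : E × F}
    (hw : w ∈ c.pairDomain t b) : MDifferentiableAt 𝓘(ℝ, E × F) I (c.pairSnd b) w :=
  (c.contMDiffOn_pairSnd.contMDiffAt
    ((c.isOpen_pairDomain ht).mem_nhds hw)).mdifferentiableAt (by simp)

theorem mfderiv_pairSnd {w : E × F} (hw : w ∈ c.pairDomain t b) (v : E × F) :
    mfderiv 𝓘(ℝ, E × F) I (c.pairSnd b) w v = chartInvDeriv I b w.1 v.1 := by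
  have : IsManifold I 1 N := .of_le (n := ∞) (by simp)
  have h1 : MDifferentiableAt 𝓘(ℝ, E) I (extChartAt I b).symm w.1 := by
    have := mdifferentiableWithinAt_extChartAt_symm (I := I) hw.1.1
    rwa [I.range_eq_univ, mdifferentiableWithinAt_univ] at this
  have h2 := (h1.hasMFDerivAt.comp w (ContinuousLinearMap.fst ℝ E F).hasMFDerivAt).mfderiv
  exact DFunLike.congr_fun h2 v

theorem fderiv_pairBase (ht : ContMDiff I J ∞ t) {y : E} (hy : y ∈ c.baseDomain t b) (v : E) :
    fderiv ℝ (c.pairBase t b) y v = mfderiv J 𝓘(ℝ, E') c.cod (t ((extChartAt I b).symm y))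
      (mfderiv I J t _ (chartInvDeriv I b y v)) := by
  have : IsManifold I 1 N := .of_le (n := ∞) (by simp)
  have h1 : MDifferentiableAt 𝓘(ℝ, E) I (extChartAt I b).symm y := by
    have := mdifferentiableWithinAt_extChartAt_symm (I := I) hy.1
    rwa [I.range_eq_univ, mdifferentiableWithinAt_univ] at this
  have h2 : mfderiv 𝓘(ℝ, E) 𝓘(ℝ, E') (c.pairBase t b) y = _ :=
    ((c.mdifferentiableAt_cod hy.2).hasMFDerivAt.comp y
      ((ht.mdifferentiableAt (by simp)).hasMFDerivAt.comp y h1.hasMFDerivAt)).mfderiv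
  rw [mfderiv_eq_fderiv] at h2
  exact DFunLike.congr_fun h2 v

theorem deriv_mfderiv_pairFst (ht : ContMDiff I J ∞ t) {w : E × F} (hw : w ∈ c.pairDomain t b)
    (v : E × F) : c.deriv (c.pairFst t b w) (mfderiv 𝓘(ℝ, E × F) I (c.pairFst t b) w v) =
      (fderiv ℝ (c.pairBase t b) w.1 v.1, v.2) := by
  have h1 := ((c.mdifferentiableAt_dom (c.mapsTo_pairFst hw)).hasMFDerivAt.comp w
    (c.mdifferentiableAt_pairFst ht hw).hasMFDerivAt).mfderiv
  have h2 : c.dom ∘ c.pairFst t b =ᶠ[𝓝 w] fun w => (c.pairBase t b w.1, w.2) :=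
    eventually_of_mem ((c.isOpen_pairDomain ht).mem_nhds hw) fun z hz => c.dom_pairFst hz
  have h3 : HasFDerivAt (c.pairBase t b) (fderiv ℝ (c.pairBase t b) w.1) w.1 :=
    (((c.contDiffOn_pairBase ht).contDiffAt
      ((c.isOpen_baseDomain ht).mem_nhds hw.1)).differentiableAt (by simp)).hasFDerivAt
  have h4 := ((h3.comp w hasFDerivAt_fst).prodMk
    (hasFDerivAt_snd (p := w))).congr_of_eventuallyEq h2
  rw [mfderiv_eq_fderiv, h4.fderiv] at h1
  exact (DFunLike.congr_fun h1 v).symm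

theorem mfderiv_pairSnd_chartDeriv {w : E × F} (hw : w ∈ c.pairDomain t b)
    (Y : TangentSpace I (c.pairSnd b w)) (z : F) :
    mfderiv 𝓘(ℝ, E × F) I (c.pairSnd b) w (chartDeriv I b (c.pairSnd b w) Y, z) = Y := by
  rw [c.mfderiv_pairSnd hw]
  exact chartInvDeriv_chartDeriv b hw.1.1 Y

/-- With `mfderiv_pairSnd_chartDeriv` this lifts a compatible pair `(X, Y)` to the parameter space.
The fibre part of `X` is prescribed, and its base part agrees because `Ts X = Tt Y`. -/
theorem mfderiv_pairFst_deriv (hs : ContMDiff I J ∞ s) (ht : ContMDiff I J ∞ t) {w : E × F}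
    (hw : w ∈ c.pairDomain t b) (X : TangentSpace I (c.pairFst t b w))
    (Y : TangentSpace I (c.pairSnd b w))
    (hXY : tangentMap I J s ⟨c.pairFst t b w, X⟩ = tangentMap I J t ⟨c.pairSnd b w, Y⟩) :
    mfderiv 𝓘(ℝ, E × F) I (c.pairFst t b) w
      (chartDeriv I b (c.pairSnd b w) Y, (c.deriv (c.pairFst t b w) X).2) = X := by
  have hq := c.mapsTo_pairFst hw
  refine c.deriv_injective hq ?_
  rw [c.deriv_mfderiv_pairFst ht hw]
  refine Prod.ext ?_ rfl
  rw [c.fst_deriv hs hq, c.fderiv_pairBase ht hw.1]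
  have h := congrArg (fun Z : TangentBundle J M => (mfderiv J 𝓘(ℝ, E') c.cod Z.1 Z.2 : E')) hXY
  refine Eq.trans ?_ h.symm
  exact congrArg (fun Z => (mfderiv J 𝓘(ℝ, E') c.cod _ (mfderiv I J t _ Z) : E'))
    (chartInvDeriv_chartDeriv b hw.1.1 Y)

/-- The converse: differentiating `s ∘ pairFst = t ∘ pairSnd` shows that parameter directions give
compatible pairs. -/
theorem tangentMap_pairFst (hs : ContMDiff I J ∞ s) (ht : ContMDiff I J ∞ t) {w : E × F}
    (hw : w ∈ c.pairDomain t b) (v : E × F) :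
    tangentMap I J s ⟨c.pairFst t b w, mfderiv 𝓘(ℝ, E × F) I (c.pairFst t b) w v⟩ =
      tangentMap I J t ⟨c.pairSnd b w, mfderiv 𝓘(ℝ, E × F) I (c.pairSnd b) w v⟩ := by
  have h1 := tangentMap_comp_at (I := 𝓘(ℝ, E × F)) (⟨w, v⟩ : TangentBundle 𝓘(ℝ, E × F) (E × F))
    (hs.mdifferentiableAt (by simp)) (c.mdifferentiableAt_pairFst ht hw)
  have h2 := tangentMap_comp_at (I := 𝓘(ℝ, E × F)) (⟨w, v⟩ : TangentBundle 𝓘(ℝ, E × F) (E × F))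
    (ht.mdifferentiableAt (by simp)) (c.mdifferentiableAt_pairSnd ht hw)
  have h3 : s ∘ c.pairFst t b =ᶠ[𝓝 w] t ∘ c.pairSnd b :=
    eventually_of_mem ((c.isOpen_pairDomain ht).mem_nhds hw) fun z hz => c.map_pairFst hz
  have h4 : tangentMap 𝓘(ℝ, E × F) J (s ∘ c.pairFst t b) ⟨w, v⟩ =
      tangentMap 𝓘(ℝ, E × F) J (t ∘ c.pairSnd b) ⟨w, v⟩ := by
    refine Bundle.TotalSpace.ext h3.eq_of_nhds ?_
    exact heq_of_eq (DFunLike.congr_fun h3.mfderiv_eq v)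
  exact h1.symm.trans (h4.trans h2)

/-! ### The form induced on a fibre product -/

variable (t b)

/-- The last coordinates on the domain of the submersion, in the chart at `a`. -/
def fibreCoord (a : N) (y : E) : F := (c.dom ((extChartAt I a).symm y)).2

/-- The restriction of `K × K` to the parametrized fibre product. -/
def pairForm {k : ℕ} (K : VectorFormField I N k) (a : N) (w : E × F) :
    (E × F) [⋀^Fin k]→L[ℝ] (E × F) :=
  (ContinuousLinearMap.inl ℝ E F).compContinuousAlternatingMap
    ((K.inChart b w.1).compContinuousLinearMap (ContinuousLinearMap.fst ℝ E F)) +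
  (ContinuousLinearMap.inr ℝ E F).compContinuousAlternatingMap
    ((fderiv ℝ (c.fibreCoord a) (extChartAt I a (c.pairFst t b w))).compContinuousAlternatingMap
      ((K.inChart a (extChartAt I a (c.pairFst t b w))).compContinuousLinearMap
        (fderiv ℝ (extChartAt I a ∘ c.pairFst t b) w)))

variable {t b}

theorem fderiv_fibreCoord {a q : N} (hq : q ∈ c.source) (ha : q ∈ (extChartAt I a).source)
    (X : TangentSpace I q) :
    fderiv ℝ (c.fibreCoord a) (extChartAt I a q) (chartDeriv I a q X) = (c.deriv q X).2 := by
  have : IsManifold I 1 N := .of_le (n := ∞) (by simp)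
  obtain ⟨y, hy, rfl⟩ := exists_symm_eq a ha
  rw [(extChartAt I a).right_inv hy]
  have h1 : MDifferentiableAt 𝓘(ℝ, E) I (extChartAt I a).symm y := by
    have := mdifferentiableWithinAt_extChartAt_symm (I := I) hy
    rwa [I.range_eq_univ, mdifferentiableWithinAt_univ] at this
  have h2 : mfderiv 𝓘(ℝ, E) 𝓘(ℝ, F) (c.fibreCoord a) y = _ :=
    ((ContinuousLinearMap.snd ℝ E' F).hasMFDerivAt.comp y
      ((c.mdifferentiableAt_dom hq).hasMFDerivAt.comp y h1.hasMFDerivAt)).mfderiv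
  rw [mfderiv_eq_fderiv] at h2
  refine (DFunLike.congr_fun h2 _).trans ?_
  exact congrArg (fun Z => (c.deriv _ Z).2) (chartInvDeriv_chartDeriv a hy X)

/-- The definition in charts makes smoothness evident; this is its intrinsic meaning. The base
component of `K` at the first point is not recorded, since compatibility determines it from the
second. -/
theorem pairForm_apply (ht : ContMDiff I J ∞ t) {k : ℕ} (K : VectorFormField I N k) {a : N}
    (ha : c.source ⊆ (extChartAt I a).source) {w : E × F} (hw : w ∈ c.pairDomain t b)
    (v : Fin k → E × F) :
    c.pairForm t b K a w v =
      (chartDeriv I b (c.pairSnd b w)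
          (K (c.pairSnd b w) fun i => mfderiv 𝓘(ℝ, E × F) I (c.pairSnd b) w (v i)),
        (c.deriv (c.pairFst t b w)
          (K (c.pairFst t b w) fun i => mfderiv 𝓘(ℝ, E × F) I (c.pairFst t b) w (v i))).2) := by
  have hq := c.mapsTo_pairFst hw
  rw [← c.fderiv_fibreCoord hq (ha hq), ← VectorFormField.inChart_chartDeriv K a (ha hq)]
  simp only [← fderiv_extChartAt_comp (c.mdifferentiableAt_pairFst ht hw) (ha hq),
    c.mfderiv_pairSnd hw]
  refine Prod.ext ?_ ?_
  · exact add_zero _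
  · exact zero_add _

variable [FiniteDimensional ℝ E] [FiniteDimensional ℝ F]

theorem contDiffOn_pairForm (ht : ContMDiff I J ∞ t) {k : ℕ} {K : VectorFormField I N k}
    (hK : K ∈ vectorForms I N k) {a : N} (ha : c.source ⊆ (extChartAt I a).source) :
    ContDiffOn ℝ ∞ (c.pairForm t b K a) (c.pairDomain t b) := by
  have hU : IsOpen ((extChartAt I a).target ∩ (extChartAt I a).symm ⁻¹' c.source) :=
    (continuousOn_extChartAt_symm (I := I) a).isOpen_inter_preimage (isOpen_extChartAt_target a)
      c.isOpen_source
  have h1 : ContDiffOn ℝ ∞ (c.fibreCoord a)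
      ((extChartAt I a).target ∩ (extChartAt I a).symm ⁻¹' c.source) := by
    refine contDiff_snd.comp_contDiffOn ?_
    rw [← contMDiffOn_iff_contDiffOn]
    exact c.contMDiffOn_dom.comp ((contMDiffOn_extChartAt_symm a).mono Set.inter_subset_left)
      fun y hy => hy.2
  have h2 : ContDiffOn ℝ ∞ (extChartAt I a ∘ c.pairFst t b) (c.pairDomain t b) :=
    (contDiffOn_extChartAt_comp (c.contMDiffOn_pairFst ht) a).mono fun w hw =>
      ⟨hw, ha (c.mapsTo_pairFst hw)⟩
  have h3 : Set.MapsTo (extChartAt I a ∘ c.pairFst t b) (c.pairDomain t b)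
      ((extChartAt I a).target ∩ (extChartAt I a).symm ⁻¹' c.source) := fun w hw => by
    have hq := c.mapsTo_pairFst hw
    refine ⟨(extChartAt I a).map_source (ha hq), ?_⟩
    change (extChartAt I a).symm (extChartAt I a _) ∈ c.source
    rwa [(extChartAt I a).left_inv (ha hq)]
  have h4 := (h1.fderiv_of_isOpen (m := ∞) hU (by simp)).comp h2 h3
  have h5 := ((hK a).mono Set.inter_subset_left).comp h2 h3
  have h6 := h2.fderiv_of_isOpen (m := ∞) (c.isOpen_pairDomain ht) (by simp)
  have h7 := (hK b).comp contDiffOn_fst (s := c.pairDomain t b) fun w hw => hw.1.1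
  exact ((h7.alternating_comp contDiffOn_const).comp_alternating contDiffOn_const).add
    (((h5.alternating_comp h6).comp_alternating h4).comp_alternating contDiffOn_const)

end SubmersionCoords

/-! ### Multiplicative forms -/

namespace LieGroupoid

variable {E : Type*} [NormedAddCommGroup E] [NormedSpace ℝ E]
  {H : Type*} [TopologicalSpace H] {I : ModelWithCorners ℝ E H}
  {E' : Type*} [NormedAddCommGroup E'] [NormedSpace ℝ E']
  {H' : Type*} [TopologicalSpace H'] {J : ModelWithCorners ℝ E' H'}
  {G : Type*} [TopologicalSpace G] [ChartedSpace H G]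
  {M : Type*} [TopologicalSpace M] [ChartedSpace H' M] {𝒢 : LieGroupoid I J G M}

theorem tangentMul_add (g h : G) (X X' : TangentSpace I g) (Y Y' : TangentSpace I h) :
    𝒢.tangentMul g h (X + X') (Y + Y') = 𝒢.tangentMul g h X Y + 𝒢.tangentMul g h X' Y' :=
  map_add (mfderivWithin (I.prod I) I (fun q : G × G => 𝒢.mul q.1 q.2) 𝒢.composable (g, h))
    ((X, Y) : TangentSpace I g × TangentSpace I h) (X', Y')

theorem tangentMul_smul (r : ℝ) (g h : G) (X : TangentSpace I g) (Y : TangentSpace I h) :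
    𝒢.tangentMul g h (r • X) (r • Y) = r • 𝒢.tangentMul g h X Y :=
  map_smul (mfderivWithin (I.prod I) I (fun q : G × G => 𝒢.mul q.1 q.2) 𝒢.composable (g, h)) r
    ((X, Y) : TangentSpace I g × TangentSpace I h)

theorem Covers.zero {k : ℕ} :
    𝒢.Covers (0 : VectorFormField I G k) (0 : VectorFormField J M k) where
  source g _ := map_zero (mfderiv I J 𝒢.source g)
  target g _ := map_zero (mfderiv I J 𝒢.target g)
  mul g h _ _ _ _ := (map_zero (mfderivWithin (I.prod I) I (fun q : G × G => 𝒢.mul q.1 q.2)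
    𝒢.composable (g, h))).symm

theorem Covers.add {k : ℕ} {K L : VectorFormField I G k} {KM LM : VectorFormField J M k}
    (hK : 𝒢.Covers K KM) (hL : 𝒢.Covers L LM) : 𝒢.Covers (K + L) (KM + LM) where
  source g X := (map_add (mfderiv I J 𝒢.source g) (K g X) (L g X)).trans
    (congrArg₂ (· + ·) (hK.source g X) (hL.source g X))
  target g X := (map_add (mfderiv I J 𝒢.target g) (K g X) (L g X)).trans
    (congrArg₂ (· + ·) (hK.target g X) (hL.target g X))
  mul g h hgh X Y hXY := (congrArg₂ (· + ·) (hK.mul g h hgh X Y hXY) (hL.mul g h hgh X Y hXY)).trans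
    (tangentMul_add g h (K g X) (L g X) (K h Y) (L h Y)).symm

theorem Covers.smul {k : ℕ} (r : ℝ) {K : VectorFormField I G k} {KM : VectorFormField J M k}
    (hK : 𝒢.Covers K KM) : 𝒢.Covers (r • K) (r • KM) where
  source g X := (map_smul (mfderiv I J 𝒢.source g) r (K g X)).trans
    (congrArg (r • ·) (hK.source g X))
  target g X := (map_smul (mfderiv I J 𝒢.target g) r (K g X)).trans
    (congrArg (r • ·) (hK.target g X))
  mul g h hgh X Y hXY := (congrArg (r • ·) (hK.mul g h hgh X Y hXY)).trans
    (tangentMul_smul r g h (K g X) (K h Y)).symm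

variable (𝒢) in
/-- The space of smooth multiplicative vector-valued `k`-forms. -/
def multiplicativeForms (k : ℕ) : Submodule ℝ (VectorFormField I G k) where
  carrier := {K | K ∈ vectorForms I G k ∧ 𝒢.IsMultiplicative K}
  zero_mem' := ⟨Submodule.zero_mem _, 0, Submodule.zero_mem _, Covers.zero⟩
  add_mem' := fun ⟨hK, KM, hKM, hc⟩ ⟨hL, LM, hLM, hc'⟩ =>
    ⟨Submodule.add_mem _ hK hL, KM + LM, Submodule.add_mem _ hKM hLM, hc.add hc'⟩
  smul_mem' := fun r _ ⟨hK, KM, hKM, hc⟩ =>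
    ⟨Submodule.smul_mem _ r hK, r • KM, Submodule.smul_mem _ r hKM, hc.smul r⟩

/-- Source and target base points are equal only propositionally, so vectors are compared in the
total space. -/
theorem _root_.VectorFormField.mk_apply_congr {k : ℕ} (K : VectorFormField J M k) {x y : M}
    (hxy : x = y) {v : Fin k → TangentSpace J x} {w : Fin k → TangentSpace J y}
    (h : ∀ i, (⟨x, v i⟩ : TangentBundle J M) = ⟨y, w i⟩) :
    (⟨x, K x v⟩ : TangentBundle J M) = ⟨y, K y w⟩ := by
  subst hxy
  have : v = w := funext fun i => by simpa using h i
  rw [this]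

/-- Both sides equal `KM` on the common projections of the arguments. Hence `K × K` takes values
tangent to `G⁽²⁾`. -/
theorem Covers.tangentMap_eq {k : ℕ} {K : VectorFormField I G k} {KM : VectorFormField J M k}
    (hK : 𝒢.Covers K KM) {g h : G} (hgh : 𝒢.source g = 𝒢.target h)
    {X : Fin k → TangentSpace I g} {Y : Fin k → TangentSpace I h}
    (hXY : ∀ i, tangentMap I J 𝒢.source ⟨g, X i⟩ = tangentMap I J 𝒢.target ⟨h, Y i⟩) :
    tangentMap I J 𝒢.source ⟨g, K g X⟩ = tangentMap I J 𝒢.target ⟨h, K h Y⟩ := by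
  have h1 : tangentMap I J 𝒢.source ⟨g, K g X⟩ =
      ⟨𝒢.source g, KM (𝒢.source g) fun i => mfderiv I J 𝒢.source g (X i)⟩ :=
    congrArg (Bundle.TotalSpace.mk _) (hK.source g X)
  have h2 : tangentMap I J 𝒢.target ⟨h, K h Y⟩ =
      ⟨𝒢.target h, KM (𝒢.target h) fun i => mfderiv I J 𝒢.target h (Y i)⟩ :=
    congrArg (Bundle.TotalSpace.mk _) (hK.target h Y)
  rw [h1, h2]
  exact KM.mk_apply_congr hgh hXY

section Mul

variable {P : Type*} [NormedAddCommGroup P] [NormedSpace ℝ P] {f₁ f₂ : P → G} {W : Set P}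

theorem contMDiffOn_mul_comp (h₁ : ContMDiffOn 𝓘(ℝ, P) I ∞ f₁ W)
    (h₂ : ContMDiffOn 𝓘(ℝ, P) I ∞ f₂ W) (h : ∀ w ∈ W, 𝒢.source (f₁ w) = 𝒢.target (f₂ w)) :
    ContMDiffOn 𝓘(ℝ, P) I ∞ (fun w => 𝒢.mul (f₁ w) (f₂ w)) W :=
  𝒢.smooth_mul.comp (h₁.prodMk h₂) h

/-- The derivative of the multiplication is taken within `G⁽²⁾`, but the composite is defined on an
open set of parameters. There the derivative is unique, so the chain rule determines `tangentMul` on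
pairs of this kind. -/
theorem mfderiv_mul_comp (hW : IsOpen W) (h₁ : ContMDiffOn 𝓘(ℝ, P) I ∞ f₁ W)
    (h₂ : ContMDiffOn 𝓘(ℝ, P) I ∞ f₂ W) (h : ∀ w ∈ W, 𝒢.source (f₁ w) = 𝒢.target (f₂ w))
    {w : P} (hw : w ∈ W) (v : P) :
    mfderiv 𝓘(ℝ, P) I (fun w => 𝒢.mul (f₁ w) (f₂ w)) w v =
      𝒢.tangentMul (f₁ w) (f₂ w) (mfderiv 𝓘(ℝ, P) I f₁ w v) (mfderiv 𝓘(ℝ, P) I f₂ w v) := by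
  have d₁ := ((h₁.contMDiffAt (hW.mem_nhds hw)).mdifferentiableAt (by simp)).hasMFDerivAt
  have d₂ := ((h₂.contMDiffAt (hW.mem_nhds hw)).mdifferentiableAt (by simp)).hasMFDerivAt
  have dm : MDifferentiableWithinAt (I.prod I) I (fun q : G × G => 𝒢.mul q.1 q.2) 𝒢.composable
      (f₁ w, f₂ w) := (𝒢.smooth_mul (f₁ w, f₂ w) (h w hw)).mdifferentiableWithinAt (by simp)
  have hWc : W ⊆ (fun z => (f₁ z, f₂ z)) ⁻¹' 𝒢.composable := h
  have hc := (dm.hasMFDerivWithinAt.comp w (d₁.prodMk d₂).hasMFDerivWithinAt hWc).hasMFDerivAt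
    (hW.mem_nhds hw)
  exact DFunLike.congr_fun hc.mfderiv v

end Mul

variable [I.Boundaryless] [J.Boundaryless] [IsManifold I ∞ G] [IsManifold J ∞ M]
  [FiniteDimensional ℝ E'] [FiniteDimensional ℝ E]

/-- The bracket of multiplicative forms preserves multiplication. -/
theorem Covers.isChartBracket_mul {k l : ℕ} {K : VectorFormField I G k} {L : VectorFormField I G l}
    {KM : VectorFormField J M k} {LM : VectorFormField J M l} {B : VectorFormField I G (k + l)}
    (hcK : 𝒢.Covers K KM) (hcL : 𝒢.Covers L LM) (hK : K ∈ vectorForms I G k)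
    (hL : L ∈ vectorForms I G l) (hB : IsChartBracket K L B) (g h : G)
    (hgh : 𝒢.source g = 𝒢.target h)
    (X : Fin (k + l) → TangentSpace I g) (Y : Fin (k + l) → TangentSpace I h)
    (hXY : ∀ i, tangentMap I J 𝒢.source ⟨g, X i⟩ = tangentMap I J 𝒢.target ⟨h, Y i⟩) :
    B (𝒢.mul g h) (fun i => 𝒢.tangentMul g h (X i) (Y i)) =
      𝒢.tangentMul g h (B g X) (B h Y) := by
  have hs := 𝒢.submersion_source.contMDiff
  have ht := 𝒢.submersion_target.contMDiff
  obtain ⟨F, _, _, _, c, hg, hc⟩ := 𝒢.submersion_source.exists_coords g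
  obtain ⟨w, hw, hw₁, hw₂⟩ := c.exists_mem_pairDomain hg hgh
  set f₁ := c.pairFst 𝒢.target h with hf₁
  set f₂ := c.pairSnd h with hf₂
  set W := c.pairDomain 𝒢.target h with hW
  have hWo : IsOpen W := c.isOpen_pairDomain ht
  have hs₁ : ContMDiffOn 𝓘(ℝ, E × F) I ∞ f₁ W := c.contMDiffOn_pairFst ht
  have hs₂ : ContMDiffOn 𝓘(ℝ, E × F) I ∞ f₂ W := c.contMDiffOn_pairSnd
  have hst : ∀ z ∈ W, 𝒢.source (f₁ z) = 𝒢.target (f₂ z) := fun z hz => c.map_pairFst hz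
  have r₂ : ∀ {j : ℕ} (K : VectorFormField I G j) z, z ∈ W → ∀ v : Fin j → E × F,
      mfderiv 𝓘(ℝ, E × F) I f₂ z (c.pairForm 𝒢.target h K g z v) =
        K (f₂ z) fun i => mfderiv 𝓘(ℝ, E × F) I f₂ z (v i) := by
    intro j K z hz v
    rw [c.pairForm_apply ht K hc hz]
    exact c.mfderiv_pairSnd_chartDeriv hz _ _
  -- Unlike for the second projection, the base form is needed here: the base part of `K` at the
  -- first arrow has been replaced by data of the second.
  have r₁ : ∀ {j : ℕ} (K : VectorFormField I G j) (KM : VectorFormField J M j), 𝒢.Covers K KM →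
      ∀ z ∈ W, ∀ v : Fin j → E × F,
      mfderiv 𝓘(ℝ, E × F) I f₁ z (c.pairForm 𝒢.target h K g z v) =
        K (f₁ z) fun i => mfderiv 𝓘(ℝ, E × F) I f₁ z (v i) := by
    intro j K KM hK z hz v
    rw [c.pairForm_apply ht K hc hz]
    exact c.mfderiv_pairFst_deriv hs ht hz _ _
      (hK.tangentMap_eq (hst z hz) fun i => c.tangentMap_pairFst hs ht hz (v i))
  have rm : ∀ {j : ℕ} (K : VectorFormField I G j) (KM : VectorFormField J M j), 𝒢.Covers K KM →
      ∀ z ∈ W, ∀ v : Fin j → E × F,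
      mfderiv 𝓘(ℝ, E × F) I (fun w => 𝒢.mul (f₁ w) (f₂ w)) z (c.pairForm 𝒢.target h K g z v) =
        K (𝒢.mul (f₁ z) (f₂ z)) fun i =>
          mfderiv 𝓘(ℝ, E × F) I (fun w => 𝒢.mul (f₁ w) (f₂ w)) z (v i) := by
    intro j K KM hK z hz v
    simp only [mfderiv_mul_comp hWo hs₁ hs₂ hst hz]
    rw [r₁ K KM hK z hz, r₂ K z hz]
    exact (hK.mul _ _ (hst z hz) _ _ fun i => c.tangentMap_pairFst hs ht hz (v i)).symm
  have key : ∀ (X : Fin (k + l) → TangentSpace I (f₁ w)) (Y : Fin (k + l) → TangentSpace I (f₂ w)),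
      (∀ i, tangentMap I J 𝒢.source ⟨f₁ w, X i⟩ = tangentMap I J 𝒢.target ⟨f₂ w, Y i⟩) →
      B (𝒢.mul (f₁ w) (f₂ w)) (fun i => 𝒢.tangentMul (f₁ w) (f₂ w) (X i) (Y i)) =
        𝒢.tangentMul (f₁ w) (f₂ w) (B (f₁ w) X) (B (f₂ w) Y) := by
    intro X Y hXY
    have hA := c.contDiffOn_pairForm (b := h) ht hK hc
    have hC := c.contDiffOn_pairForm (b := h) ht hL hc
    let v : Fin (k + l) → E × F := fun i =>
      (chartDeriv I h (f₂ w) (Y i), (c.deriv (f₁ w) (X i)).2)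
    have hvX : ∀ i, mfderiv 𝓘(ℝ, E × F) I f₁ w (v i) = X i := fun i =>
      c.mfderiv_pairFst_deriv hs ht hw _ _ (hXY i)
    have hvY : ∀ i, mfderiv 𝓘(ℝ, E × F) I f₂ w (v i) = Y i := fun i =>
      c.mfderiv_pairSnd_chartDeriv hw _ _
    have e₁ := hB.related_flatBracket hK hL hWo hs₁ hA hC (r₁ K KM hcK) (r₁ L LM hcL) hw v
    have e₂ := hB.related_flatBracket hK hL hWo hs₂ hA hC (r₂ K) (r₂ L) hw v
    -- The same bracket on the parameter space is pushed forward by the two projections and by the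
    -- product. The chain rule expresses the third image through the first two, which is the claim.
    have em := hB.related_flatBracket hK hL hWo (contMDiffOn_mul_comp hs₁ hs₂ hst) hA hC
      (rm K KM hcK) (rm L LM hcL) hw v
    simp only [mfderiv_mul_comp hWo hs₁ hs₂ hst hw, e₁, e₂, hvX, hvY] at em
    exact em.symm
  rw [hw₁, hw₂] at key
  exact key X Y hXY

/-- The base form of the bracket is the bracket of the base forms, by naturality along source and
target. -/
theorem IsMultiplicative.isChartBracket {k l : ℕ} {K : VectorFormField I G k}
    {L : VectorFormField I G l} {B : VectorFormField I G (k + l)} (hmK : 𝒢.IsMultiplicative K)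
    (hmL : 𝒢.IsMultiplicative L) (hK : K ∈ vectorForms I G k) (hL : L ∈ vectorForms I G l)
    (hB : IsChartBracket K L B) : 𝒢.IsMultiplicative B := by
  obtain ⟨KM, hKM, hcK⟩ := hmK
  obtain ⟨LM, hLM, hcL⟩ := hmL
  have hBM := isChartBracket_fnBracket hKM hLM
  exact ⟨fnBracket KM LM, hBM.mem_vectorForms hKM hLM,
    hB.related hBM hK hL hKM hLM 𝒢.submersion_source.contMDiff hcK.source hcL.source,
    hB.related hBM hK hL hKM hLM 𝒢.submersion_target.contMDiff hcK.target hcL.target,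
    hcK.isChartBracket_mul hcL hK hL hB⟩

end LieGroupoid

end

theorem mainTheorem1
    {E : Type*} [NormedAddCommGroup E] [NormedSpace ℝ E] [FiniteDimensional ℝ E]
    {H : Type*} [TopologicalSpace H] {I : ModelWithCorners ℝ E H} [I.Boundaryless]
    {E' : Type*} [NormedAddCommGroup E'] [NormedSpace ℝ E'] [FiniteDimensional ℝ E']
    {H' : Type*} [TopologicalSpace H'] {J : ModelWithCorners ℝ E' H'} [J.Boundaryless]
    {G : Type*} [TopologicalSpace G] [ChartedSpace H G] [IsManifold I ∞ G] [T2Space G]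
    {M : Type*} [TopologicalSpace M] [ChartedSpace H' M] [IsManifold J ∞ M] [T2Space M]
    (𝒢 : LieGroupoid I J G M) :
    -- any two vector-valued forms have exactly one Frölicher–Nijenhuis bracket
    (∀ (k l : ℕ), ∀ K ∈ vectorForms I G k, ∀ L ∈ vectorForms I G l,
      ∃! B : VectorFormField I G (k + l),
        B ∈ vectorForms I G (k + l) ∧ IsFrolicherNijenhuisBracket K L B) ∧
    -- the bracket of multiplicative forms is multiplicative
    (∀ (k l : ℕ), ∀ K ∈ vectorForms I G k, ∀ L ∈ vectorForms I G l,
      𝒢.IsMultiplicative K → 𝒢.IsMultiplicative L →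
      ∀ B ∈ vectorForms I G (k + l), IsFrolicherNijenhuisBracket K L B →
        𝒢.IsMultiplicative B) ∧
    -- the multiplicative forms are a graded subspace, so they are a graded Lie subalgebra
    (∀ k : ℕ, ∃ S : Submodule ℝ (VectorFormField I G k),
      ∀ K, K ∈ S ↔ K ∈ vectorForms I G k ∧ 𝒢.IsMultiplicative K) := by
  refine ⟨fun k l K hK L hL => existsUnique_frolicherNijenhuisBracket hK hL,
    fun k l K hK L hL hmK hmL B _ hB =>
      hmK.isChartBracket hmL hK hL (hB.isChartBracket hK hL),
    fun k => ⟨𝒢.multiplicativeForms k, fun K => Iff.rfl⟩⟩
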